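/- Let $\mathbb K$ be a field of characteristic $0$, let $\mathcal P$ be a dg operad and $\mathcal C$ a dg cooperad over $\mathbb K$, and let $\alpha:\mathcal C\to\mathcal P$ be an operadic twisting morphism: a morphism of $\mathbb S$-modules of degree $-1$ with $\partial(\alpha)+\alpha\star\alpha=0$. Let $A$ be a dg $\mathcal P$-algebra and $C$ a dg $\mathcal C$-coalgebra with structure map $\Delta_C=(\Delta_C(n))_n:C\to\bigoplus_n(\mathcal C(n)\otimes C^{\otimes n})^{\mathbb S_n}$. For a $\mathcal P$-algebra $B$ and $\psi:C\to B$ of degree $0$, let $\star_\alpha(\psi):C\to B$ be the composite of $\Delta_C$, the identification of the invariants $(\mathcal C(n)\otimes C^{\otimes n})^{\mathbb S_n}$ with the coinvariants $\mathcal C(n)\otimes_{\mathbb S_n}C^{\otimes n}$ (inverse to the norm map $[x]\mapsto\sum_{\sigma\in\mathbb S_n}\sigma x$), the map $\mathcal C(C)\to\mathcal P(B)$ induced by $\alpha$ and $\psi$, and the structure map $\gamma_B:\mathcal P(B)\to B$. Let $\varphi:C\to A$ be an algebraic twisting morphism with respect to $\alpha$: a linear map of degree $0$ with $\partial(\varphi)+\star_\alpha(\varphi)=0$.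 For a dg $A$-module $N$, a map $\psi:C\to A$ of degree $0$ and a homogeneous linear map $g:C\to N$, put $\alpha[\psi,g]=\sum_{n\ge1}\alpha[\psi,g]_n:C\to N$, where $$\alpha[\psi,g]_n=\tfrac1{(n-1)!}\,\gamma_N\circ(\alpha\otimes\psi^{\otimes n-1}\otimes g)\circ\Delta_C(n)$$ with the Koszul sign $(-1)^{|g|(|\mu|+|c_1|+\cdots+|c_{n-1}|)}$ on $\mu\otimes c_1\otimes\cdots\otimes c_n$ (the factor $1/(n-1)!$ again comes from the norm identification of invariants and coinvariants, for $\mathbb S_{n-1}$). Then: 1. There is a quasi-free dg $\mathcal P$-algebra $\mathcal P\circ_\alpha C$ with underlying graded algebra $\mathcal P(C)=\bigoplus_n\mathcal P(n)\otimes_{\mathbb S_n}C^{\otimes n}$ and differential $d_\alpha=d_{\mathcal P\circ C}-\delta_\alpha^l$, where $\delta_\alpha^l$ is the derivation that is equal on $C$ to $\star_\alpha(\iota)$, with $\iota:C\to\mathcal P(C)$ the inclusion; and $\varphi$ extends to a morphism of dg $\mathcal P$-algebras $f_\varphi:\mathcal P\circ_\alpha C\to A$. 2. There is a dg $A$-module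 whose underlying graded module is the free $A$-module $A\otimes^{\mathcal P}C$ (the coequalizer of $\mathcal P(\mathcal P(A),C)\rightrightarrows\mathcal P(A,C)$), with differential $d_\varphi=d_{A\otimes^{\mathcal P}C}-\delta_\varphi^l$, where $\delta_\varphi^l$ is the $A$-linear map that is equal on the generators to $\alpha[\varphi,\iota]$, with $\iota:C\to A\otimes^{\mathcal P}C$ the inclusion. 3. For every dg $A$-module $M$, regarded as a $\mathcal P\circ_\alpha C$-module through $f_\varphi$, the following are dg modules, and they are isomorphic: $$(\mathrm{Der}_A(\mathcal P\circ_\alpha C,M),\ \partial)\;\cong\;(\mathrm{Hom}(C,M),\ \partial_\varphi)\;\cong\;(\mathrm{Hom}_{A\text{-mod}}(A\otimes^{\mathcal P}C,M),\ \partial_\varphi).$$ The elements of degree $n$ are the derivations, the linear maps, and the maps of $A$-modules of degree $n$, respectively; $\partial(D)=d_M D-(-1)^{|D|}D\,d_\alpha$ on derivations, $\partial_\varphi(g)=\partial(g)+\alpha[\varphi,g]=d_M g-(-1)^{|g|}g\,d_C+\alpha[\varphi,g]$ on $\mathrm{Hom}(C,M)$, and $\partial_\varphi(h)=d_M h-(-1)^{|h|}h\,d_\varphi$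 on maps of $A$-modules. The isomorphisms are given by the restrictions $D\mapsto D|_C$ and $h\mapsto h|_C$ to the generators. In particular this holds when $f_\varphi:\mathcal P\circ_\alpha C\to A$ is a quasi-free resolution of $A$; the dg $A$-module $(A\otimes^{\mathcal P}C,d_\varphi)$ is then a representation of the cotangent complex of $A$, with an explicit differential. -/

import Mathlib

open scoped TensorProduct BigOperators

universe u

namespace DGOperad

noncomputable section

/-! ## Signs -/

/-- The sign `(-1)^n` as an element of the ground field. -/
def ksign (K : Type u) [Field K] (n : ℤ) : K := ((n.negOnePow : ℤ) : K)

/-- The Koszul exponent of the reordering `(x_0, x_1, …) ↦ (x_{σ 0}, x_{σ 1}, …)` of homogeneous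
elements, where `x_j` has degree `e j`: one term for each pair that changes its order. -/
def permExp {m n : ℕ} (σ : Fin m ≃ Fin n) (e : Fin n → ℤ) : ℤ :=
  ∑ x : Fin m, ∑ y : Fin m, if x < y ∧ σ y < σ x then e (σ x) * e (σ y) else 0

/-- The sum of the degrees in front of position `j`. -/
def before {n : ℕ} (e : Fin n → ℤ) (j : Fin n) : ℤ := ∑ l ∈ Finset.Iio j, e l

/-- The Koszul exponent of the reordering
`ν_1 ⋯ ν_k x_{1,1} x_{1,2} ⋯ x_{k,i_k} ↦ ν_1 x_{1,1} x_{1,2} ⋯ ν_k x_{k,1} ⋯ x_{k,i_k}`,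
where `ν_j` has degree `q j` and `x_{j,l}` has degree `r ⟨j, l⟩`. -/
def shuffleExp {k : ℕ} {i : Fin k → ℕ} (q : Fin k → ℤ) (r : (Σ j, Fin (i j)) → ℤ) : ℤ :=
  ∑ j : Fin k, q j * ∑ j' ∈ Finset.Iio j, ∑ l, r ⟨j', l⟩

/-! ## Differential graded modules -/

/-- A differential graded `K`-module: `ℤ`-graded, with a differential of degree `-1`. -/
structure DGModule (K : Type u) [Field K] where
  carrier : Type u
  [addCommGroup : AddCommGroup carrier]
  [module : Module K carrier]
  /-- the homogeneous components -/
  gr : ℤ → Submodule K carrier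
  isInternal : DirectSum.IsInternal gr
  d : carrier →ₗ[K] carrier
  d_mem : ∀ {i : ℤ} {x : carrier}, x ∈ gr i → d x ∈ gr (i - 1)
  d_d : ∀ x, d (d x) = 0

variable {K : Type u} [Field K]

instance : CoeSort (DGModule K) (Type u) := ⟨DGModule.carrier⟩
instance (V : DGModule K) : AddCommGroup V := V.addCommGroup
instance (V : DGModule K) : Module K V := V.module

/-- The decomposition into homogeneous components. -/
def DGModule.decomp (V : DGModule K) : V →ₗ[K] DirectSum ℤ fun i => V.gr i :=
  letI := V.isInternal.chooseDecomposition
  (DirectSum.decomposeLinearEquiv V.gr).toLinearMap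

/-- The operator that multiplies the elements of degree `i` by `(-1)^(q i)`. -/
def DGModule.sgn (V : DGModule K) (q : ℤ) : V →ₗ[K] V :=
  (DirectSum.toModule K ℤ V fun i => ksign K (q * i) • (V.gr i).subtype) ∘ₗ V.decomp

theorem DGModule.sgn_of_mem (V : DGModule K) (q : ℤ) {i : ℤ} {x : V} (hx : x ∈ V.gr i) :
    V.sgn q x = ksign K (q * i) • x := by
  have h : V.decomp x = DirectSum.lof K ℤ (fun i => V.gr i) i ⟨x, hx⟩ := by
    let _ := V.isInternal.chooseDecomposition
    exact DirectSum.decompose_of_mem V.gr hx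
  simp [DGModule.sgn, h]

/-- The linear functional `u` vanishes on all homogeneous components but the one of degree `p`. -/
def IsHomogeneousFunctional {V : DGModule K} (u : V →ₗ[K] K) (p : ℤ) : Prop :=
  ∀ i, i ≠ p → ∀ x ∈ V.gr i, u x = 0

/-- The linear maps of degree `n`. -/
def homGr (X Y : DGModule K) (n : ℤ) : Submodule K (X →ₗ[K] Y) where
  carrier := {f | ∀ i, ∀ x ∈ X.gr i, f x ∈ Y.gr (i + n)}
  add_mem' hf hg i x hx := (Y.gr _).add_mem (hf i x hx) (hg i x hx)
  zero_mem' _ _ _ := (Y.gr _).zero_mem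
  smul_mem' c _ hf i x hx := (Y.gr _).smul_mem c (hf i x hx)

/-- `∂ f = d_Y ∘ f - (-1)^n f ∘ d_X` for `f` of degree `n`. -/
def homD (X Y : DGModule K) (n : ℤ) : (X →ₗ[K] Y) →ₗ[K] (X →ₗ[K] Y) :=
  LinearMap.lcomp K Y LinearMap.id ∘ₗ LinearMap.llcomp K X Y Y Y.d
    - ksign K n • LinearMap.lcomp K Y X.d

theorem homD_apply (X Y : DGModule K) (n : ℤ) (f : X →ₗ[K] Y) (x : X) :
    homD X Y n f x = Y.d (f x) - ksign K n • f (X.d x) := by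
  simp [homD]

/-- The degree `g` part of `X ⊗ Y_0 ⊗ ⋯ ⊗ Y_{n-1}`. -/
def tensorGr (X : DGModule K) {n : ℕ} (Y : Fin n → DGModule K) (g : ℤ) :
    Submodule K (X ⊗[K] (⨂[K] j, Y j)) :=
  Submodule.span K {t | ∃ (p : ℤ) (q : Fin n → ℤ) (x : X) (y : ∀ j, Y j),
    x ∈ X.gr p ∧ (∀ j, y j ∈ (Y j).gr (q j)) ∧ p + ∑ j, q j = g ∧
    t = x ⊗ₜ[K] PiTensorProduct.tprod K y}

/-- The differential of `X ⊗ Y_0 ⊗ ⋯ ⊗ Y_{n-1}`: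
`d(x ⊗ y_0 ⊗ ⋯) = dx ⊗ y_0 ⊗ ⋯ + ∑_j (-1)^{|x| + |y_0| + ⋯ + |y_{j-1}|} x ⊗ y_0 ⊗ ⋯ ⊗ dy_j ⊗ ⋯`. -/
def tensorD (X : DGModule K) {n : ℕ} (Y : Fin n → DGModule K) :
    (X ⊗[K] (⨂[K] j, Y j)) →ₗ[K] (X ⊗[K] (⨂[K] j, Y j)) :=
  TensorProduct.map X.d LinearMap.id +
    ∑ j : Fin n, TensorProduct.map (X.sgn 1) (PiTensorProduct.map fun l =>
      if l < j then (Y l).sgn 1 else if l = j then (Y l).d else LinearMap.id)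

/-- The functional `x ⊗ y_0 ⊗ ⋯ ⊗ y_{n-1} ↦ u(x) v_0(y_0) ⋯ v_{n-1}(y_{n-1})` (no sign). -/
def contract {X : DGModule K} {n : ℕ} {Y : Fin n → DGModule K}
    (u : X →ₗ[K] K) (v : ∀ j, Y j →ₗ[K] K) : (X ⊗[K] (⨂[K] j, Y j)) →ₗ[K] K :=
  LinearMap.mul' K K ∘ₗ TensorProduct.map u (PiTensorProduct.lift
    ((MultilinearMap.mkPiAlgebra K (Fin n) K).compLinearMap v))

/-! ## Symmetric sequences, operads, cooperads -/

/-- A dg `𝕊`-module `{M(n)}_{n ≥ 0}`. The action of `𝕊_n` on `M(n)` is written as a relabelling of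
inputs along bijections `Fin m ≃ Fin n` (which exist only for `m = n`): for `σ ∈ 𝕊_n`, `map σ` is
the left action of `σ`, that is, the right action of `σ⁻¹`. -/
structure SModule (K : Type u) [Field K] where
  obj : ℕ → DGModule K
  map : ∀ {m n : ℕ}, (Fin m ≃ Fin n) → obj m →ₗ[K] obj n
  map_refl : ∀ {n : ℕ} (x : obj n), map (Equiv.refl (Fin n)) x = x
  map_trans : ∀ {l m n : ℕ} (σ : Fin l ≃ Fin m) (τ : Fin m ≃ Fin n) (x : obj l),
    map (σ.trans τ) x = map τ (map σ x)
  map_mem : ∀ {m n : ℕ} (σ : Fin m ≃ Fin n) {i : ℤ} {x : obj m},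
    x ∈ (obj m).gr i → map σ x ∈ (obj n).gr i
  map_d : ∀ {m n : ℕ} (σ : Fin m ≃ Fin n) (x : obj m),
    map σ ((obj m).d x) = (obj n).d (map σ x)

/-- The bijection of inputs given by bijections inside the blocks. -/
def blockInner {k : ℕ} {i i' : Fin k → ℕ} (σ : ∀ j, Fin (i' j) ≃ Fin (i j)) :
    Fin (∑ j, i' j) ≃ Fin (∑ j, i j) :=
  finSigmaFinEquiv.symm.trans ((Equiv.sigmaCongrRight σ).trans finSigmaFinEquiv)

/-- The bijection of inputs that permutes the blocks. -/
def blockOuter {k k' : ℕ} (σ : Fin k ≃ Fin k') (i : Fin k' → ℕ) :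
    Fin (∑ j, i (σ j)) ≃ Fin (∑ j, i j) :=
  finSigmaFinEquiv.symm.trans
    ((Equiv.sigmaCongrLeft (β := fun j => Fin (i j)) σ).trans finSigmaFinEquiv)

theorem sum_sum_eq {k : ℕ} {i : Fin k → ℕ} (m : (Σ j, Fin (i j)) → ℕ) :
    ∑ j, ∑ l, m ⟨j, l⟩ = ∑ y : Fin (∑ j, i j), m (finSigmaFinEquiv.symm y) := by
  rw [Equiv.sum_comp finSigmaFinEquiv.symm m, Fintype.sum_sigma]

/-- A dg operad, given by its composition maps
`γ : P(k) ⊗ P(i_1) ⊗ ⋯ ⊗ P(i_k) → P(i_1 + ⋯ + i_k)` and its unit; the inputs of a composite are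
ordered lexicographically. -/
structure Operad (K : Type u) [Field K] extends SModule K where
  one : obj 1
  one_mem : one ∈ (obj 1).gr 0
  d_one : (obj 1).d one = 0
  comp : ∀ {k : ℕ} (i : Fin k → ℕ),
    obj k →ₗ[K] MultilinearMap K (fun j => (obj (i j) : Type u)) (obj (∑ j, i j))
  comp_mem : ∀ {k : ℕ} (i : Fin k → ℕ) {p : ℤ} {q : Fin k → ℤ} {μ : obj k} {ν : ∀ j, obj (i j)},
    μ ∈ (obj k).gr p → (∀ j, ν j ∈ (obj (i j)).gr (q j)) →
    comp i μ ν ∈ (obj (∑ j, i j)).gr (p + ∑ j, q j)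
  comp_d : ∀ {k : ℕ} (i : Fin k → ℕ) {p : ℤ} {q : Fin k → ℤ} {μ : obj k} {ν : ∀ j, obj (i j)},
    μ ∈ (obj k).gr p → (∀ j, ν j ∈ (obj (i j)).gr (q j)) →
    (obj (∑ j, i j)).d (comp i μ ν) = comp i ((obj k).d μ) ν +
      ∑ j, ksign K (p + before q j) •
        comp i μ (Function.update ν j ((obj (i j)).d (ν j)))
  one_comp : ∀ {n : ℕ} (ν : obj n),
    comp (fun _ : Fin 1 => n) one (fun _ => ν) = map (finCongr (by simp)) ν
  comp_one : ∀ {k : ℕ} (μ : obj k),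
    comp (fun _ : Fin k => 1) μ (fun _ => one) = map (finCongr (by simp)) μ
  comp_map_inner : ∀ {k : ℕ} (i i' : Fin k → ℕ) (σ : ∀ j, Fin (i' j) ≃ Fin (i j)) (μ : obj k)
    (ν : ∀ j, obj (i' j)),
    comp i μ (fun j => map (σ j) (ν j)) = map (blockInner σ) (comp i' μ ν)
  comp_map_outer : ∀ {k k' : ℕ} (σ : Fin k ≃ Fin k') (i : Fin k' → ℕ) (μ : obj k)
    {q : Fin k' → ℤ} {ν : ∀ j, obj (i j)}, (∀ j, ν j ∈ (obj (i j)).gr (q j)) →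
    comp i (map σ μ) ν =
      ksign K (permExp σ q) • map (blockOuter σ i) (comp (fun j => i (σ j)) μ fun j => ν (σ j))
  assoc : ∀ {k : ℕ} (i : Fin k → ℕ) (m : (Σ j, Fin (i j)) → ℕ) (μ : obj k)
    {q : Fin k → ℤ} {ν : ∀ j, obj (i j)} {r : (Σ j, Fin (i j)) → ℤ} {ρ : ∀ x, obj (m x)},
    (∀ j, ν j ∈ (obj (i j)).gr (q j)) → (∀ x, ρ x ∈ (obj (m x)).gr (r x)) →
    comp (fun y => m (finSigmaFinEquiv.symm y)) (comp i μ ν)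
        (fun y => ρ (finSigmaFinEquiv.symm y)) =
      ksign K (shuffleExp q r) • map (finCongr (sum_sum_eq m))
        (comp (fun j => ∑ l, m ⟨j, l⟩) μ
          fun j => comp (fun l => m ⟨j, l⟩) (ν j) fun l => ρ ⟨j, l⟩)

/-- The composite of a decomposition map with a functional. -/
def coev {X C : DGModule K} {n : ℕ} {Y : Fin n → DGModule K}
    (Δ : C →ₗ[K] X ⊗[K] (⨂[K] j, Y j)) (u : X →ₗ[K] K) (v : ∀ j, Y j →ₗ[K] K) : C →ₗ[K] K :=
  contract u v ∘ₗ Δ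

/-- A dg cooperad: a decomposition `Δ : Q(n) → (Q ∘ Q)(n)` and a counit, where `(Q ∘ Q)(n)` is the
direct sum over `k` of the invariants of the block permutations in the sum of the
`Q(k) ⊗ Q(i_1) ⊗ ⋯ ⊗ Q(i_k)` over all ways `e` to distribute the `n` inputs over blocks of sizes
`i_1, …, i_k`. `Δ i e` is the component of `Δ` at `(k, i, e)`.
Coassociativity is an identity between elements of tensor products of vector spaces, and it is
tested on products of homogeneous functionals, which separate these elements. -/
structure Cooperad (K : Type u) [Field K] extends SModule K where
  counit : obj 1 →ₗ[K] K
  counit_homogeneous : IsHomogeneousFunctional counit 0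
  counit_d : ∀ x, counit ((obj 1).d x) = 0
  Δ : ∀ {k n : ℕ} (i : Fin k → ℕ), ((Σ j, Fin (i j)) ≃ Fin n) →
    obj n →ₗ[K] obj k ⊗[K] (⨂[K] j, obj (i j))
  finite : ∀ {n : ℕ} (c : obj n),
    {k : ℕ | ∃ (i : Fin k → ℕ) (e : (Σ j, Fin (i j)) ≃ Fin n), Δ i e c ≠ 0}.Finite
  Δ_mem : ∀ {k n : ℕ} (i : Fin k → ℕ) (e : (Σ j, Fin (i j)) ≃ Fin n) {g : ℤ} {c : obj n},
    c ∈ (obj n).gr g → Δ i e c ∈ tensorGr (obj k) (fun j => obj (i j)) g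
  Δ_d : ∀ {k n : ℕ} (i : Fin k → ℕ) (e : (Σ j, Fin (i j)) ≃ Fin n) (c : obj n),
    Δ i e ((obj n).d c) = tensorD (obj k) (fun j => obj (i j)) (Δ i e c)
  Δ_map : ∀ {k n n' : ℕ} (i : Fin k → ℕ) (e : (Σ j, Fin (i j)) ≃ Fin n) (τ : Fin n ≃ Fin n')
    (c : obj n), Δ i (e.trans τ) (map τ c) = Δ i e c
  Δ_inner : ∀ {k n : ℕ} (i i' : Fin k → ℕ) (σ : ∀ j, Fin (i' j) ≃ Fin (i j))
    (e : (Σ j, Fin (i j)) ≃ Fin n) (c : obj n),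
    Δ i e c = TensorProduct.map LinearMap.id (PiTensorProduct.map fun j => map (σ j))
      (Δ i' ((Equiv.sigmaCongrRight σ).trans e) c)
  Δ_outer : ∀ {k k' n : ℕ} (σ : Fin k ≃ Fin k') (i : Fin k' → ℕ) (e : (Σ j, Fin (i j)) ≃ Fin n)
    (u : obj k' →ₗ[K] K) {q : Fin k' → ℤ} {v : ∀ j, obj (i j) →ₗ[K] K},
    (∀ j, IsHomogeneousFunctional (v j) (q j)) →
    coev (Δ i e) u v = ksign K (permExp σ q) •
      coev (Δ (fun j => i (σ j))
        ((Equiv.sigmaCongrLeft (β := fun j => Fin (i j)) σ).trans e)) (u ∘ₗ map σ) fun j => v (σ j)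
  counit_left : ∀ {n : ℕ} (v : obj n →ₗ[K] K),
    coev (Δ (fun _ : Fin 1 => n) (Equiv.uniqueSigma fun _ : Fin 1 => Fin n)) counit (fun _ => v) = v
  counit_right : ∀ {n : ℕ} (u : obj n →ₗ[K] K),
    coev (Δ (fun _ : Fin n => 1) (Equiv.sigmaUnique (Fin n) fun _ => Fin 1)) u (fun _ => counit) = u
  coassoc : ∀ {k N : ℕ} (i : Fin k → ℕ) (m : (Σ j, Fin (i j)) → ℕ)
    (e : (Σ x : (Σ j, Fin (i j)), Fin (m x)) ≃ Fin N) {p : ℤ} {q : Fin k → ℤ}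
    {r : (Σ j, Fin (i j)) → ℤ} {u : obj k →ₗ[K] K} {v : ∀ j, obj (i j) →ₗ[K] K}
    {w : ∀ x, obj (m x) →ₗ[K] K}, IsHomogeneousFunctional u p →
    (∀ j, IsHomogeneousFunctional (v j) (q j)) → (∀ x, IsHomogeneousFunctional (w x) (r x)) →
    coev (Δ (fun y => m (finSigmaFinEquiv.symm y))
        ((Equiv.sigmaCongrLeft (β := fun x => Fin (m x)) finSigmaFinEquiv.symm).trans e))
        (coev (Δ i finSigmaFinEquiv) u v) (fun y => w (finSigmaFinEquiv.symm y)) =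
      ksign K (shuffleExp q r) •
        coev (Δ (fun j => ∑ l, m ⟨j, l⟩)
          ((Equiv.sigmaCongrRight fun j => (finSigmaFinEquiv (n := fun l => m ⟨j, l⟩)).symm).trans
            ((Equiv.sigmaAssoc fun j l => Fin (m ⟨j, l⟩)).symm.trans e)))
          u (fun j => coev (Δ (fun l => m ⟨j, l⟩) finSigmaFinEquiv) (v j) fun l => w ⟨j, l⟩)

/-! ## Algebras, modules, coalgebras -/

/-- A dg algebra over the operad `P`; `op μ a` is `γ(μ; a_1, …, a_k)`. -/
structure PAlgebra (P : Operad K) extends DGModule K where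
  op : ∀ {k : ℕ}, P.obj k →ₗ[K] MultilinearMap K (fun _ : Fin k => carrier) carrier
  op_mem : ∀ {k : ℕ} {p : ℤ} {e : Fin k → ℤ} {μ : P.obj k} {a : Fin k → carrier},
    μ ∈ (P.obj k).gr p → (∀ l, a l ∈ gr (e l)) → op μ a ∈ gr (p + ∑ l, e l)
  op_d : ∀ {k : ℕ} {p : ℤ} {e : Fin k → ℤ} {μ : P.obj k} {a : Fin k → carrier},
    μ ∈ (P.obj k).gr p → (∀ l, a l ∈ gr (e l)) →
    d (op μ a) = op ((P.obj k).d μ) a +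
      ∑ l, ksign K (p + before e l) • op μ (Function.update a l (d (a l)))
  op_one : ∀ a : carrier, op P.one (fun _ => a) = a
  op_map : ∀ {k k' : ℕ} (σ : Fin k ≃ Fin k') (μ : P.obj k) {e : Fin k' → ℤ}
    {a : Fin k' → carrier}, (∀ l, a l ∈ gr (e l)) →
    op (P.map σ μ) a = ksign K (permExp σ e) • op μ fun l => a (σ l)
  op_comp : ∀ {k : ℕ} (i : Fin k → ℕ) (μ : P.obj k) {q : Fin k → ℤ} {ν : ∀ j, P.obj (i j)}
    {r : (Σ j, Fin (i j)) → ℤ} {a : (Σ j, Fin (i j)) → carrier},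
    (∀ j, ν j ∈ (P.obj (i j)).gr (q j)) → (∀ x, a x ∈ gr (r x)) →
    op (P.comp i μ ν) (fun y => a (finSigmaFinEquiv.symm y)) =
      ksign K (shuffleExp q r) • op μ fun j => op (ν j) fun l => a ⟨j, l⟩

instance (P : Operad K) : CoeSort (PAlgebra P) (Type u) := ⟨fun A => A.carrier⟩

/-- A dg module over the `P`-algebra `A`; `act j μ m a` is `γ_M(μ; a_1, …, m, …, a_k)` with `m` at
position `j`. In the axioms the `a_l` come as a function on all positions whose value at the
position of `m` is not used, and the degree listed at that position is that of `m`. -/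
structure AModule {P : Operad K} (A : PAlgebra P) extends DGModule K where
  act : ∀ {k : ℕ} (j : Fin k),
    P.obj k →ₗ[K] carrier →ₗ[K] MultilinearMap K (fun _ : {l : Fin k // l ≠ j} => (A : Type u)) carrier
  act_mem : ∀ {k : ℕ} (j : Fin k) {p : ℤ} {e : Fin k → ℤ} {μ : P.obj k} {m : carrier}
    {a : Fin k → A}, μ ∈ (P.obj k).gr p → m ∈ gr (e j) → (∀ l, l ≠ j → a l ∈ A.gr (e l)) →
    act j μ m (fun l => a l) ∈ gr (p + ∑ l, e l)
  act_d : ∀ {k : ℕ} (j : Fin k) {p : ℤ} {e : Fin k → ℤ} {μ : P.obj k} {m : carrier}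
    {a : Fin k → A}, μ ∈ (P.obj k).gr p → m ∈ gr (e j) → (∀ l, l ≠ j → a l ∈ A.gr (e l)) →
    d (act j μ m fun l => a l) = act j ((P.obj k).d μ) m (fun l => a l) +
      ∑ l, ksign K (p + before e l) •
        (if l = j then act j μ (d m) (fun l => a l)
        else act j μ m (fun l' => Function.update a l (A.d (a l)) l'))
  act_one : ∀ m : carrier, act (0 : Fin 1) P.one m (fun _ => 0) = m
  act_map : ∀ {k k' : ℕ} (σ : Fin k ≃ Fin k') (j : Fin k) (μ : P.obj k) {e : Fin k' → ℤ}
    {m : carrier} {a : Fin k' → A}, m ∈ gr (e (σ j)) → (∀ l, l ≠ σ j → a l ∈ A.gr (e l)) →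
    act (σ j) (P.map σ μ) m (fun l => a l) =
      ksign K (permExp σ e) • act j μ m fun l => a (σ l)
  act_comp : ∀ {k : ℕ} (i : Fin k → ℕ) (j : Fin k) (l₀ : Fin (i j)) (μ : P.obj k)
    {q : Fin k → ℤ} {ν : ∀ j, P.obj (i j)} {r : (Σ j, Fin (i j)) → ℤ} {m : carrier}
    {a : (Σ j, Fin (i j)) → A}, (∀ j, ν j ∈ (P.obj (i j)).gr (q j)) → m ∈ gr (r ⟨j, l₀⟩) →
    (∀ x, x ≠ ⟨j, l₀⟩ → a x ∈ A.gr (r x)) →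
    act (finSigmaFinEquiv ⟨j, l₀⟩) (P.comp i μ ν) m
        (fun y => a (finSigmaFinEquiv.symm (y : Fin (∑ j, i j)))) =
      ksign K (shuffleExp q r) •
        act j μ (act l₀ (ν j) m fun l => a ⟨j, l⟩) fun j' => A.op (ν j') fun l => a ⟨j', l⟩

instance {P : Operad K} (A : PAlgebra P) : CoeSort (AModule A) (Type u) := ⟨fun M => M.carrier⟩

/-- A dg coalgebra over the cooperad `Q`: a decomposition `C → ⨁_n (Q(n) ⊗ C^{⊗ n})^{𝕊_n}`.
As for cooperads, identities in tensor products are tested on homogeneous functionals. -/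
structure QCoalgebra (Q : Cooperad K) extends DGModule K where
  δ : carrier →ₗ[K] DirectSum ℕ fun n => Q.obj n ⊗[K] (⨂[K] _ : Fin n, toDGModule)
  δ_mem : ∀ (n : ℕ) {g : ℤ} {c : carrier}, c ∈ gr g →
    δ c n ∈ tensorGr (Q.obj n) (fun _ => toDGModule) g
  δ_d : ∀ (n : ℕ) (c : carrier),
    δ (d c) n = tensorD (Q.obj n) (fun _ => toDGModule) (δ c n)
  δ_invariant : ∀ {n : ℕ} (σ : Fin n ≃ Fin n) (u : Q.obj n →ₗ[K] K) {q : Fin n → ℤ}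
    {w : Fin n → (toDGModule →ₗ[K] K)}, (∀ l, IsHomogeneousFunctional (w l) (q l)) →
    ∀ c, contract u w (δ c n) =
      ksign K (permExp σ q) * contract (u ∘ₗ Q.map σ) (fun l => w (σ l)) (δ c n)
  counit_δ : ∀ (w : toDGModule →ₗ[K] K) (c : carrier),
    contract Q.counit (fun _ => w) (δ c 1) = w c
  coassoc : ∀ {k : ℕ} (i : Fin k → ℕ) {p : ℤ} {q : Fin k → ℤ} {r : (Σ j, Fin (i j)) → ℤ}
    {u : Q.obj k →ₗ[K] K} {v : ∀ j, Q.obj (i j) →ₗ[K] K}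
    {w : (Σ j, Fin (i j)) → (toDGModule →ₗ[K] K)}, IsHomogeneousFunctional u p →
    (∀ j, IsHomogeneousFunctional (v j) (q j)) → (∀ x, IsHomogeneousFunctional (w x) (r x)) →
    ∀ c, contract (coev (Q.Δ i finSigmaFinEquiv) u v) (fun y => w (finSigmaFinEquiv.symm y))
        (δ c (∑ j, i j)) =
      ksign K (shuffleExp q r) *
        contract (Y := fun _ => toDGModule) u (fun j =>
          contract (v j) (fun l => w ⟨j, l⟩) ∘ₗ DirectSum.component K ℕ _ (i j) ∘ₗ δ) (δ c k)

instance (Q : Cooperad K) : CoeSort (QCoalgebra Q) (Type u) := ⟨fun C => C.carrier⟩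

/-! ## Operadic twisting morphisms -/

/-- The morphism of `𝕊`-modules `Q → I → P` given by the counit of `Q` and the unit of `P`. -/
def unitCounit (Q : Cooperad K) (P : Operad K) : ∀ n : ℕ, Q.obj n →ₗ[K] P.obj n
  | 1 => Q.counit.smulRight P.one
  | _ => 0

/-- The composition map as a linear map on the tensor product. -/
def Operad.compT (P : Operad K) {k : ℕ} (i : Fin k → ℕ) :
    (P.obj k ⊗[K] (⨂[K] j, P.obj (i j))) →ₗ[K] P.obj (∑ j, i j) :=
  TensorProduct.lift (PiTensorProduct.lift.toLinearMap ∘ₗ P.comp i)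

/-- The convolution product
`Q → Q ∘_{(1)} Q → P ∘_{(1)} P → P`, `α ⋆ β = γ_{(1)} ∘ (α ∘_{(1)} β) ∘ Δ_{(1)}`, in arity `n`, for
`β` of degree `-1`. The component `Q → Q ∘_{(1)} Q` is obtained from the decomposition by applying
the counit to all blocks but the `j`-th. The sum runs over the trees with `k + 1` inputs at the root
vertex, and `n - k` inputs at the upper vertex, which is grafted on the `j`-th input; each such tree
is represented by `(k + 1)! (n - k)!` pairs `(j, e)`. -/
def convolution (Q : Cooperad K) (P : Operad K) (α β : ∀ n, Q.obj n →ₗ[K] P.obj n) (n : ℕ) :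
    Q.obj n →ₗ[K] P.obj n :=
  ∑ k ∈ Finset.range (n + 1), (((k + 1).factorial * (n - k).factorial : ℕ) : K)⁻¹ •
    ∑ j : Fin (k + 1),
      ∑ e : (Σ l : Fin (k + 1), Fin (Function.update (fun _ => 1) j (n - k) l)) ≃ Fin n,
        P.map (finSigmaFinEquiv.symm.trans e) ∘ₗ P.compT _ ∘ₗ
          TensorProduct.map (α (k + 1) ∘ₗ (Q.obj (k + 1)).sgn 1)
            (PiTensorProduct.map fun l => if l = j then β _ else unitCounit Q P _) ∘ₗ
          Q.Δ (Function.update (fun _ => 1) j (n - k)) e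

/-- An operadic twisting morphism: a morphism of `𝕊`-modules `α : Q → P` of degree `-1` with
`∂(α) + α ⋆ α = 0`. -/
structure OperadicTwisting (Q : Cooperad K) (P : Operad K) where
  toFun : ∀ n, Q.obj n →ₗ[K] P.obj n
  mem : ∀ n {i : ℤ} {x : Q.obj n}, x ∈ (Q.obj n).gr i → toFun n x ∈ (P.obj n).gr (i - 1)
  equivariant : ∀ {m n : ℕ} (σ : Fin m ≃ Fin n) (x : Q.obj m),
    toFun n (Q.map σ x) = P.map σ (toFun m x)
  maurerCartan : ∀ n, homD (Q.obj n) (P.obj n) (-1) (toFun n) + convolution Q P toFun toFun n = 0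

/-! ## Free algebras -/

section Free

variable (P : Operad K)

/-- `⨁_n P(n) ⊗ V^{⊗ n}`. -/
abbrev SchurRaw (V : DGModule K) : Type u :=
  DirectSum ℕ fun n => P.obj n ⊗[K] (⨂[K] _ : Fin n, V)

/-- The element `μ ⊗ v_1 ⊗ ⋯ ⊗ v_n`. -/
def schurWord {V : DGModule K} {n : ℕ} (μ : P.obj n) (v : Fin n → V) : SchurRaw P V :=
  DirectSum.lof K ℕ (fun n => P.obj n ⊗[K] (⨂[K] _ : Fin n, V)) n
    (μ ⊗ₜ[K] PiTensorProduct.tprod K v)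

/-- The relations `μ · σ ⊗ v = μ ⊗ σ · v` of the coinvariants, with the Koszul sign. -/
def schurRel (V : DGModule K) : Submodule K (SchurRaw P V) :=
  Submodule.span K {t | ∃ (n : ℕ) (σ : Fin n ≃ Fin n) (μ : P.obj n) (e : Fin n → ℤ) (v : Fin n → V),
    (∀ l, v l ∈ V.gr (e l)) ∧
    t = schurWord P (P.map σ μ) v - ksign K (permExp σ e) • schurWord P μ fun l => v (σ l)}

/-- `P(V) = ⨁_n P(n) ⊗_{𝕊_n} V^{⊗ n}`. -/
abbrev Schur (V : DGModule K) : Type u := SchurRaw P V ⧸ schurRel P V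

variable {P}

/-- `μ ⊗ v_1 ⊗ ⋯ ⊗ v_n ↦ γ_B(μ; ψ v_1, …, ψ v_n)`. -/
def PAlgebra.evalRaw (B : PAlgebra P) {V : DGModule K} (ψ : V →ₗ[K] B.toDGModule) :
    SchurRaw P V →ₗ[K] B.toDGModule :=
  DirectSum.toModule K ℕ B.toDGModule fun _ =>
    TensorProduct.lift (PiTensorProduct.lift.toLinearMap ∘ₗ B.op) ∘ₗ
      TensorProduct.map LinearMap.id (PiTensorProduct.map fun _ => ψ)

theorem PAlgebra.evalRaw_word (B : PAlgebra P) {V : DGModule K} (ψ : V →ₗ[K] B.toDGModule) {n : ℕ}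
    (μ : P.obj n) (v : Fin n → V) :
    B.evalRaw ψ (schurWord P μ v) = B.op μ fun l => ψ (v l) := by
  simp [PAlgebra.evalRaw, schurWord]

theorem mem_of_mem_homGr_zero {X Y : DGModule K} {f : X →ₗ[K] Y} (hf : f ∈ homGr X Y 0) {i : ℤ}
    {x : X} (hx : x ∈ X.gr i) : f x ∈ Y.gr i := by
  simpa using hf i x hx

/-- The map `P(V) → P(B) → B` given by a map `ψ : V → B` of degree `0`. -/
def PAlgebra.eval (B : PAlgebra P) {V : DGModule K} (ψ : V →ₗ[K] B.toDGModule)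
    (hψ : ψ ∈ homGr V B.toDGModule 0) : Schur P V →ₗ[K] B.toDGModule :=
  (schurRel P V).liftQ (B.evalRaw ψ) <| by
    rw [schurRel, Submodule.span_le]
    rintro _ ⟨n, σ, μ, e, v, hv, rfl⟩
    simp only [SetLike.mem_coe, LinearMap.mem_ker, map_sub, map_smul, PAlgebra.evalRaw_word]
    rw [sub_eq_zero]
    exact B.op_map σ μ fun l => mem_of_mem_homGr_zero hψ (hv l)

/-- A morphism of dg `P`-algebras. -/
structure IsPAlgebraHom {B A : PAlgebra P} (f : B.toDGModule →ₗ[K] A.toDGModule) : Prop where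
  mem : f ∈ homGr B.toDGModule A.toDGModule 0
  map_d : ∀ b : B, f (B.d b) = A.d (f b)
  map_op : ∀ {k : ℕ} (μ : P.obj k) (b : Fin k → B), f (B.op μ b) = A.op μ fun l => f (b l)

end Free

/-! ## Free modules over an algebra -/

section FreeModule

variable {P : Operad K} (A : PAlgebra P) (N : DGModule K)

/-- The sum over all `n` and all positions `j` of `P(n) ⊗ A ⊗ ⋯ ⊗ N ⊗ ⋯ ⊗ A` (`N` at position `j`);
the factor `N` is written next to `P(n)`. -/
abbrev FreeRaw : Type u :=
  DirectSum (Σ n : ℕ, Fin n) fun x =>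
    P.obj x.1 ⊗[K] (N ⊗[K] (⨂[K] _ : {l : Fin x.1 // l ≠ x.2}, A.toDGModule))

variable {N}

/-- The element `μ ⊗ a_1 ⊗ ⋯ ⊗ x ⊗ ⋯ ⊗ a_n`, with `x` at position `j` (where `a` is not used). -/
def freeWord {n : ℕ} (j : Fin n) (μ : P.obj n) (x : N) (a : Fin n → A) : FreeRaw A N :=
  DirectSum.lof K (Σ n : ℕ, Fin n) (fun x =>
    P.obj x.1 ⊗[K] (N ⊗[K] (⨂[K] _ : {l : Fin x.1 // l ≠ x.2}, A.toDGModule))) ⟨n, j⟩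
    (μ ⊗ₜ[K] (x ⊗ₜ[K] PiTensorProduct.tprod K fun l => a l))

variable (N)

/-- The relations `μ · σ ⊗ v = μ ⊗ σ · v` that define `P(A, N)`. -/
def freeRelEquivariance : Set (FreeRaw A N) :=
  {t | ∃ (n : ℕ) (σ : Fin n ≃ Fin n) (j : Fin n) (μ : P.obj n) (e : Fin n → ℤ) (x : N)
      (a : Fin n → A), x ∈ N.gr (e (σ j)) ∧ (∀ l, l ≠ σ j → a l ∈ A.gr (e l)) ∧
    t = freeWord A (σ j) (P.map σ μ) x a -
      ksign K (permExp σ e) • freeWord A j μ x fun l => a (σ l)}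

/-- The relations `γ(μ; ν_1, …, id, …, ν_k) ⊗ a_1 ⊗ ⋯ ⊗ x ⊗ ⋯ ⊗ a_n =
± μ ⊗ γ_A(ν_1; a_1, …) ⊗ ⋯ ⊗ x ⊗ ⋯ ⊗ γ_A(ν_k; …, a_n)` of the coequalizer of
`P(P(A), N) ⇉ P(A, N)`; the operation at the position `j` of `x` is the unit. -/
def freeRelCoequalizer : Set (FreeRaw A N) :=
  {t | ∃ (k : ℕ) (i : Fin k → ℕ) (j : Fin k) (hj : 1 = i j) (l₀ : Fin (i j)) (μ : P.obj k)
      (q : Fin k → ℤ) (ν : ∀ j, P.obj (i j)) (r : (Σ j, Fin (i j)) → ℤ) (x : N)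
      (a : (Σ j, Fin (i j)) → A), (∀ j, ν j ∈ (P.obj (i j)).gr (q j)) ∧
    ν j = P.map (finCongr hj) P.one ∧ x ∈ N.gr (r ⟨j, l₀⟩) ∧
    (∀ y, y ≠ ⟨j, l₀⟩ → a y ∈ A.gr (r y)) ∧
    t = freeWord A (finSigmaFinEquiv ⟨j, l₀⟩) (P.comp i μ ν) x (fun y => a (finSigmaFinEquiv.symm y))
      - ksign K (shuffleExp q r) • freeWord A j μ x fun j' => A.op (ν j') fun l => a ⟨j', l⟩}

/-- The free `A`-module `A ⊗^P N`, the coequalizer of `P(P(A), N) ⇉ P(A, N)`. -/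
abbrev FreeAModule : Type u :=
  FreeRaw A N ⧸ Submodule.span K (freeRelEquivariance A N ∪ freeRelCoequalizer A N)

variable {A N}

/-- `μ ⊗ a_1 ⊗ ⋯ ⊗ x ⊗ ⋯ ⊗ a_n ↦ γ_M(μ; a_1, …, ψ x, …, a_n)`. -/
def AModule.evalRaw (M : AModule A) (ψ : N →ₗ[K] M.toDGModule) : FreeRaw A N →ₗ[K] M.toDGModule :=
  DirectSum.toModule K (Σ n : ℕ, Fin n) M.toDGModule fun x =>
    TensorProduct.lift (PiTensorProduct.lift.toLinearMap ∘ₗ TensorProduct.lift (M.act x.2)) ∘ₗ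
      TensorProduct.map (TensorProduct.map LinearMap.id ψ) LinearMap.id ∘ₗ
        (TensorProduct.assoc K _ _ _).symm.toLinearMap

theorem AModule.evalRaw_word (M : AModule A) (ψ : N →ₗ[K] M.toDGModule) {n : ℕ} (j : Fin n)
    (μ : P.obj n) (x : N) (a : Fin n → A) :
    M.evalRaw ψ (freeWord A j μ x a) = M.act j μ (ψ x) fun l => a l := by
  simp [AModule.evalRaw, freeWord]

theorem AModule.act_unit (M : AModule A) {n : ℕ} (hn : 1 = n) (j : Fin n) (m : M)
    (a : {l : Fin n // l ≠ j} → A) :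
    M.act j (P.map (finCongr hn) P.one) m a = m := by
  subst hn
  have hj : j = 0 := Subsingleton.elim _ _
  subst hj
  have h1 : P.map (finCongr (rfl : 1 = 1)) P.one = P.one := P.map_refl P.one
  have h2 : a = fun _ => 0 := by
    funext l
    exact absurd (Subsingleton.elim _ _) l.2
  rw [h1, h2, M.act_one]

/-- The map `A ⊗^P N → M` given by a map `ψ : N → M` of degree `0` to an `A`-module. -/
def AModule.eval (M : AModule A) (ψ : N →ₗ[K] M.toDGModule) (hψ : ψ ∈ homGr N M.toDGModule 0) :
    FreeAModule A N →ₗ[K] M.toDGModule :=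
  Submodule.liftQ _ (M.evalRaw ψ) <| by
    rw [Submodule.span_le]
    rintro _ (⟨n, σ, j, μ, e, x, a, hx, ha, rfl⟩ |
      ⟨k, i, j, hj, l₀, μ, q, ν, r, x, a, hν, hνj, hx, ha, rfl⟩)
    · simp only [SetLike.mem_coe, LinearMap.mem_ker, map_sub, map_smul, AModule.evalRaw_word]
      rw [sub_eq_zero]
      exact M.act_map σ j μ (mem_of_mem_homGr_zero hψ hx) ha
    · simp only [SetLike.mem_coe, LinearMap.mem_ker, map_sub, map_smul, AModule.evalRaw_word]
      rw [sub_eq_zero, M.act_comp i j l₀ μ hν (mem_of_mem_homGr_zero hψ hx) ha, hνj,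
        M.act_unit hj l₀]

/-- The multilinear map `(c_1, …, c_k) ↦ γ_M(μ; ψ c_1, …, g c_j, …, ψ c_k)`, linearly in `μ`. -/
def AModule.insert (M : AModule A) {V : DGModule K} {k : ℕ} (j : Fin k)
    (ψ : V →ₗ[K] A.toDGModule) (g : V →ₗ[K] M.toDGModule) :
    P.obj k →ₗ[K] MultilinearMap K (fun _ : Fin k => (V : Type u)) M.toDGModule :=
  have h₁ : ∀ (c : Fin k → V) (z : V), (fun t : {t : Fin k // t ≠ j} =>
      ψ (Function.update c j z t.1)) = fun t => ψ (c t.1) := fun c z => by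
    funext t
    rw [Function.update_of_ne t.2]
  have h₂ : ∀ (c : Fin k → V) (l : Fin k) (h : l ≠ j) (z : V), (fun t : {t : Fin k // t ≠ j} =>
      ψ (Function.update c l z t.1)) =
        Function.update (fun t : {t : Fin k // t ≠ j} => ψ (c t.1)) ⟨l, h⟩ (ψ z) := fun c l h z => by
    funext t
    by_cases ht : t = ⟨l, h⟩
    · subst ht; simp
    · rw [Function.update_of_ne ht, Function.update_of_ne]
      exact fun h2 => ht (Subtype.ext h2)
  { toFun := fun μ =>
      { toFun := fun c => M.act j μ (g (c j)) fun l => ψ (c l.1)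
        map_update_add' := by
          intro inst c l x y
          obtain rfl : inst = instDecidableEqFin k := Subsingleton.elim _ _
          by_cases h : l = j
          · subst h
            simp [h₁]
          · simp [h₂ c l h, Function.update_of_ne (Ne.symm h)]
        map_update_smul' := by
          intro inst c l r x
          obtain rfl : inst = instDecidableEqFin k := Subsingleton.elim _ _
          by_cases h : l = j
          · subst h
            simp [h₁]
          · simp [h₂ c l h, Function.update_of_ne (Ne.symm h)] }
    map_add' := fun μ μ' => by ext c; simp
    map_smul' := fun r μ => by ext c; simp }

end FreeModule

/-! ## Algebraic twisting morphisms and twisted objects -/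

section Twisting

variable {P : Operad K} {Q : Cooperad K} (α : OperadicTwisting Q P) (C : QCoalgebra Q)

/-- `C → Q(C) → P(C)`, the second map being `α ∘ id_C`, before passage to coinvariants.
The component in arity `n` of the first map is an invariant, and `(Q(n) ⊗ C^{⊗ n})^{𝕊_n}` is
identified with `Q(n) ⊗_{𝕊_n} C^{⊗ n}` by the norm isomorphism `[x] ↦ ∑_{σ ∈ 𝕊_n} σ x`; thus the
invariant `t` is sent to the class of `(1 / n!) t`. -/
def decompose : C.toDGModule →ₗ[K] SchurRaw P C.toDGModule :=
  (DirectSum.lmap fun n => ((n.factorial : ℕ) : K)⁻¹ •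
    TensorProduct.map (α.toFun n) LinearMap.id) ∘ₗ C.δ

/-- `⋆_α(ψ) : C → Q(C) → P(B) → B`, for `ψ : C → B` of degree `0`. -/
def star (B : PAlgebra P) (ψ : C.toDGModule →ₗ[K] B.toDGModule) :
    C.toDGModule →ₗ[K] B.toDGModule :=
  B.evalRaw ψ ∘ₗ decompose α C

/-- An algebraic twisting morphism with respect to `α`: a map `φ : C → A` of degree `0` with
`∂(φ) + ⋆_α(φ) = 0`. -/
structure AlgebraicTwisting (A : PAlgebra P) where
  toFun : C.toDGModule →ₗ[K] A.toDGModule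
  mem : toFun ∈ homGr C.toDGModule A.toDGModule 0
  maurerCartan : homD C.toDGModule A.toDGModule 0 toFun + star α C A toFun = 0

variable {A : PAlgebra P} {C}

/-- The arity `n` component of `α[ψ, g]` for `ψ` of degree `0` and `g` of degree `s`, on
`Q(n) ⊗ C^{⊗ n}`:
`μ ⊗ c_1 ⊗ ⋯ ⊗ c_n ↦ (-1)^{s (|μ| + |c_1| + ⋯ + |c_{n-1}|)} γ_M(α μ; ψ c_1, …, ψ c_{n-1}, g c_n)`,
divided by `(n - 1)!` since `(P(n) ⊗ A^{⊗ n-1} ⊗ M)^{𝕊_{n-1}}` is identified with the coinvariants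
by the norm isomorphism. -/
def bracketTerm (M : AModule A) (s : ℤ) (ψ : C.toDGModule →ₗ[K] A.toDGModule)
    (g : C.toDGModule →ₗ[K] M.toDGModule) :
    ∀ n : ℕ, (Q.obj n ⊗[K] (⨂[K] _ : Fin n, C.toDGModule)) →ₗ[K] M.toDGModule
  | 0 => 0
  | n + 1 => ((n.factorial : ℕ) : K)⁻¹ • TensorProduct.lift
      (PiTensorProduct.lift.toLinearMap ∘ₗ
        M.insert (Fin.last n) (ψ ∘ₗ C.toDGModule.sgn s) g ∘ₗ
          α.toFun (n + 1) ∘ₗ (Q.obj (n + 1)).sgn s)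

/-- `α[ψ, g] = ∑_{n ≥ 1} α[ψ, g]_n : C → M`, for `ψ` of degree `0` and `g` of degree `s`. -/
def bracket (M : AModule A) (s : ℤ) (ψ : C.toDGModule →ₗ[K] A.toDGModule)
    (g : C.toDGModule →ₗ[K] M.toDGModule) : C.toDGModule →ₗ[K] M.toDGModule :=
  DirectSum.toModule K ℕ M.toDGModule (bracketTerm α M s ψ g) ∘ₗ C.δ

variable {α} (φ : AlgebraicTwisting α C A)

/-- The dg `P`-algebra `R` over `A` (with augmentation `f`) is the quasi-free algebra `P ∘_α C`,
with the augmentation that extends `φ`, and `ι` is the inclusion of the generators `C → P(C)`: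
the underlying graded algebra of `R` is `P(C)`, and `d_R = d_{P ∘ C} - δ_α^l`. Since `R` is a dg
algebra and `δ_α^l` is the derivation that extends `C → Q(C) → P(C)`, the latter equation is one
between values on generators, `d_R(ι c) = ι(d c) - (δ_α^l)(c)`. -/
structure IsTwistedComposite (R : PAlgebra P) (ι : C.toDGModule →ₗ[K] R.toDGModule)
    (f : R.toDGModule →ₗ[K] A.toDGModule) : Prop where
  mem : ι ∈ homGr C.toDGModule R.toDGModule 0
  bijective : Function.Bijective (R.eval ι mem)
  d_generator : ∀ c : C, R.d (ι c) = ι (C.d c) - star α C R ι c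
  augmentation : IsPAlgebraHom f
  augmentation_generator : ∀ c : C, f (ι c) = φ.toFun c

/-- The dg `A`-module `T` is the free graded `A`-module `A ⊗^P C` with the twisted differential
`d_φ = d_{A ⊗^P C} - δ_φ^l`, and `ι` is the inclusion of the generators. Since `T` is a dg
`A`-module and `δ_φ^l` commutes with the `A`-module structure (up to the Koszul sign), the equation
for `d_φ` is one between values on generators, and there `δ_φ^l` is
`C → (Q(n) ⊗ C^{⊗ n})^{𝕊_n} → P(n) ⊗ A^{⊗ n-1} ⊗ C → A ⊗^P C` with the second map
`α ⊗ φ^{⊗ n-1} ⊗ id`, that is, `α[φ, ι]`. -/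
structure IsTwistedFreeModule (T : AModule A) (ι : C.toDGModule →ₗ[K] T.toDGModule) : Prop where
  mem : ι ∈ homGr C.toDGModule T.toDGModule 0
  bijective : Function.Bijective (T.eval ι mem)
  d_generator : ∀ c : C, T.d (ι c) = ι (C.d c) - bracket α T 0 φ.toFun ι c

end Twisting

/-! ## The three dg modules -/

section Complexes

/-- The submodules `H n` of the spaces of linear maps of degree `n` form a dg module with the
operators `D n : H n → H (n - 1)`. -/
structure IsDGFamily {X Y : DGModule K} (H : ℤ → Submodule K (X →ₗ[K] Y))
    (D : ℤ → (X →ₗ[K] Y) →ₗ[K] (X →ₗ[K] Y)) : Prop where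
  map_mem : ∀ n : ℤ, ∀ f ∈ H (n + 1), D (n + 1) f ∈ H n
  sq_zero : ∀ n : ℤ, ∀ f ∈ H (n + 1 + 1), D (n + 1) (D (n + 1 + 1) f) = 0

/-- The dg module given by a family as above. -/
def IsDGFamily.complex {X Y : DGModule K} {H : ℤ → Submodule K (X →ₗ[K] Y)}
    {D : ℤ → (X →ₗ[K] Y) →ₗ[K] (X →ₗ[K] Y)} (h : IsDGFamily H D) :
    ChainComplex (ModuleCat.{u} K) ℤ :=
  ChainComplex.of (fun n => ModuleCat.of K (H n))
    (fun n => ModuleCat.ofHom ((D (n + 1)).restrict (h.map_mem n)))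
    (fun n => by
      ext f x
      exact LinearMap.congr_fun (h.sq_zero n f.1 f.2) x)

/-- The elements of degree `n` of the dg module `h.complex` are those of `H n`. -/
def IsDGFamily.equiv {X Y : DGModule K} {H : ℤ → Submodule K (X →ₗ[K] Y)}
    {D : ℤ → (X →ₗ[K] Y) →ₗ[K] (X →ₗ[K] Y)} (h : IsDGFamily H D) (n : ℤ) :
    H n ≃ₗ[K] h.complex.X n :=
  LinearEquiv.refl K (H n)

/-- The differential of `h.complex` is `D`. -/
theorem IsDGFamily.d_equiv {X Y : DGModule K} {H : ℤ → Submodule K (X →ₗ[K] Y)}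
    {D : ℤ → (X →ₗ[K] Y) →ₗ[K] (X →ₗ[K] Y)} (h : IsDGFamily H D) (n : ℤ) (f : H (n + 1)) :
    h.complex.d (n + 1) n (h.equiv (n + 1) f) =
      h.equiv n ⟨D (n + 1) f.1, h.map_mem n f.1 f.2⟩ := by
  have e : h.complex.d (n + 1) n = ModuleCat.ofHom ((D (n + 1)).restrict (h.map_mem n)) :=
    ChainComplex.of_d (fun n => ModuleCat.of K (H n))
      (fun n => ModuleCat.ofHom ((D (n + 1)).restrict (h.map_mem n))) n
  rw [e]
  rfl

variable {P : Operad K} {A : PAlgebra P}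

/-- The `A`-derivations `D : R → M` of degree `n`, for a `P`-algebra `f : R → A` over `A`:
`D(γ(μ; b_1, …, b_k)) = ∑_j ± γ_M(μ; f b_1, …, D b_j, …, f b_k)`. -/
def der (R : PAlgebra P) (f : R.toDGModule →ₗ[K] A.toDGModule) (M : AModule A) (n : ℤ) :
    Submodule K (R.toDGModule →ₗ[K] M.toDGModule) where
  carrier := {D | D ∈ homGr R.toDGModule M.toDGModule n ∧
    ∀ {k : ℕ} {p : ℤ} {e : Fin k → ℤ} {μ : P.obj k} {b : Fin k → R},
      μ ∈ (P.obj k).gr p → (∀ l, b l ∈ R.gr (e l)) →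
      D (R.op μ b) = ∑ j, ksign K (n * (p + before e j)) •
        M.act j μ (D (b j)) fun l => f (b l)}
  add_mem' := by
    rintro D D' ⟨hD, hD₁⟩ ⟨hD', hD₂⟩
    refine ⟨add_mem hD hD', fun hμ hb => ?_⟩
    simp [hD₁ hμ hb, hD₂ hμ hb, Finset.sum_add_distrib]
  zero_mem' := ⟨zero_mem _, fun _ _ => by simp⟩
  smul_mem' := by
    rintro c D ⟨hD, hD₁⟩
    refine ⟨Submodule.smul_mem _ c hD, fun hμ hb => ?_⟩
    simp [hD₁ hμ hb, Finset.smul_sum, smul_comm c]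

/-- The morphisms of graded `A`-modules `h : T → M` of degree `n`. -/
def homA (T M : AModule A) (n : ℤ) : Submodule K (T.toDGModule →ₗ[K] M.toDGModule) where
  carrier := {h | h ∈ homGr T.toDGModule M.toDGModule n ∧
    ∀ {k : ℕ} (j : Fin k) {p : ℤ} {e : Fin k → ℤ} {μ : P.obj k} {t : T} {a : Fin k → A},
      μ ∈ (P.obj k).gr p → (∀ l, l ≠ j → a l ∈ A.gr (e l)) →
      h (T.act j μ t fun l => a l) =
        ksign K (n * (p + before e j)) • M.act j μ (h t) fun l => a l}
  add_mem' := by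
    rintro D D' ⟨hD, hD₁⟩ ⟨hD', hD₂⟩
    refine ⟨add_mem hD hD', fun j _ _ _ _ _ hμ ha => ?_⟩
    simp [hD₁ j hμ ha, hD₂ j hμ ha]
  zero_mem' := ⟨zero_mem _, fun _ _ _ _ _ _ _ _ => by simp⟩
  smul_mem' := by
    rintro c D ⟨hD, hD₁⟩
    refine ⟨Submodule.smul_mem _ c hD, fun j _ _ _ _ _ hμ ha => ?_⟩
    simp [hD₁ j hμ ha, smul_comm c]

/-- The bracket `α[φ, -]` on the maps of degree `s`, as a linear operator. -/
def bracketOp {Q : Cooperad K} {α : OperadicTwisting Q P} {C : QCoalgebra Q}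
    (φ : AlgebraicTwisting α C A) (M : AModule A) (s : ℤ) :
    (C.toDGModule →ₗ[K] M.toDGModule) →ₗ[K] (C.toDGModule →ₗ[K] M.toDGModule) where
  toFun g := bracket α M s φ.toFun g
  map_add' g g' := by
    have h : ∀ n, bracketTerm α M s φ.toFun (g + g') n =
        bracketTerm α M s φ.toFun g n + bracketTerm α M s φ.toFun g' n := by
      rintro (_ | n)
      · simp [bracketTerm]
      · ext μ c
        simp [bracketTerm, AModule.insert]
    rw [bracket, bracket, bracket, ← LinearMap.add_comp]
    congr 1
    refine DirectSum.linearMap_ext K fun n => LinearMap.ext fun t => ?_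
    simp [h]
  map_smul' r g := by
    have h : ∀ n, bracketTerm α M s φ.toFun (r • g) n =
        r • bracketTerm α M s φ.toFun g n := by
      rintro (_ | n)
      · simp [bracketTerm]
      · ext μ c
        simp [bracketTerm, AModule.insert, smul_comm r]
    rw [bracket, bracket, RingHom.id_apply, ← LinearMap.smul_comp]
    congr 1
    refine DirectSum.linearMap_ext K fun n => LinearMap.ext fun t => ?_
    simp [h]

/-- The twisted differential `∂_φ(g) = ∂(g) + α[φ, g]` on the maps `g : C → M` of degree `n`. -/
def twistedD {Q : Cooperad K} {α : OperadicTwisting Q P} {C : QCoalgebra Q}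
    (φ : AlgebraicTwisting α C A) (M : AModule A) (n : ℤ) :
    (C.toDGModule →ₗ[K] M.toDGModule) →ₗ[K] (C.toDGModule →ₗ[K] M.toDGModule) :=
  homD C.toDGModule M.toDGModule n + bracketOp φ M n

end Complexes

end

end DGOperad

open DGOperad

namespace DGOperad

noncomputable section

variable {K : Type u} [Field K]

/-! All three complexes are compared by restriction to generators. A derivation on P(C) and a map of
A-modules on A ⊗^P C are both freely determined by a linear map on C (`exists_der`, `der_ext`,
`exists_homA`, `homA_ext`), so the content lies in the differentials. For a derivation D of degree s
along f, the Leibniz rule on the words of ⋆_α(ι) gives D(⋆_α(ι)) = (-1)^s α[fι, Dι] (`der_star`):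
the n terms of the rule agree because Δ_C(n) is invariant, and this turns 1/n! into 1/(n-1)!. With
d_α = d - δ it says that ∂(D) restricts to ∂_φ(D|_C). For maps of modules the same follows by moving
the map through the action (`homA_bracket`). The equation ∂_φ² = 0 is never computed on Hom(C, M);
it is transported from derivations.

The main work is the existence of P ∘_α C, that is, (d - δ)² = 0. The operator d - δ obeys the
Leibniz rule in degree -1, so the cross terms in its square cancel (`IsLeibniz.sq`) and only
generators matter. There the equation reads d⋆ + ⋆d + α[ι, ⋆] = 0 with ⋆ = ⋆_α(ι)
(`d_star_add_bracket`). The first two terms collect to ∂(α) evaluated on Δ_C. The bracket is α ⋆ α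
evaluated on Δ_C (`bracket_star`): coassociativity replaces the decomposition of Q by that of C
inside each letter, the counit removes all blocks but one, and the n! labellings of a tree
contribute equally because Δ_C(n) is invariant. The Maurer–Cartan equation of α then concludes. The
extension of φ to P(C) commutes with the differentials on C by the Maurer–Cartan equation of φ.

The free module A ⊗^P C is treated as the part linear in C of the free algebra S on A ⊕ C
(`Extension`). A projection κ keeps the words with exactly one letter in C, and the remaining
arguments count only through their values in A. Differential, grading and action descend from S
along κ (`Extension.exists_descend`), so the signs of the module axioms are those of the algebra S.
The twist is the map of modules h that extends α[φ, ι]; (d - h)² = 0 means ∂(h) = h², and on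
generators this is ∂_φ²(ι) = 0 in Hom(C, A ⊗^P C).

Koszul signs depend on degrees, so signed formulas are multilinear only within a multidegree. Maps
are therefore prescribed degree by degree and identities are checked on homogeneous words, where
they become axioms of the operad together with a congruence of exponents modulo 2. Characteristic 0
serves the factorials and also the gradings of P(C) and A ⊗^P C, which are recognised from
eigenvalues 2^i of a weight operator. -/

theorem ksign_add (a b : ℤ) : ksign K (a + b) = ksign K a * ksign K b := by
  simp [ksign, Int.negOnePow_add]

@[simp] theorem ksign_zero : ksign K 0 = 1 := by simp [ksign]

theorem ksign_mul_self (a : ℤ) : ksign K a * ksign K a = 1 := by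
  rw [← ksign_add, ksign, Int.negOnePow_even _ ⟨a, rfl⟩]; simp

theorem ksign_two_mul (a : ℤ) : ksign K (2 * a) = 1 := by
  rw [two_mul, ksign_add, ksign_mul_self]

/-- Most sign checks end here: half the difference of the two exponents is supplied as `c`, and the
remaining integer identity is linear or polynomial. -/
theorem ksign_congr {a b : ℤ} (c : ℤ) (h : a = b + 2 * c) : ksign K a = ksign K b := by
  rw [h, ksign_add, ksign_two_mul, mul_one]

theorem ksign_ne_zero (a : ℤ) : ksign K a ≠ 0 := fun h => by
  have := ksign_mul_self (K := K) a
  simp [h] at this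

@[simp] theorem ksign_one : ksign K 1 = -1 := by simp [ksign]

theorem ksign_add_one (a : ℤ) : ksign K (a + 1) = -ksign K a := by
  rw [ksign_add, ksign_one, mul_neg_one]

theorem ksign_sub_one (a : ℤ) : ksign K (a - 1) = -ksign K a := by
  rw [← ksign_add_one]; exact ksign_congr (-1) (by ring)

theorem ksign_neg (a : ℤ) : ksign K (-a) = ksign K a := ksign_congr (-a) (by ring)

/-! ### Exponents of reorderings and shuffles -/

/-- The sum of `q x * r y` over the pairs with `y < x`. -/
def beforeSum {n : ℕ} (q r : Fin n → ℤ) : ℤ := ∑ x, ∑ y, if y < x then q x * r y else 0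

/-- The sum of `a (σ x) * b (σ y)` over the inversions of `σ`. -/
def invSum {m n : ℕ} (σ : Fin m ≃ Fin n) (a b : Fin n → ℤ) : ℤ :=
  ∑ x, ∑ y, if x < y ∧ σ y < σ x then a (σ x) * b (σ y) else 0

theorem invSum_add_left {m n : ℕ} (σ : Fin m ≃ Fin n) (a a' b : Fin n → ℤ) :
    invSum σ (a + a') b = invSum σ a b + invSum σ a' b := by
  simp only [invSum, ← Finset.sum_add_distrib]
  refine Finset.sum_congr rfl fun x _ => Finset.sum_congr rfl fun y _ => ?_
  split_ifs <;> simp [add_mul]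

theorem invSum_add_right {m n : ℕ} (σ : Fin m ≃ Fin n) (a b b' : Fin n → ℤ) :
    invSum σ a (b + b') = invSum σ a b + invSum σ a b' := by
  simp only [invSum, ← Finset.sum_add_distrib]
  refine Finset.sum_congr rfl fun x _ => Finset.sum_congr rfl fun y _ => ?_
  split_ifs <;> simp [mul_add]

theorem permExp_eq {m n : ℕ} (σ : Fin m ≃ Fin n) (e : Fin n → ℤ) :
    permExp σ e = invSum σ e e := rfl

theorem permExp_add {m n : ℕ} (σ : Fin m ≃ Fin n) (a b : Fin n → ℤ) :
    permExp σ (a + b) = permExp σ a + permExp σ b + (invSum σ a b + invSum σ b a) := by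
  simp only [permExp_eq, invSum_add_left, invSum_add_right]; ring

/-- Moving the entries of degree q past those of degree r may be done before or after the reordering
σ; the difference is accounted for by the inversions of σ. The identity of integers already holds
for each ordered pair of positions, by cases on the order of x, y and of their images. -/
theorem beforeSum_add_invSum {m n : ℕ} (σ : Fin m ≃ Fin n) (q r : Fin n → ℤ) :
    beforeSum q r + invSum σ r q = beforeSum (q ∘ σ) (r ∘ σ) + invSum σ q r := by
  have h : beforeSum q r = ∑ x, ∑ y, if σ y < σ x then q (σ x) * r (σ y) else 0 := by
    rw [beforeSum, ← Equiv.sum_comp σ]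
    exact Finset.sum_congr rfl fun x _ => (Equiv.sum_comp σ _).symm
  have h2 : invSum σ r q = ∑ x, ∑ y, if y < x ∧ σ x < σ y then r (σ y) * q (σ x) else 0 := by
    rw [invSum, Finset.sum_comm]
  rw [h, h2, beforeSum, invSum]
  simp only [← Finset.sum_add_distrib]
  refine Finset.sum_congr rfl fun x _ => Finset.sum_congr rfl fun y _ => ?_
  simp only [Function.comp]
  rcases lt_trichotomy x y with hxy | rfl | hxy
  · have : σ x ≠ σ y := fun hh => hxy.ne (σ.injective hh)
    simp [hxy, not_lt_of_gt hxy]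
  · simp
  · have h1 : ¬ x < y := not_lt_of_gt hxy
    rcases lt_or_gt_of_ne (fun hh => hxy.ne (σ.injective hh) : σ y ≠ σ x) with h3 | h3
    · simp [hxy, h1, h3, not_lt_of_gt h3]
    · simp [hxy, h1, h3, not_lt_of_gt h3, mul_comm]

theorem beforeSum_eq {n : ℕ} (q r : Fin n → ℤ) : beforeSum q r = ∑ x, q x * before r x := by
  refine Finset.sum_congr rfl fun x _ => ?_
  rw [before, Finset.mul_sum, ← Finset.sum_filter]
  refine Finset.sum_congr ?_ fun _ _ => rfl
  ext; simp

theorem beforeSum_single {n : ℕ} (j : Fin n) (s : ℤ) (r : Fin n → ℤ) :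
    beforeSum (Pi.single j s) r = s * before r j := by
  rw [beforeSum_eq, Finset.sum_eq_single j] <;> simp +contextual

theorem permExp_single {m n : ℕ} (σ : Fin m ≃ Fin n) (j : Fin n) (s : ℤ) :
    permExp σ (Pi.single j s) = 0 := by
  refine Finset.sum_eq_zero fun x _ => Finset.sum_eq_zero fun y _ => ?_
  split_ifs with h
  · by_cases hx : σ x = j
    · have : σ y ≠ j := fun hy => h.2.ne (hy.trans hx.symm)
      simp [this]
    · simp [hx]
  · rfl

theorem single_comp_equiv {m n : ℕ} (σ : Fin m ≃ Fin n) (j : Fin m) (s : ℤ) :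
    (Pi.single (σ j) s : Fin n → ℤ) ∘ σ = Pi.single j s := by
  funext x
  simp [Pi.single_apply]

/-- Raising the degree of one entry by `s` changes the exponent of a reordering by the exponents
for moving an operator of degree `s` to that entry. -/
theorem ksign_permExp_add_single {m n : ℕ} (σ : Fin m ≃ Fin n) (j : Fin m) (s : ℤ)
    (e : Fin n → ℤ) :
    ksign K (permExp σ (e + Pi.single (σ j) s)) * ksign K (s * before e (σ j)) =
      ksign K (permExp σ e) * ksign K (s * before (e ∘ σ) j) := by
  have h := beforeSum_add_invSum σ (Pi.single (σ j) s) e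
  rw [single_comp_equiv, beforeSum_single, beforeSum_single] at h
  rw [← ksign_add, ← ksign_add]
  -- The two cross terms of `permExp_add` differ, and by `h` their difference is that of the two
  -- `before` terms; what is left is twice one of them.
  refine ksign_congr (invSum σ (Pi.single (σ j) s) e) ?_
  rw [permExp_add, permExp_single]
  linarith

theorem permExp_of_monotone {m n : ℕ} (σ : Fin m ≃ Fin n) (h : ∀ x y, x < y → σ x < σ y)
    (e : Fin n → ℤ) : permExp σ e = 0 := by
  refine Finset.sum_eq_zero fun x _ => Finset.sum_eq_zero fun y _ => if_neg ?_
  rintro ⟨h1, h2⟩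
  exact lt_asymm h2 (h _ _ h1)

/-! ### Blocks -/

/-- The value at ⟨j, l⟩ is l plus the sizes of the blocks before j, and the sum for a later block j'
includes the whole block j, which is longer than l. -/
theorem finSigma_lt_of_lt {k : ℕ} {i : Fin k → ℕ} {j j' : Fin k} (h : j < j') (l : Fin (i j))
    (l' : Fin (i j')) : finSigmaFinEquiv ⟨j, l⟩ < finSigmaFinEquiv ⟨j', l'⟩ := by
  rw [Fin.lt_def, finSigmaFinEquiv_apply, finSigmaFinEquiv_apply]
  dsimp only
  have h1 : ∑ t : Fin j.1, i (Fin.castLE j.2.le t) + i j ≤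
      ∑ t : Fin j'.1, i (Fin.castLE j'.2.le t) := by
    have h2 : ∀ (a : ℕ) (ha : a ≤ k), ∑ t : Fin a, i (Fin.castLE ha t) =
        ∑ t : Fin k, if t.1 < a then i t else 0 := by
      intro a ha
      obtain ⟨b, rfl⟩ := Nat.exists_eq_add_of_le ha
      rw [Fin.sum_univ_add]
      simp only [Fin.val_castAdd, Fin.is_lt, if_true, Fin.val_natAdd, add_lt_iff_neg_left,
        not_lt_zero, if_false, Finset.sum_const_zero, add_zero]
      rfl
    have h3 : i j = ∑ t, if t = j then i t else 0 := by simp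
    rw [h2, h2, h3, ← Finset.sum_add_distrib]
    refine Finset.sum_le_sum fun t _ => ?_
    have : j.1 < j'.1 := h
    rcases lt_trichotomy t j with ht | rfl | ht
    · simp [ht.ne, ht, ht.trans h]
    · simp [h]
    · have : j.1 < t.1 := ht
      simp [ht.ne', Nat.not_lt.2 this.le]
  have := l.2
  omega

theorem finSigma_lt_iff {k : ℕ} {i : Fin k → ℕ} {j : Fin k} (l l' : Fin (i j)) :
    finSigmaFinEquiv ⟨j, l⟩ < finSigmaFinEquiv ⟨j, l'⟩ ↔ l < l' := by
  rw [Fin.lt_def, finSigmaFinEquiv_apply, finSigmaFinEquiv_apply, Fin.lt_def]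
  simp

theorem sum_finSigma {k : ℕ} {i : Fin k → ℕ} {M : Type*} [AddCommMonoid M]
    (f : Fin (∑ j, i j) → M) : ∑ y, f y = ∑ j, ∑ l, f (finSigmaFinEquiv ⟨j, l⟩) := by
  rw [← Equiv.sum_comp finSigmaFinEquiv, Fintype.sum_sigma]

theorem before_eq {n : ℕ} (e : Fin n → ℤ) (j : Fin n) :
    before e j = ∑ l, if l < j then e l else 0 := by
  rw [before, ← Finset.sum_filter]
  exact Finset.sum_congr (by ext; simp) fun _ _ => rfl

theorem before_finSigma {k : ℕ} {i : Fin k → ℕ} (r : (Σ j, Fin (i j)) → ℤ) (j : Fin k)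
    (l : Fin (i j)) :
    before (fun y => r (finSigmaFinEquiv.symm y)) (finSigmaFinEquiv ⟨j, l⟩) =
      before (fun j => ∑ l, r ⟨j, l⟩) j + before (fun l => r ⟨j, l⟩) l := by
  rw [before_eq, sum_finSigma, before_eq, before_eq]
  have h : ∀ j', (∑ l', if finSigmaFinEquiv ⟨j', l'⟩ < finSigmaFinEquiv ⟨j, l⟩
      then r (finSigmaFinEquiv.symm (finSigmaFinEquiv ⟨j', l'⟩)) else 0) =
      (if j' < j then ∑ l, r ⟨j', l⟩ else 0) +
        if j' = j then ∑ l', (if l' < l then r ⟨j, l'⟩ else 0) else 0 := by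
    intro j'
    rcases lt_trichotomy j' j with h | rfl | h
    · simp [finSigma_lt_of_lt h, h, h.ne]
    · simp [finSigma_lt_iff]
    · simp [not_lt_of_gt (finSigma_lt_of_lt h _ _), not_lt_of_gt h, h.ne']
  rw [Finset.sum_congr rfl fun j' _ => h j', Finset.sum_add_distrib]
  simp

/-- Puts shuffle exponents into the bilinear form `beforeSum`, so that they can be expanded when
degrees add. -/
theorem shuffleExp_eq {k : ℕ} {i : Fin k → ℕ} (q : Fin k → ℤ) (r : (Σ j, Fin (i j)) → ℤ) :
    shuffleExp q r = beforeSum q fun j => ∑ l, r ⟨j, l⟩ := by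
  rw [beforeSum_eq]; rfl

theorem beforeSum_add_left {n : ℕ} (q q' r : Fin n → ℤ) :
    beforeSum (q + q') r = beforeSum q r + beforeSum q' r := by
  simp [beforeSum_eq, add_mul, Finset.sum_add_distrib]

theorem beforeSum_add_right {n : ℕ} (q r r' : Fin n → ℤ) :
    beforeSum q (r + r') = beforeSum q r + beforeSum q r' := by
  simp [beforeSum_eq, before, mul_add, Finset.sum_add_distrib]

theorem before_add {n : ℕ} (r r' : Fin n → ℤ) (j : Fin n) :
    before (r + r') j = before r j + before r' j := by
  simp [before, Finset.sum_add_distrib]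

/-- Two flattened positions lie either in different blocks, which gives block totals, or in the same
block. -/
theorem sum_before_finSigma {k : ℕ} {i : Fin k → ℕ} (p r : (Σ j, Fin (i j)) → ℤ) :
    beforeSum (fun y => p (finSigmaFinEquiv.symm y)) (fun y => r (finSigmaFinEquiv.symm y)) =
      beforeSum (fun j => ∑ l, p ⟨j, l⟩) (fun j => ∑ l, r ⟨j, l⟩) +
        ∑ j, beforeSum (fun l => p ⟨j, l⟩) fun l => r ⟨j, l⟩ := by
  simp only [beforeSum_eq]
  rw [sum_finSigma, ← Finset.sum_add_distrib]
  refine Finset.sum_congr rfl fun j _ => ?_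
  rw [Finset.sum_mul, ← Finset.sum_add_distrib]
  refine Finset.sum_congr rfl fun l _ => ?_
  rw [before_finSigma, Equiv.symm_apply_apply]; ring

theorem blockOuter_finSigma {k k' : ℕ} (σ : Fin k ≃ Fin k') (i : Fin k' → ℕ) (j : Fin k)
    (l : Fin (i (σ j))) :
    blockOuter σ i (finSigmaFinEquiv ⟨j, l⟩) = finSigmaFinEquiv ⟨σ j, l⟩ := by
  simp [blockOuter, Equiv.sigmaCongrLeft]

theorem blockInner_finSigma {k : ℕ} {i i' : Fin k → ℕ} (σ : ∀ j, Fin (i' j) ≃ Fin (i j))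
    (j : Fin k) (l : Fin (i' j)) :
    blockInner σ (finSigmaFinEquiv ⟨j, l⟩) = finSigmaFinEquiv ⟨j, σ j l⟩ := by
  simp [blockInner]

/-- Two letters are inverted exactly when they lie in different blocks and these blocks are
inverted, so each inversion of σ contributes the product of two block totals. -/
theorem permExp_blockOuter {k k' : ℕ} (σ : Fin k ≃ Fin k') (i : Fin k' → ℕ)
    (r : (Σ j, Fin (i j)) → ℤ) :
    permExp (blockOuter σ i) (fun y => r (finSigmaFinEquiv.symm y)) =
      permExp σ fun j => ∑ l, r ⟨j, l⟩ := by
  unfold permExp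
  rw [sum_finSigma]
  refine Finset.sum_congr rfl fun x _ => ?_
  simp only [sum_finSigma (i := fun j => i (σ j))]
  rw [Finset.sum_comm]
  refine Finset.sum_congr rfl fun y _ => ?_
  simp only [blockOuter_finSigma, Equiv.symm_apply_apply]
  rw [Finset.sum_mul_sum]
  have key : ∀ (a : Fin (i (σ x))) (b : Fin (i (σ y))),
      (finSigmaFinEquiv (n := fun j => i (σ j)) ⟨x, a⟩ < finSigmaFinEquiv ⟨y, b⟩ ∧
        finSigmaFinEquiv ⟨σ y, b⟩ < finSigmaFinEquiv ⟨σ x, a⟩) ↔ (x < y ∧ σ y < σ x) := by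
    intro a b
    constructor
    · rintro ⟨h1, h2⟩
      rcases lt_trichotomy x y with h | rfl | h
      · refine ⟨h, ?_⟩
        rcases lt_trichotomy (σ x) (σ y) with h' | h' | h'
        · exact absurd h2 (not_lt_of_gt (finSigma_lt_of_lt h' _ _))
        · exact absurd (σ.injective h') h.ne
        · exact h'
      · rw [finSigma_lt_iff] at h1 h2
        exact absurd h1 (not_lt_of_gt h2)
      · exact absurd h1 (not_lt_of_gt
          (finSigma_lt_of_lt (i := fun j => i (σ j)) h _ _))
    · rintro ⟨h1, h2⟩
      exact ⟨finSigma_lt_of_lt (i := fun j => i (σ j)) h1 _ _, finSigma_lt_of_lt h2 _ _⟩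
  simp only [key]
  split_ifs with h
  · rfl
  · simp

/-- Letters of different blocks keep their order, so only inversions inside a block count. -/
theorem permExp_blockInner {k : ℕ} {i i' : Fin k → ℕ} (σ : ∀ j, Fin (i' j) ≃ Fin (i j))
    (r : (Σ j, Fin (i j)) → ℤ) :
    permExp (blockInner σ) (fun y => r (finSigmaFinEquiv.symm y)) =
      ∑ j, permExp (σ j) fun l => r ⟨j, l⟩ := by
  unfold permExp
  rw [sum_finSigma]
  refine Finset.sum_congr rfl fun x _ => Finset.sum_congr rfl fun a _ => ?_
  rw [sum_finSigma, Finset.sum_eq_single x]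
  · simp [blockInner_finSigma, finSigma_lt_iff]
  · intro y _ hy
    refine Finset.sum_eq_zero fun b _ => if_neg ?_
    rw [blockInner_finSigma, blockInner_finSigma]
    rintro ⟨h1, h2⟩
    rcases lt_or_gt_of_ne hy with h | h
    · exact lt_asymm h1 (finSigma_lt_of_lt h _ _)
    · exact lt_asymm h2 (finSigma_lt_of_lt h _ _)
  · simp

/-! ## Multilinear maps -/

section Multilinear

variable {ι : Type*} [Fintype ι] [DecidableEq ι] {X : ι → Type*} [∀ l, AddCommGroup (X l)]
  [∀ l, Module K (X l)] {W : Type*} [AddCommGroup W] [Module K W]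

/-- Induction on the set of variables whose value is only known to lie in the span; the other
variables are generators, and one variable at a time is released by linearity. -/
theorem multilinear_eq_on_span (f g : MultilinearMap K X W) (S : ∀ l, Set (X l))
    (h : ∀ x, (∀ l, x l ∈ S l) → f x = g x) (x : ∀ l, X l)
    (hx : ∀ l, x l ∈ Submodule.span K (S l)) : f x = g x := by
  have key : ∀ s : Finset ι, ∀ x : ∀ l, X l, (∀ l ∈ s, x l ∈ Submodule.span K (S l)) →
      (∀ l, l ∉ s → x l ∈ S l) → f x = g x := by
    intro s
    induction s using Finset.induction_on with
    | empty => exact fun x _ hx => h x fun l => hx l (by simp)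
    | insert a s ha ih =>
      intro x hx hx'
      have h1 : Set.EqOn (f.toLinearMap x a) (g.toLinearMap x a) (S a) := by
        intro z hz
        refine ih _ (fun l hl => ?_) (fun l hl => ?_)
        · have : l ≠ a := fun hh => ha (hh ▸ hl)
          rw [Function.update_of_ne this]
          exact hx l (Finset.mem_insert_of_mem hl)
        · by_cases hla : l = a
          · subst hla; simpa using hz
          · rw [Function.update_of_ne hla]
            exact hx' l (by simp [hla, hl])
      have h2 := LinearMap.eqOn_span h1 (hx a (Finset.mem_insert_self a s))
      simpa using h2
  exact key Finset.univ x (fun l _ => hx l) fun l hl => absurd (Finset.mem_univ l) hl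

/-- A multilinear map can be prescribed on families of generators if the prescription extends
linearly in each variable. -/
theorem exists_multilinear {G : ι → Type*} (s : ∀ l, G l → X l)
    (hs : ∀ l, Submodule.span K (Set.range (s l)) = ⊤) (F : (∀ l, G l) → W)
    (h : ∀ j g, ∃ L : X j →ₗ[K] W, ∀ g', L (s j g') = F (Function.update g j g')) :
    ∃ M : MultilinearMap K X W, ∀ g, M (fun l => s l (g l)) = F g := by
  -- Bases are extracted from the generating families; M is defined by F on basis elements only.
  choose B hB hBs hBl using fun l => exists_linearIndependent K (Set.range (s l))
  choose c hc using fun l (p : B l) => hB l p.2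
  let b : ∀ l, Module.Basis (B l) K (X l) := fun l => Module.Basis.mk (hBl l) (by
    rw [Subtype.range_coe, hBs, hs])
  have hb : ∀ l p, b l p = s l (c l p) := fun l p => by simp [b, hc]
  let M : MultilinearMap K X W := ((Basis.piTensorProduct b).constr K
    fun p => F fun l => c l (p l)).compMultilinearMap (PiTensorProduct.tprod K)
  have hM : ∀ p : ∀ l, B l, M (fun l => b l (p l)) = F fun l => c l (p l) := fun p => by
    have := (Basis.piTensorProduct b).constr_basis K (fun p => F fun l => c l (p l)) p
    rw [Basis.piTensorProduct_apply] at this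
    exact this
  refine ⟨M, ?_⟩
  -- Agreement with F spreads from basis elements to all generators, one variable at a time: the
  -- linear map L of the hypothesis agrees with M on the basis in that variable, hence everywhere.
  have key : ∀ t : Finset ι, ∀ g : ∀ l, G l, (∀ l, l ∉ t → ∃ p, g l = c l p) →
      M (fun l => s l (g l)) = F g := by
    intro t
    induction t using Finset.induction_on with
    | empty =>
      intro g hg
      choose p hp using fun l => hg l (by simp)
      obtain rfl : g = fun l => c l (p l) := funext hp
      rw [← hM]
      simp only [hb]
    | insert a t ha ih =>
      intro g hg
      obtain ⟨L, hL⟩ := h a g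
      have h1 : M.toLinearMap (fun l => s l (g l)) a = L := by
        refine (b a).ext fun p => ?_
        rw [hb, hL, ← ih]
        · rw [MultilinearMap.toLinearMap_apply]
          congr 1
          funext l
          by_cases hl : l = a
          · subst hl; simp
          · simp [Function.update_of_ne hl]
        · intro l hl
          by_cases hla : l = a
          · subst hla; exact ⟨p, by simp⟩
          · rw [Function.update_of_ne hla]
            exact hg l (by simp [hla, hl])
      have h2 := LinearMap.congr_fun h1 (s a (g a))
      rw [hL, Function.update_eq_self] at h2
      rw [← h2, MultilinearMap.toLinearMap_apply]
      congr 1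
      exact (Function.update_eq_self a fun l => s l (g l)).symm
  exact fun g => key Finset.univ g fun l hl => absurd (Finset.mem_univ l) hl

theorem exists_multilinear_quotient {N : ∀ l, Submodule K (X l)} (M : MultilinearMap K X W)
    (h : ∀ j x z, z ∈ N j → M (Function.update x j z) = 0) :
    ∃ M' : MultilinearMap K (fun l => X l ⧸ N l) W, ∀ x, M' (fun l => (N l).mkQ (x l)) = M x := by
  refine exists_multilinear (G := X) (fun l => (N l).mkQ) (fun l => ?_) (fun x => M x) fun j x => ?_
  · have := LinearMap.range_eq_top.2 (N l).mkQ_surjective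
    rw [← LinearMap.coe_range, this]
    simp
  · refine ⟨(N j).liftQ (M.toLinearMap x j) fun z hz => h j x z hz, fun z => ?_⟩
    exact (N j).liftQ_apply _ _

end Multilinear

/-! ## Homogeneous elements -/

section Homogeneous

theorem DGModule.decomp_of_mem (V : DGModule K) {i : ℤ} {x : V} (hx : x ∈ V.gr i) :
    V.decomp x = DirectSum.lof K ℤ (fun i => V.gr i) i ⟨x, hx⟩ := by
  let _ := V.isInternal.chooseDecomposition
  exact DirectSum.decompose_of_mem V.gr hx

theorem DGModule.span_homogeneous (V : DGModule K) :
    Submodule.span K {x : V | ∃ i, x ∈ V.gr i} = ⊤ := by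
  rw [eq_top_iff, ← V.isInternal.submodule_iSup_eq_top, iSup_le_iff]
  exact fun i x hx => Submodule.subset_span ⟨i, hx⟩

theorem DGModule.linearMap_ext {V : DGModule K} {W : Type*} [AddCommGroup W] [Module K W]
    {f g : V →ₗ[K] W} (h : ∀ i, ∀ x ∈ V.gr i, f x = g x) : f = g := by
  refine LinearMap.ext_on V.span_homogeneous ?_
  rintro x ⟨i, hx⟩
  exact h i x hx

/-- Linear maps can be prescribed in each degree. -/
theorem DGModule.exists_linearMap (V : DGModule K) {W : Type*} [AddCommGroup W] [Module K W]
    (F : ℤ → V →ₗ[K] W) : ∃ L : V →ₗ[K] W, ∀ i, ∀ x ∈ V.gr i, L x = F i x := by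
  refine ⟨DirectSum.toModule K ℤ W (fun i => F i ∘ₗ (V.gr i).subtype) ∘ₗ V.decomp, ?_⟩
  intro i x hx
  simp [V.decomp_of_mem hx]

variable {ι : Type*} [Fintype ι] [DecidableEq ι] {X : DGModule K} {Y : ι → DGModule K}
  {W : Type*} [AddCommGroup W] [Module K W]

theorem multilinear_ext_homogeneous {f g : MultilinearMap K (fun l => (Y l : Type u)) W}
    (h : ∀ (e : ι → ℤ) (y : ∀ l, Y l), (∀ l, y l ∈ (Y l).gr (e l)) → f y = g y) : f = g := by
  ext y
  refine multilinear_eq_on_span f g (fun l => {x | ∃ i, x ∈ (Y l).gr i}) ?_ y fun l => ?_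
  · intro x hx
    choose e he using hx
    exact h e x he
  · rw [(Y l).span_homogeneous]; trivial

/-- A formula with Koszul signs is multilinear only for fixed degrees of the arguments. Such
formulas, one for each multidegree, are glued along the decompositions of the factors, with no
compatibility required. -/
theorem exists_multilinear_homogeneous (F : (ι → ℤ) → MultilinearMap K (fun l => (Y l : Type u)) W) :
    ∃ M : MultilinearMap K (fun l => (Y l : Type u)) W,
      ∀ (e : ι → ℤ) (y : ∀ l, Y l), (∀ l, y l ∈ (Y l).gr (e l)) → M y = F e y := by
  refine ⟨(MultilinearMap.fromDirectSumEquiv (R := K) (M := fun l (i : ℤ) => (Y l).gr i)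
    fun e => (F e).compLinearMap fun l => ((Y l).gr (e l)).subtype).compLinearMap
      fun l => (Y l).decomp, ?_⟩
  intro e y hy
  rw [MultilinearMap.compLinearMap_apply]
  have : (fun l => (Y l).decomp (y l)) =
      fun l => DirectSum.lof K ℤ (fun i => (Y l).gr i) (e l) ⟨y l, hy l⟩ :=
    funext fun l => (Y l).decomp_of_mem (hy l)
  rw [this, MultilinearMap.fromDirectSumEquiv_lof]
  rfl

theorem tensor_ext_homogeneous {f g : X ⊗[K] (⨂[K] l, Y l) →ₗ[K] W}
    (h : ∀ (p : ℤ) (e : ι → ℤ) (x : X) (y : ∀ l, Y l), x ∈ X.gr p →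
      (∀ l, y l ∈ (Y l).gr (e l)) →
      f (x ⊗ₜ PiTensorProduct.tprod K y) = g (x ⊗ₜ PiTensorProduct.tprod K y)) : f = g := by
  refine TensorProduct.ext (DGModule.linearMap_ext fun p x hx => ?_)
  refine PiTensorProduct.ext (multilinear_ext_homogeneous fun e y hy => ?_)
  exact h p e x y hx hy

/-- Linear maps on a tensor product can be prescribed in each multidegree. -/
theorem exists_tensor_homogeneous
    (F : ℤ → (ι → ℤ) → X →ₗ[K] MultilinearMap K (fun l => (Y l : Type u)) W) :
    ∃ L : X ⊗[K] (⨂[K] l, Y l) →ₗ[K] W,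
      ∀ (p : ℤ) (e : ι → ℤ) (x : X) (y : ∀ l, Y l), x ∈ X.gr p →
        (∀ l, y l ∈ (Y l).gr (e l)) → L (x ⊗ₜ PiTensorProduct.tprod K y) = F p e x y := by
  choose M hM using fun p x => exists_multilinear_homogeneous fun e => F p e x
  let N : ℤ → X →ₗ[K] MultilinearMap K (fun l => (Y l : Type u)) W := fun p =>
    { toFun := M p
      map_add' := fun x x' => multilinear_ext_homogeneous fun e y hy => by
        simp [hM _ _ _ _ hy]
      map_smul' := fun c x => multilinear_ext_homogeneous fun e y hy => by
        simp [hM _ _ _ _ hy] }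
  obtain ⟨L, hL⟩ := X.exists_linearMap N
  refine ⟨TensorProduct.lift (PiTensorProduct.lift.toLinearMap ∘ₗ L), ?_⟩
  intro p e x y hx hy
  simp [hL p x hx, N, hM _ _ _ _ hy]

theorem span_tensor_homogeneous :
    Submodule.span K {t : X ⊗[K] (⨂[K] l, Y l) | ∃ (p : ℤ) (e : ι → ℤ) (x : X) (y : ∀ l, Y l),
      x ∈ X.gr p ∧ (∀ l, y l ∈ (Y l).gr (e l)) ∧ t = x ⊗ₜ PiTensorProduct.tprod K y} = ⊤ := by
  set S := Submodule.span K {t : X ⊗[K] (⨂[K] l, Y l) | ∃ (p : ℤ) (e : ι → ℤ) (x : X)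
    (y : ∀ l, Y l), x ∈ X.gr p ∧ (∀ l, y l ∈ (Y l).gr (e l)) ∧ t = x ⊗ₜ PiTensorProduct.tprod K y}
  have h : S.mkQ = 0 := tensor_ext_homogeneous fun p e x y hx hy => by
    rw [LinearMap.zero_apply, Submodule.mkQ_apply, Submodule.Quotient.mk_eq_zero]
    exact Submodule.subset_span ⟨p, e, x, y, hx, hy, rfl⟩
  rw [← S.ker_mkQ, h, LinearMap.ker_zero]

end Homogeneous

/-- Multilinear maps on products of `X_j ⊗ V ⊗ ⋯ ⊗ V` can be prescribed in each multidegree. -/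
theorem exists_multilinear_blocks {k : ℕ} {i : Fin k → ℕ} {X : Fin k → DGModule K}
    {V : DGModule K} {W : Type*} [AddCommGroup W] [Module K W]
    (F : (Fin k → ℤ) → ((Σ j, Fin (i j)) → ℤ) → MultilinearMap K (fun j => (X j : Type u))
      (MultilinearMap K (fun _ : (Σ j, Fin (i j)) => (V : Type u)) W)) :
    ∃ M : MultilinearMap K (fun j => X j ⊗[K] (⨂[K] _ : Fin (i j), V)) W,
      ∀ (q : Fin k → ℤ) (r : (Σ j, Fin (i j)) → ℤ) (ν : ∀ j, X j) (ρ : (Σ j, Fin (i j)) → V),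
        (∀ j, ν j ∈ (X j).gr (q j)) → (∀ x, ρ x ∈ V.gr (r x)) →
        M (fun j => ν j ⊗ₜ PiTensorProduct.tprod K fun l => ρ ⟨j, l⟩) = F q r ν ρ := by
  -- A generator carries its degrees as data, because F depends on them and zero is homogeneous of
  -- every degree.
  let G : Fin k → Type u := fun j => {g : ℤ × (Fin (i j) → ℤ) × X j × (Fin (i j) → V) //
    g.2.2.1 ∈ (X j).gr g.1 ∧ ∀ l, g.2.2.2 l ∈ V.gr (g.2.1 l)}
  obtain ⟨M, hM⟩ := exists_multilinear (K := K) (G := G)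
    (X := fun j => X j ⊗[K] (⨂[K] _ : Fin (i j), V))
    (fun j g => g.1.2.2.1 ⊗ₜ PiTensorProduct.tprod K g.1.2.2.2)
    (fun j => by
      rw [← span_tensor_homogeneous]
      congr 1
      ext t
      constructor
      · rintro ⟨g, rfl⟩
        exact ⟨_, _, _, _, g.2.1, g.2.2, rfl⟩
      · rintro ⟨p, e, x, y, hx, hy, rfl⟩
        exact ⟨⟨(p, e, x, y), hx, hy⟩, rfl⟩)
    (fun g => F (fun j => (g j).1.1) (fun x => (g x.1).1.2.1 x.2) (fun j => (g j).1.2.2.1)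
      (fun x => (g x.1).1.2.2.2 x.2))
    (fun j g => by
      -- Linear extension in the j-th factor: the data of all other factors are frozen, degrees
      -- included, and only the entries at j vary.
      let N : ℤ → (Fin (i j) → ℤ) → X j →ₗ[K] MultilinearMap K (fun _ : Fin (i j) => (V : Type u)) W :=
        fun p e =>
        { toFun := fun x =>
            { toFun := fun y => F (Function.update (fun j => (g j).1.1) j p)
                (fun z => Function.update (β := fun j => Fin (i j) → ℤ)
                  (fun j => (g j).1.2.1) j e z.1 z.2)
                (Function.update (fun j => (g j).1.2.2.1) j x)
                (fun z => Function.update (β := fun j => Fin (i j) → V)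
                  (fun j => (g j).1.2.2.2) j y z.1 z.2)
              map_update_add' := by
                intro inst y l a b
                obtain rfl : inst = instDecidableEqFin _ := Subsingleton.elim _ _
                have h : ∀ a, (fun z : (Σ j, Fin (i j)) => Function.update (β := fun j => Fin (i j) → V)
                    (fun j => (g j).1.2.2.2) j (Function.update y l a) z.1 z.2) =
                    Function.update (fun z : (Σ j, Fin (i j)) => Function.update
                      (β := fun j => Fin (i j) → V) (fun j => (g j).1.2.2.2) j y z.1 z.2) ⟨j, l⟩ a := by
                  intro a
                  funext ⟨j', l'⟩
                  by_cases hj : j' = j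
                  · subst hj
                    by_cases hl : l' = l
                    · subst hl; simp
                    · simp [hl]
                  · simp [hj]
                rw [h, h, h, MultilinearMap.map_update_add]
              map_update_smul' := by
                intro inst y l c a
                obtain rfl : inst = instDecidableEqFin _ := Subsingleton.elim _ _
                have h : ∀ a, (fun z : (Σ j, Fin (i j)) => Function.update (β := fun j => Fin (i j) → V)
                    (fun j => (g j).1.2.2.2) j (Function.update y l a) z.1 z.2) =
                    Function.update (fun z : (Σ j, Fin (i j)) => Function.update
                      (β := fun j => Fin (i j) → V) (fun j => (g j).1.2.2.2) j y z.1 z.2) ⟨j, l⟩ a := by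
                  intro a
                  funext ⟨j', l'⟩
                  by_cases hj : j' = j
                  · subst hj
                    by_cases hl : l' = l
                    · subst hl; simp
                    · simp [hl]
                  · simp [hj]
                rw [h, h, MultilinearMap.map_update_smul] }
          map_add' := fun x x' => by ext y; simp
          map_smul' := fun c x => by ext y; simp }
      obtain ⟨L, hL⟩ := exists_tensor_homogeneous N
      refine ⟨L, fun g' => ?_⟩
      rw [hL _ _ _ _ g'.2.1 g'.2.2]
      simp only [N, LinearMap.coe_mk, AddHom.coe_mk, MultilinearMap.coe_mk]
      congr 1
      · congr 1
        · congr 1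
          · funext j'
            by_cases h : j' = j
            · subst h; simp
            · simp [h]
          · funext ⟨j', l'⟩
            by_cases h : j' = j
            · subst h; simp
            · simp [h]
        · funext j'
          by_cases h : j' = j
          · subst h; simp
          · simp [h]
      · funext ⟨j', l'⟩
        by_cases h : j' = j
        · subst h; simp
        · simp [h])
  refine ⟨M, fun q r ν ρ hν hρ => ?_⟩
  exact hM fun j => ⟨(q j, fun l => r ⟨j, l⟩, ν j, fun l => ρ ⟨j, l⟩), hν j, fun l => hρ ⟨j, l⟩⟩

/-! ## Gradings from weights -/

/-- In characteristic `0`, submodules on which an operator acts with eigenvalue `2 ^ i` form a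
grading if they span. -/
theorem isInternal_of_weight [CharZero K] {V : Type*} [AddCommGroup V] [Module K V]
    (gr : ℤ → Submodule K V) (E : V →ₗ[K] V) (hE : ∀ i, ∀ x ∈ gr i, E x = (2 : K) ^ i • x)
    (h : ⨆ i, gr i = ⊤) : DirectSum.IsInternal gr := by
  refine DirectSum.isInternal_submodule_of_iSupIndep_of_iSup_eq_top ?_ h
  -- Eigenspaces for distinct eigenvalues are independent, and characteristic 0 keeps the rational
  -- powers of 2 distinct in the field.
  have h1 := (Module.End.eigenspaces_iSupIndep E).comp (f := fun i : ℤ => (2 : K) ^ i) (by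
    intro i j hij
    have h2 : ((2 : ℚ) ^ i) = 2 ^ j := by
      have : (((2 : ℚ) ^ i : ℚ) : K) = ((2 ^ j : ℚ) : K) := by push_cast; exact hij
      exact_mod_cast this
    exact zpow_right_injective₀ (by norm_num) (by norm_num) h2)
  refine h1.mono fun i x hx => ?_
  exact Module.End.mem_eigenspace_iff.2 (hE i x hx)

theorem DGModule.exists_weight (V : DGModule K) :
    ∃ E : V →ₗ[K] V, ∀ i, ∀ x ∈ V.gr i, E x = (2 : K) ^ i • x :=
  V.exists_linearMap (F := fun i => (2 : K) ^ i • LinearMap.id)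

/-! ## Separation by functionals -/

/-- Coordinates with respect to a basis collected from the homogeneous components are homogeneous
functionals. This is why the axioms of cooperads and coalgebras, tested on such functionals,
determine tensors. -/
theorem DGModule.exists_basis (V : DGModule K) : ∃ (I : Type u) (b : Module.Basis I K V)
    (deg : I → ℤ), (∀ i, b i ∈ V.gr (deg i)) ∧
      ∀ i, IsHomogeneousFunctional (b.coord i) (deg i) := by
  refine ⟨_, V.isInternal.collectedBasis fun i => Module.Basis.ofVectorSpace K (V.gr i),
    fun a => a.1, fun a => V.isInternal.collectedBasis_mem _ a, ?_⟩
  rintro ⟨i, a⟩ i' hi x hx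
  exact V.isInternal.collectedBasis_repr_of_mem_ne _ hi hx

/-- The functional `y_0 ⊗ ⋯ ↦ v_0(y_0) ⋯`. -/
def prodFunctional {ι : Type*} [Fintype ι] {Y : ι → DGModule K} (v : ∀ j, Y j →ₗ[K] K) :
    (⨂[K] j, Y j) →ₗ[K] K :=
  PiTensorProduct.lift ((MultilinearMap.mkPiAlgebra K ι K).compLinearMap v)

@[simp] theorem prodFunctional_tprod {ι : Type*} [Fintype ι] {Y : ι → DGModule K}
    (v : ∀ j, Y j →ₗ[K] K) (y : ∀ j, Y j) :
    prodFunctional v (PiTensorProduct.tprod K y) = ∏ j, v j (y j) := by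
  simp [prodFunctional]

@[simp] theorem contract_tprod {X : DGModule K} {n : ℕ} {Y : Fin n → DGModule K}
    (u : X →ₗ[K] K) (v : ∀ j, Y j →ₗ[K] K) (x : X) (y : ∀ j, Y j) :
    contract u v (x ⊗ₜ PiTensorProduct.tprod K y) = u x * ∏ j, v j (y j) := by
  simp [contract]

/-- The coordinates of a tensor in a product of homogeneous bases are contractions with homogeneous
functionals. -/
theorem eq_of_contract_eq {X : DGModule K} {n : ℕ} {Y : Fin n → DGModule K}
    {t t' : X ⊗[K] (⨂[K] j, Y j)}
    (h : ∀ (p : ℤ) (q : Fin n → ℤ) (u : X →ₗ[K] K) (v : ∀ j, Y j →ₗ[K] K),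
      IsHomogeneousFunctional u p → (∀ j, IsHomogeneousFunctional (v j) (q j)) →
      contract u v t = contract u v t') : t = t' := by
  obtain ⟨I, b, deg, -, hb⟩ := X.exists_basis
  choose J c deg' _ hc using fun j => (Y j).exists_basis
  refine (b.tensorProduct (Basis.piTensorProduct c)).ext_elem fun ⟨a, a'⟩ => ?_
  have h1 : (b.tensorProduct (Basis.piTensorProduct c)).coord (a, a') =
      contract (b.coord a) fun j => (c j).coord (a' j) := by
    ext x y
    simp [mul_comm]
  have h2 := h _ _ _ _ (hb a) fun j => hc j (a' j)
  rw [← h1] at h2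
  simpa using h2

/-- The functional `x ⊗ (y_0 ⊗ ⋯ ⊗ (z_0 ⊗ ⋯)) ↦ u(x) ∏ v_j(y_j) ∏ w_l(z_l)`. -/
def contractTwo {X : DGModule K} {k n : ℕ} {Y : Fin k → DGModule K} {Z : Fin n → DGModule K}
    (u : X →ₗ[K] K) (v : ∀ j, Y j →ₗ[K] K) (w : ∀ j, Z j →ₗ[K] K) :
    (X ⊗[K] ((⨂[K] j, Y j) ⊗[K] (⨂[K] j, Z j))) →ₗ[K] K :=
  LinearMap.mul' K K ∘ₗ TensorProduct.map u
    (LinearMap.mul' K K ∘ₗ TensorProduct.map (prodFunctional v) (prodFunctional w))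

theorem eq_of_contractTwo_eq {X : DGModule K} {k n : ℕ} {Y : Fin k → DGModule K}
    {Z : Fin n → DGModule K} {t t' : X ⊗[K] ((⨂[K] j, Y j) ⊗[K] (⨂[K] j, Z j))}
    (h : ∀ (p : ℤ) (q : Fin k → ℤ) (r : Fin n → ℤ) (u : X →ₗ[K] K) (v : ∀ j, Y j →ₗ[K] K)
      (w : ∀ j, Z j →ₗ[K] K), IsHomogeneousFunctional u p →
      (∀ j, IsHomogeneousFunctional (v j) (q j)) → (∀ j, IsHomogeneousFunctional (w j) (r j)) →
      contractTwo u v w t = contractTwo u v w t') : t = t' := by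
  obtain ⟨I, b, deg, -, hb⟩ := X.exists_basis
  choose J c deg' _ hc using fun j => (Y j).exists_basis
  choose J' c' deg'' _ hc' using fun j => (Z j).exists_basis
  refine (b.tensorProduct ((Basis.piTensorProduct c).tensorProduct
    (Basis.piTensorProduct c'))).ext_elem fun ⟨a, a', a''⟩ => ?_
  have h1 : (b.tensorProduct ((Basis.piTensorProduct c).tensorProduct
      (Basis.piTensorProduct c'))).coord (a, a', a'') =
      contractTwo (b.coord a) (fun j => (c j).coord (a' j)) fun j => (c' j).coord (a'' j) := by
    ext x y z
    simp [contractTwo, mul_comm]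
  have h2 := h _ _ _ _ _ _ (hb a) (fun j => hc j (a' j)) fun j => hc' j (a'' j)
  rw [← h1] at h2
  simpa using h2

/-! ## Words in the free algebra -/

section Words

variable (P : Operad K) (V : DGModule K)

/-- The class of `μ ⊗ v_1 ⊗ ⋯ ⊗ v_n` in `P(V)`. -/
def word {n : ℕ} : P.obj n →ₗ[K] MultilinearMap K (fun _ : Fin n => (V : Type u)) (Schur P V) where
  toFun μ := ((schurRel P V).mkQ ∘ₗ DirectSum.lof K ℕ (fun n => P.obj n ⊗[K] (⨂[K] _ : Fin n, V)) n
    ∘ₗ TensorProduct.mk K _ _ μ).compMultilinearMap (PiTensorProduct.tprod K)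
  map_add' μ μ' := by ext v; simp
  map_smul' c μ := by ext v; simp

variable {P V}

theorem mkQ_schurWord {n : ℕ} (μ : P.obj n) (v : Fin n → V) :
    (schurRel P V).mkQ (schurWord P μ v) = word P V μ v := rfl

theorem word_map {m n : ℕ} (σ : Fin m ≃ Fin n) (μ : P.obj m) {e : Fin n → ℤ} {v : Fin n → V}
    (hv : ∀ l, v l ∈ V.gr (e l)) :
    word P V (P.map σ μ) v = ksign K (permExp σ e) • word P V μ fun l => v (σ l) := by
  obtain rfl : m = n := by simpa using Fintype.card_congr σ
  rw [← mkQ_schurWord, ← mkQ_schurWord, ← map_smul, ← sub_eq_zero, ← map_sub, ← LinearMap.mem_ker,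
    Submodule.ker_mkQ]
  exact Submodule.subset_span ⟨_, σ, μ, e, v, hv, rfl⟩

theorem word_finCongr {m n : ℕ} (h : m = n) (μ : P.obj m) (v : Fin n → V) :
    word P V (P.map (finCongr h) μ) v = word P V μ fun l => v (finCongr h l) := by
  subst h
  simp only [finCongr_refl, Equiv.refl_apply]
  rw [P.map_refl]

theorem schurRaw_ext {W : Type*} [AddCommGroup W] [Module K W] {f g : SchurRaw P V →ₗ[K] W}
    (h : ∀ {n : ℕ} (p : ℤ) (e : Fin n → ℤ) (μ : P.obj n) (v : Fin n → V), μ ∈ (P.obj n).gr p →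
      (∀ l, v l ∈ V.gr (e l)) → f (schurWord P μ v) = g (schurWord P μ v)) : f = g :=
  DirectSum.linearMap_ext K fun _ => tensor_ext_homogeneous fun p e μ v hμ hv => h p e μ v hμ hv

theorem schur_ext {W : Type*} [AddCommGroup W] [Module K W] {f g : Schur P V →ₗ[K] W}
    (h : ∀ {n : ℕ} (p : ℤ) (e : Fin n → ℤ) (μ : P.obj n) (v : Fin n → V), μ ∈ (P.obj n).gr p →
      (∀ l, v l ∈ V.gr (e l)) → f (word P V μ v) = g (word P V μ v)) : f = g :=
  Submodule.linearMap_qext _ (schurRaw_ext fun p e μ v hμ hv => h p e μ v hμ hv)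

/-- Linear maps on `P(V)` can be prescribed on homogeneous words if the symmetry is respected. -/
theorem exists_schur_lift {W : Type*} [AddCommGroup W] [Module K W]
    (F : ∀ n : ℕ, ℤ → (Fin n → ℤ) →
      P.obj n →ₗ[K] MultilinearMap K (fun _ : Fin n => (V : Type u)) W)
    (hF : ∀ (n : ℕ) (σ : Fin n ≃ Fin n) (p : ℤ) (e : Fin n → ℤ) (μ : P.obj n) (v : Fin n → V),
      μ ∈ (P.obj n).gr p → (∀ l, v l ∈ V.gr (e l)) →
      F n p e (P.map σ μ) v = ksign K (permExp σ e) • F n p (e ∘ σ) μ fun l => v (σ l)) :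
    ∃ L : Schur P V →ₗ[K] W, ∀ {n : ℕ} (p : ℤ) (e : Fin n → ℤ) (μ : P.obj n) (v : Fin n → V),
      μ ∈ (P.obj n).gr p → (∀ l, v l ∈ V.gr (e l)) → L (word P V μ v) = F n p e μ v := by
  choose L hL using fun n => exists_tensor_homogeneous (X := P.obj n) (Y := fun _ : Fin n => V) (F n)
  let R : SchurRaw P V →ₗ[K] W := DirectSum.toModule K ℕ W L
  have hR : ∀ {n : ℕ} (μ : P.obj n) (v : Fin n → V),
      R (schurWord P μ v) = L n (μ ⊗ₜ PiTensorProduct.tprod K v) := fun μ v => by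
    simp [R, schurWord]
  have hker : schurRel P V ≤ LinearMap.ker R := by
    rw [schurRel, Submodule.span_le]
    rintro _ ⟨n, σ, μ, e, v, hv, rfl⟩
    rw [SetLike.mem_coe, LinearMap.mem_ker, map_sub, map_smul, sub_eq_zero, hR, hR]
    -- For fixed letters both sides of the relation are linear in the operation, so it may be
    -- assumed homogeneous, although the relations allow any operation.
    have h : ((L n).comp ((TensorProduct.mk K _ _).flip (PiTensorProduct.tprod K v))).comp
        (P.map σ) = ksign K (permExp σ e) • (L n).comp ((TensorProduct.mk K _ _).flip
          (PiTensorProduct.tprod K fun l => v (σ l))) := by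
      refine DGModule.linearMap_ext fun p x hx => ?_
      have h1 := hL n p e _ v (P.map_mem σ hx) hv
      have h2 := hL n p (e ∘ σ) x (fun l => v (σ l)) hx fun l => hv _
      simp [h1, h2, hF n σ p e x v hx hv]
    exact LinearMap.congr_fun h μ
  refine ⟨(schurRel P V).liftQ R hker, ?_⟩
  intro n p e μ v hμ hv
  rw [← mkQ_schurWord, Submodule.mkQ_apply, Submodule.liftQ_apply, hR, hL n p e μ v hμ hv]

theorem word_range_span : Submodule.span K {x : Schur P V | ∃ (n : ℕ) (p : ℤ) (e : Fin n → ℤ)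
    (μ : P.obj n) (v : Fin n → V), μ ∈ (P.obj n).gr p ∧ (∀ l, v l ∈ V.gr (e l)) ∧
      x = word P V μ v} = ⊤ := by
  rw [← Submodule.ker_mkQ (Submodule.span K _), LinearMap.ker_eq_top]
  refine schur_ext fun p e μ v hμ hv => ?_
  rw [LinearMap.zero_apply, Submodule.mkQ_apply, Submodule.Quotient.mk_eq_zero]
  exact Submodule.subset_span ⟨_, p, e, μ, v, hμ, hv, rfl⟩

theorem schurWord_range_span : Submodule.span K {x : SchurRaw P V | ∃ (n : ℕ) (p : ℤ)
    (e : Fin n → ℤ) (μ : P.obj n) (v : Fin n → V), μ ∈ (P.obj n).gr p ∧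
      (∀ l, v l ∈ V.gr (e l)) ∧ x = schurWord P μ v} = ⊤ := by
  rw [← Submodule.ker_mkQ (Submodule.span K _), LinearMap.ker_eq_top]
  refine schurRaw_ext fun p e μ v hμ hv => ?_
  rw [LinearMap.zero_apply, Submodule.mkQ_apply, Submodule.Quotient.mk_eq_zero]
  exact Submodule.subset_span ⟨_, p, e, μ, v, hμ, hv, rfl⟩

/-- The operations of the free algebra before passage to coinvariants in the arguments. -/
theorem exists_schurRaw_op {k : ℕ} (μ : P.obj k) :
    ∃ M : MultilinearMap K (fun _ : Fin k => SchurRaw P V) (Schur P V),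
      ∀ (i : Fin k → ℕ) (q : Fin k → ℤ) (r : (Σ j, Fin (i j)) → ℤ) (ν : ∀ j, P.obj (i j))
        (v : (Σ j, Fin (i j)) → V), (∀ j, ν j ∈ (P.obj (i j)).gr (q j)) →
        (∀ x, v x ∈ V.gr (r x)) →
        M (fun j => schurWord P (ν j) fun l => v ⟨j, l⟩) = ksign K (shuffleExp q r) •
          word P V (P.comp i μ ν) fun y => v (finSigmaFinEquiv.symm y) := by
  choose M hM using fun i : Fin k → ℕ => exists_multilinear_blocks (V := V)
    (X := fun j => P.obj (i j)) fun q r => ksign K (shuffleExp q r) •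
      ((MultilinearMap.domDomCongrLinearEquiv K K (V : Type u) (Schur P V)
        finSigmaFinEquiv.symm).toLinearMap ∘ₗ word P V).compMultilinearMap (P.comp i μ)
  refine ⟨MultilinearMap.fromDirectSumEquiv (R := K) M, fun i q r ν v hν hv => ?_⟩
  unfold schurWord
  rw [MultilinearMap.fromDirectSumEquiv_lof, hM i q r ν v hν hv]
  rfl

/-- A permutation of the letters inside one argument becomes a permutation inside one block of the
composite, by `comp_map_inner`; the sum over a block is unchanged, so the shuffle sign is too. Hence
the operation passes to coinvariants in every argument. -/
theorem exists_schur_op {k : ℕ} (μ : P.obj k) :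
    ∃ M : MultilinearMap K (fun _ : Fin k => Schur P V) (Schur P V),
      ∀ (i : Fin k → ℕ) (q : Fin k → ℤ) (r : (Σ j, Fin (i j)) → ℤ) (ν : ∀ j, P.obj (i j))
        (v : (Σ j, Fin (i j)) → V), (∀ j, ν j ∈ (P.obj (i j)).gr (q j)) →
        (∀ x, v x ∈ V.gr (r x)) →
        M (fun j => word P V (ν j) fun l => v ⟨j, l⟩) = ksign K (shuffleExp q r) •
          word P V (P.comp i μ ν) fun y => v (finSigmaFinEquiv.symm y) := by
  obtain ⟨M, hM⟩ := exists_schurRaw_op (V := V) μ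
  -- the symmetry in the arguments
  have hsym : ∀ (i : Fin k → ℕ) (σ : ∀ j, Fin (i j) ≃ Fin (i j)) (q : Fin k → ℤ)
      (r : (Σ j, Fin (i j)) → ℤ) (ν : ∀ j, P.obj (i j)) (v : (Σ j, Fin (i j)) → V),
      (∀ j, ν j ∈ (P.obj (i j)).gr (q j)) → (∀ x, v x ∈ V.gr (r x)) →
      M (fun j => schurWord P (P.map (σ j) (ν j)) fun l => v ⟨j, l⟩) =
        ksign K (∑ j, permExp (σ j) fun l => r ⟨j, l⟩) •
          M (fun j => schurWord P (ν j) fun l => v ⟨j, σ j l⟩) := by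
    intro i σ q r ν v hν hv
    rw [hM i q r (fun j => P.map (σ j) (ν j)) v (fun j => P.map_mem _ (hν j)) hv,
      hM i q (fun x => r ⟨x.1, σ x.1 x.2⟩) ν (fun x => v ⟨x.1, σ x.1 x.2⟩) hν (fun x => hv _),
      P.comp_map_inner i i σ μ ν,
      word_map (blockInner σ) _ (e := fun y => r (finSigmaFinEquiv.symm y)) (fun y => hv _),
      permExp_blockInner, smul_comm]
    congr 2
    · rw [shuffleExp_eq, shuffleExp_eq]
      congr 2
      funext j
      exact (Equiv.sum_comp (σ j) fun l => r ⟨j, l⟩).symm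
    · congr 1
      funext y
      obtain ⟨⟨j, l⟩, rfl⟩ := finSigmaFinEquiv.surjective y
      rw [blockInner_finSigma, Equiv.symm_apply_apply, Equiv.symm_apply_apply]
  obtain ⟨M', hM'⟩ := exists_multilinear_quotient (N := fun _ => schurRel P V) M (by
    intro j x z hz
    suffices h : schurRel P V ≤ LinearMap.ker (M.toLinearMap x j) from h hz
    refine Submodule.span_le.2 ?_
    rintro _ ⟨n, τ, μ', e, v', hv', rfl⟩
    rw [SetLike.mem_coe, LinearMap.mem_ker]
    -- The relation as a linear map of its operation, which may then be taken homogeneous.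
    let T : P.obj n →ₗ[K] SchurRaw P V :=
      DirectSum.lof K ℕ (fun n => P.obj n ⊗[K] (⨂[K] _ : Fin n, V)) n ∘ₗ
        (TensorProduct.mk K _ _).flip (PiTensorProduct.tprod K v') ∘ₗ P.map τ -
      ksign K (permExp τ e) • DirectSum.lof K ℕ (fun n => P.obj n ⊗[K] (⨂[K] _ : Fin n, V)) n ∘ₗ
        (TensorProduct.mk K _ _).flip (PiTensorProduct.tprod K fun l => v' (τ l))
    have hT : ∀ μ', T μ' = schurWord P (P.map τ μ') v' -
      ksign K (permExp τ e) • schurWord P μ' fun l => v' (τ l) := fun μ' => rfl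
    suffices h : M.toLinearMap x j ∘ₗ T = 0 from LinearMap.congr_fun h μ'
    refine DGModule.linearMap_ext fun p μ' hμ' => ?_
    rw [LinearMap.comp_apply, MultilinearMap.toLinearMap_apply, LinearMap.zero_apply]
    -- All arguments but the j-th are reduced to homogeneous words; the j-th is held at the relation
    -- by allowing a single value there.
    refine multilinear_eq_on_span M 0 (fun l => if l = j then {T μ'} else
      {x | ∃ (n : ℕ) (p : ℤ) (e : Fin n → ℤ) (μ : P.obj n) (v : Fin n → V), μ ∈ (P.obj n).gr p ∧
      (∀ l, v l ∈ V.gr (e l)) ∧ x = schurWord P μ v}) ?_ _ ?_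
    · intro y hy
      have hyj : y j = T μ' := by simpa using hy j
      have hy' : ∀ l, ∃ g : Σ n : ℕ, ℤ × (Fin n → ℤ) × P.obj n × (Fin n → V),
          (g.2.2.2.1 ∈ (P.obj g.1).gr g.2.1 ∧ ∀ t, g.2.2.2.2 t ∈ V.gr (g.2.2.1 t)) ∧
          (l ≠ j → y l = schurWord P g.2.2.2.1 g.2.2.2.2) ∧
          (l = j → g = ⟨n, p, e, μ', v'⟩) := by
        intro l
        by_cases hl : l = j
        · exact ⟨⟨n, p, e, μ', v'⟩, ⟨hμ', hv'⟩, fun h => absurd hl h, fun _ => rfl⟩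
        · have := hy l
          rw [if_neg hl] at this
          obtain ⟨n, p, e, μ, v, h1, h2, h3⟩ := this
          exact ⟨⟨n, p, e, μ, v⟩, ⟨h1, h2⟩, fun _ => h3, fun h => absurd h hl⟩
      choose g hg hgy hgj using hy'
      -- The data of the j-th argument is a variable here, so that its equation with `g j` can be
      -- substituted in spite of the dependent types.
      have fin : ∀ (G : Σ n : ℕ, ℤ × (Fin n → ℤ) × P.obj n × (Fin n → V)), g j = G →
          ∀ τ : Fin G.1 ≃ Fin G.1, y j = schurWord P (P.map τ G.2.2.2.1) G.2.2.2.2 -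
            ksign K (permExp τ G.2.2.1) • schurWord P G.2.2.2.1 (fun l => G.2.2.2.2 (τ l)) →
          M y = 0 := by
        rintro _ rfl τ hτ
        have e1 := hsym (fun l => (g l).1) (Function.update (fun l => Equiv.refl _) j τ)
          (fun l => (g l).2.1) (fun x => (g x.1).2.2.1 x.2) (fun l => (g l).2.2.2.1)
          (fun x => (g x.1).2.2.2.2 x.2) (fun l => (hg l).1) (fun x => (hg x.1).2 x.2)
        rw [Finset.sum_eq_single j, Function.update_self] at e1
        · have e2 : y = Function.update y j (y j) := by simp
          have e3 : (fun l => schurWord P (P.map (Function.update (β := fun l => Fin (g l).1 ≃ Fin (g l).1)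
              (fun l => Equiv.refl _) j τ l) (g l).2.2.2.1) fun t => (g l).2.2.2.2 t) = Function.update y j
                (schurWord P (P.map τ (g j).2.2.2.1) (g j).2.2.2.2) := by
            funext l
            by_cases hl : l = j
            · subst hl; simp
            · simp [hl, hgy l hl, P.map_refl]
          have e4 : (fun l => schurWord P (g l).2.2.2.1 fun t => (g l).2.2.2.2
              (Function.update (β := fun l => Fin (g l).1 ≃ Fin (g l).1)
              (fun l => Equiv.refl (Fin (g l).1)) j τ l t)) = Function.update y j
                (schurWord P (g j).2.2.2.1 fun t => (g j).2.2.2.2 (τ t)) := by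
            funext l
            by_cases hl : l = j
            · subst hl; simp
            · simp [hl, hgy l hl]
          rw [e3, e4] at e1
          rw [e2, hτ, MultilinearMap.map_update_sub, MultilinearMap.map_update_smul, e1, sub_self]
        · intro l _ hl
          rw [Function.update_of_ne hl]
          exact permExp_of_monotone _ (fun _ _ h => h) _
        · simp
      exact fin _ (hgj j rfl) τ (by rw [hyj, hT])
    · intro l
      by_cases hl : l = j
      · subst hl
        rw [if_pos rfl, Function.update_self]
        exact Submodule.mem_span_singleton_self _
      · rw [if_neg hl, Function.update_of_ne hl, schurWord_range_span]
        trivial)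
  refine ⟨M', fun i q r ν v hν hv => ?_⟩
  rw [← hM i q r ν v hν hv, ← hM']
  rfl

theorem schur_multilinear_ext {ι : Type*} [Fintype ι] [DecidableEq ι] {W : Type*} [AddCommGroup W]
    [Module K W] {f g : MultilinearMap K (fun _ : ι => Schur P V) W}
    (h : ∀ (i : ι → ℕ) (q : ι → ℤ) (r : (Σ j, Fin (i j)) → ℤ) (ν : ∀ j, P.obj (i j))
        (v : (Σ j, Fin (i j)) → V), (∀ j, ν j ∈ (P.obj (i j)).gr (q j)) →
        (∀ x, v x ∈ V.gr (r x)) →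
        f (fun j => word P V (ν j) fun l => v ⟨j, l⟩) =
          g (fun j => word P V (ν j) fun l => v ⟨j, l⟩)) : f = g := by
  ext x
  refine multilinear_eq_on_span f g _ ?_ x fun l => by rw [word_range_span (P := P) (V := V)]; trivial
  intro x hx
  choose n p e μ v hμ hv hx using hx
  obtain rfl : x = fun l => word P V (μ l) (v l) := funext hx
  exact h n p (fun x => e x.1 x.2) μ (fun x => v x.1 x.2) hμ fun x => hv _ _

variable (P V)

/-- The operations of the free algebra. -/
def schurOp {k : ℕ} : P.obj k →ₗ[K] MultilinearMap K (fun _ : Fin k => Schur P V) (Schur P V) where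
  toFun μ := (exists_schur_op (V := V) μ).choose
  map_add' μ μ' := schur_multilinear_ext fun i q r ν v hν hv => by
    rw [_root_.add_apply, (exists_schur_op _).choose_spec i q r ν v hν hv,
      (exists_schur_op μ).choose_spec i q r ν v hν hv,
      (exists_schur_op μ').choose_spec i q r ν v hν hv]
    simp
  map_smul' c μ := schur_multilinear_ext fun i q r ν v hν hv => by
    rw [_root_.smul_apply, (exists_schur_op _).choose_spec i q r ν v hν hv,
      (exists_schur_op μ).choose_spec i q r ν v hν hv]
    simp [smul_comm c]

variable {P V}

theorem schurOp_word {k : ℕ} (μ : P.obj k) {i : Fin k → ℕ} {q : Fin k → ℤ}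
    {r : (Σ j, Fin (i j)) → ℤ} {ν : ∀ j, P.obj (i j)} {v : (Σ j, Fin (i j)) → V}
    (hν : ∀ j, ν j ∈ (P.obj (i j)).gr (q j)) (hv : ∀ x, v x ∈ V.gr (r x)) :
    schurOp P V μ (fun j => word P V (ν j) fun l => v ⟨j, l⟩) = ksign K (shuffleExp q r) •
      word P V (P.comp i μ ν) fun y => v (finSigmaFinEquiv.symm y) :=
  (exists_schur_op μ).choose_spec i q r ν v hν hv

end Words

/-! ## The free dg algebra -/

theorem update_id_apply {ι : Type*} [DecidableEq ι] {X : ι → Type*} [∀ l, AddCommGroup (X l)]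
    [∀ l, Module K (X l)] (j : ι) (D : X j →ₗ[K] X j) (b : ∀ l, X l) :
    (fun l => Function.update (β := fun l => X l →ₗ[K] X l) (fun _ => LinearMap.id) j D l (b l)) =
      Function.update b j (D (b j)) := by
  funext l
  by_cases h : l = j
  · subst h; simp
  · simp [h]

/-- For squares of odd operators: the two orders of acting on distinct arguments cancel. -/
theorem sum_sum_eq_sum_diag {n : ℕ} {M : Type*} [AddCommGroup M] (f : Fin n → Fin n → M)
    (h : ∀ l m, l < m → f l m + f m l = 0) : ∑ l, ∑ m, f l m = ∑ l, f l l := by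
  have h1 : ∀ l m, f l m = (if l < m then f l m else 0) + (if m < l then f l m else 0) +
      if m = l then f l m else 0 := by
    intro l m
    rcases lt_trichotomy l m with h | rfl | h
    · simp [h, not_lt_of_gt h, h.ne']
    · simp
    · simp [h, not_lt_of_gt h, h.ne]
  calc ∑ l, ∑ m, f l m = ∑ l, ∑ m, (if l < m then f l m else 0) +
        ∑ l, ∑ m, (if m < l then f l m else 0) + ∑ l, ∑ m, if m = l then f l m else 0 := by
          simp only [← Finset.sum_add_distrib]
          exact Finset.sum_congr rfl fun l _ => Finset.sum_congr rfl fun m _ => h1 l m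
    _ = ∑ l, f l l := by
          rw [Finset.sum_comm (f := fun l m => if m < l then f l m else 0),
            ← Finset.sum_add_distrib, Finset.sum_eq_zero, zero_add]
          · simp
          · intro l _
            rw [← Finset.sum_add_distrib]
            refine Finset.sum_eq_zero fun m _ => ?_
            split_ifs with h2
            · exact h l m h2
            · simp

theorem before_update_of_le {n : ℕ} (e : Fin n → ℤ) {l m : Fin n} (h : m ≤ l) (x : ℤ) :
    before (Function.update e l x) m = before e m := by
  refine Finset.sum_congr rfl fun t ht => ?_
  rw [Function.update_of_ne]
  exact ((Finset.mem_Iio.1 ht).trans_le h).ne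

theorem before_update_of_lt {n : ℕ} (e : Fin n → ℤ) {l m : Fin n} (h : l < m) (x : ℤ) :
    before (Function.update e l x) m = before e m + (x - e l) := by
  have h2 : Function.update e l x = e + Pi.single l (x - e l) := by
    funext t
    by_cases ht : t = l
    · subst ht; simp
    · simp [ht]
  rw [h2, before_add]
  congr 1
  rw [before, Finset.sum_eq_single l] <;> simp +contextual [h]

theorem mem_update {n : ℕ} {X : Type*} [AddCommGroup X] [Module K X] {gr : ℤ → Submodule K X}
    {e : Fin n → ℤ} {b : Fin n → X} (hb : ∀ l, b l ∈ gr (e l)) {j : Fin n} {x : X} {i : ℤ}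
    (hx : x ∈ gr i) (l : Fin n) :
    Function.update b j x l ∈ gr (Function.update e j i l) := by
  by_cases h : l = j
  · subst h; simpa using hx
  · simpa [h] using hb l

/-- The Leibniz rule for operators of degree `-1` on an algebra over the graded operad `P`. -/
def IsLeibniz (P : Operad K) {X : Type u} [AddCommGroup X] [Module K X] (gr : ℤ → Submodule K X)
    (op : ∀ {k : ℕ}, P.obj k →ₗ[K] MultilinearMap K (fun _ : Fin k => X) X) (D : X →ₗ[K] X) : Prop :=
  ∀ {k : ℕ} {p : ℤ} {e : Fin k → ℤ} {μ : P.obj k} {a : Fin k → X},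
    μ ∈ (P.obj k).gr p → (∀ l, a l ∈ gr (e l)) →
    D (op μ a) = op ((P.obj k).d μ) a +
      ∑ l, ksign K (p + before e l) • op μ (Function.update a l (D (a l)))

/-- Acting on an earlier argument lowers the degree in front of a later one by 1, so the two orders
have opposite signs; the terms with the differential of the operation cancel in the same way. Only
D² on single arguments survives, without signs, and therefore D² = 0 need only be checked on
generators. -/
theorem IsLeibniz.sq {P : Operad K} {X : Type u} [AddCommGroup X] [Module K X]
    {gr : ℤ → Submodule K X}
    {op : ∀ {k : ℕ}, P.obj k →ₗ[K] MultilinearMap K (fun _ : Fin k => X) X} {D : X →ₗ[K] X}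
    (hD : IsLeibniz P gr op D) (hmem : ∀ {i x}, x ∈ gr i → D x ∈ gr (i - 1))
    {k : ℕ} {p : ℤ} {e : Fin k → ℤ} {μ : P.obj k} {a : Fin k → X}
    (hμ : μ ∈ (P.obj k).gr p) (ha : ∀ l, a l ∈ gr (e l)) :
    D (D (op μ a)) = ∑ l, op μ (Function.update a l (D (D (a l)))) := by
  rw [hD hμ ha, map_add, hD ((P.obj k).d_mem hμ) ha, (P.obj k).d_d, map_sum]
  have h1 : ∀ l, D (ksign K (p + before e l) • op μ (Function.update a l (D (a l)))) =
      ksign K (p + before e l) • op ((P.obj k).d μ) (Function.update a l (D (a l))) +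
      ∑ m, (ksign K (p + before e l) * ksign K (p + before (Function.update e l (e l - 1)) m)) •
        op μ (Function.update (Function.update a l (D (a l))) m
          (D (Function.update a l (D (a l)) m))) := by
    intro l
    rw [map_smul, hD hμ (mem_update ha (hmem (ha l))), smul_add, Finset.smul_sum]
    simp only [smul_smul]
  rw [Finset.sum_congr rfl fun l _ => h1 l, Finset.sum_add_distrib, ← add_assoc, sum_sum_eq_sum_diag]
  · rw [map_zero, _root_.zero_apply, zero_add, ← Finset.sum_add_distrib,
      Finset.sum_eq_zero, zero_add]
    · refine Finset.sum_congr rfl fun l _ => ?_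
      rw [before_update_of_le _ le_rfl, ksign_mul_self, one_smul, Function.update_self,
        Function.update_idem]
    · intro l _
      rw [show p - 1 + before e l = p + before e l - 1 by ring, ksign_sub_one, neg_smul,
        neg_add_cancel]
  · intro l m hlm
    rw [Function.update_of_ne hlm.ne', Function.update_of_ne hlm.ne,
      Function.update_comm hlm.ne, ← add_smul, before_update_of_lt _ hlm,
      before_update_of_le _ hlm.le]
    convert zero_smul K _
    rw [show p + (before e m + (e l - 1 - e l)) = p + before e m - 1 by ring, ksign_sub_one]
    ring

theorem ksign_sum {ι : Type*} (s : Finset ι) (f : ι → ℤ) :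
    ksign K (∑ j ∈ s, f j) = ∏ j ∈ s, ksign K (f j) := by
  classical
  induction s using Finset.induction_on with
  | empty => simp
  | insert a s ha ih => rw [Finset.sum_insert ha, Finset.prod_insert ha, ksign_add, ih]

/-- The two ways to flatten three levels of blocks agree. -/
theorem finSigma_assoc {k : ℕ} {i : Fin k → ℕ} (m : (Σ j, Fin (i j)) → ℕ)
    (y : Fin (∑ j, ∑ l, m ⟨j, l⟩)) :
    (⟨finSigmaFinEquiv.symm (finSigmaFinEquiv.symm (finCongr (sum_sum_eq m) y)).1,
      (finSigmaFinEquiv.symm (finCongr (sum_sum_eq m) y)).2⟩ : Σ x, Fin (m x)) =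
    ⟨⟨(finSigmaFinEquiv.symm y).1, (finSigmaFinEquiv.symm (finSigmaFinEquiv.symm y).2).1⟩,
      (finSigmaFinEquiv.symm (finSigmaFinEquiv.symm y).2).2⟩ := by
  let f : Fin (∑ y : Fin (∑ j, i j), m (finSigmaFinEquiv.symm y)) ≃ Σ x, Fin (m x) :=
    finSigmaFinEquiv.symm.trans
      (Equiv.sigmaCongrLeft (β := fun x => Fin (m x)) finSigmaFinEquiv.symm)
  let G : (Σ x, Fin (m x)) ≃ Fin (∑ j, ∑ l, m ⟨j, l⟩) :=
    (Equiv.sigmaAssoc fun j l => Fin (m ⟨j, l⟩)).trans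
      ((Equiv.sigmaCongrRight fun j => finSigmaFinEquiv (n := fun l => m ⟨j, l⟩)).trans
        finSigmaFinEquiv)
  have hG : ∀ j l t, G ⟨⟨j, l⟩, t⟩ = finSigmaFinEquiv ⟨j, finSigmaFinEquiv ⟨l, t⟩⟩ :=
    fun j l t => rfl
  have h1 : ∀ x x' : (Σ j, Fin (i j)), finSigmaFinEquiv x < finSigmaFinEquiv x' →
      ∀ t t', G ⟨x, t⟩ < G ⟨x', t'⟩ := by
    rintro ⟨j, l⟩ ⟨j', l'⟩ h t t'
    rw [hG, hG]
    rcases lt_trichotomy j j' with hj | rfl | hj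
    · exact finSigma_lt_of_lt (i := fun j => ∑ l, m ⟨j, l⟩) hj _ _
    · rw [finSigma_lt_iff (i := fun j => ∑ l, m ⟨j, l⟩)]
      exact finSigma_lt_of_lt (i := fun l => m ⟨j, l⟩) ((finSigma_lt_iff _ _).1 h) _ _
    · exact absurd h (not_lt_of_gt (finSigma_lt_of_lt hj _ _))
  have h2 : ∀ x t t', t < t' → G ⟨x, t⟩ < G ⟨x, t'⟩ := by
    rintro ⟨j, l⟩ t t' h
    rw [hG, hG, finSigma_lt_iff (i := fun j => ∑ l, m ⟨j, l⟩),
      finSigma_lt_iff (i := fun l => m ⟨j, l⟩)]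
    exact h
  -- Both flattenings list triples in lexicographic order. A strictly increasing map between these
  -- finite ordinals is determined by its range, so the comparison is the cast.
  have h3 : StrictMono fun y => G (f y) := by
    intro y y' hy
    obtain ⟨⟨a, t⟩, rfl⟩ := finSigmaFinEquiv.surjective y
    obtain ⟨⟨a', t'⟩, rfl⟩ := finSigmaFinEquiv.surjective y'
    have hf : ∀ a t, f (finSigmaFinEquiv ⟨a, t⟩) = ⟨finSigmaFinEquiv.symm a, t⟩ := fun a t => by
      simp [f, Equiv.sigmaCongrLeft]
    simp only [hf]
    rcases lt_trichotomy a a' with h | rfl | h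
    · exact h1 _ _ (by simpa using h) _ _
    · exact h2 _ _ _ ((finSigma_lt_iff (i := fun y => m (finSigmaFinEquiv.symm y)) _ _).1 hy)
    · exact absurd hy (not_lt_of_gt
        (finSigma_lt_of_lt (i := fun y => m (finSigmaFinEquiv.symm y)) h _ _))
  have h4 : (fun y => G (f y)) = (finCongr (sum_sum_eq m)).symm := by
    refine (StrictMono.range_inj h3 (fun a b h => by simpa using h)).1 ?_
    rw [(finCongr (sum_sum_eq m)).symm.surjective.range_eq]
    exact (f.trans G).surjective.range_eq
  have h5 := congrFun h4 (finCongr (sum_sum_eq m) y)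
  rw [Equiv.symm_apply_apply, ← Equiv.eq_symm_apply] at h5
  exact h5

section FreeAlgebra

variable (P : Operad K) (V : DGModule K)

/-- The homogeneous components of `P(V)`. -/
def schurGr (g : ℤ) : Submodule K (Schur P V) :=
  Submodule.span K {x | ∃ (n : ℕ) (p : ℤ) (e : Fin n → ℤ) (μ : P.obj n) (v : Fin n → V),
    μ ∈ (P.obj n).gr p ∧ (∀ l, v l ∈ V.gr (e l)) ∧ p + ∑ l, e l = g ∧ x = word P V μ v}

variable {P V}

theorem word_mem {n : ℕ} {p : ℤ} {e : Fin n → ℤ} {μ : P.obj n} {v : Fin n → V}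
    (hμ : μ ∈ (P.obj n).gr p) (hv : ∀ l, v l ∈ V.gr (e l)) :
    word P V μ v ∈ schurGr P V (p + ∑ l, e l) :=
  Submodule.subset_span ⟨n, p, e, μ, v, hμ, hv, rfl, rfl⟩

theorem sum_comp_equiv {n : ℕ} (σ : Fin n ≃ Fin n) (e : Fin n → ℤ) :
    ∑ l, (e ∘ σ) l = ∑ l, e l := Equiv.sum_comp σ e

/-- The weight operator multiplies a word of degree g by 2^g. It is well defined on coinvariants
because a permutation of letters preserves the total degree. -/
theorem schur_isInternal [CharZero K] : DirectSum.IsInternal (schurGr P V) := by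
  obtain ⟨E, hE⟩ := exists_schur_lift (P := P) (V := V)
    (fun n p e => (2 : K) ^ (p + ∑ l, e l) • word P V) (by
      intro n σ p e μ v hμ hv
      simp only [LinearMap.smul_apply, _root_.smul_apply]
      rw [word_map σ μ hv, smul_comm, sum_comp_equiv])
  refine isInternal_of_weight _ E ?_ ?_
  · intro i x hx
    suffices h : schurGr P V i ≤ LinearMap.ker (E - (2 : K) ^ i • LinearMap.id) by
      have := h hx
      rw [LinearMap.mem_ker] at this
      simpa [sub_eq_zero] using this
    refine Submodule.span_le.2 ?_
    rintro _ ⟨n, p, e, μ, v, hμ, hv, rfl, rfl⟩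
    simp [hE p e μ v hμ hv]
  · rw [eq_top_iff, ← word_range_span, Submodule.span_le]
    rintro _ ⟨n, p, e, μ, v, hμ, hv, rfl⟩
    exact Submodule.mem_iSup_of_mem _ (word_mem hμ hv)

/-- Identities of multilinear maps on homogeneous elements of `P(V)` hold if they hold on words. -/
theorem schurGr_multilinear_eq {ι : Type*} [Fintype ι] [DecidableEq ι] {W : Type*}
    [AddCommGroup W] [Module K W] (f g : MultilinearMap K (fun _ : ι => Schur P V) W) {e : ι → ℤ}
    (h : ∀ (i : ι → ℕ) (q : ι → ℤ) (r : (Σ j, Fin (i j)) → ℤ) (ν : ∀ j, P.obj (i j))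
        (v : (Σ j, Fin (i j)) → V), (∀ j, ν j ∈ (P.obj (i j)).gr (q j)) →
        (∀ x, v x ∈ V.gr (r x)) → (∀ j, e j = q j + ∑ l, r ⟨j, l⟩) →
        f (fun j => word P V (ν j) fun l => v ⟨j, l⟩) =
          g (fun j => word P V (ν j) fun l => v ⟨j, l⟩))
    {b : ι → Schur P V} (hb : ∀ l, b l ∈ schurGr P V (e l)) : f b = g b := by
  refine multilinear_eq_on_span f g _ ?_ b hb
  intro x hx
  choose n p r μ v hμ hv he hx using hx
  obtain rfl : x = fun l => word P V (μ l) (v l) := funext hx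
  exact h n p (fun x => r x.1 x.2) μ (fun x => v x.1 x.2) hμ (fun x => hv _ _) fun j => (he j).symm

theorem schurOp_mem {k : ℕ} {p : ℤ} {e : Fin k → ℤ} {μ : P.obj k} {a : Fin k → Schur P V}
    (hμ : μ ∈ (P.obj k).gr p) (ha : ∀ l, a l ∈ schurGr P V (e l)) :
    schurOp P V μ a ∈ schurGr P V (p + ∑ l, e l) := by
  -- Membership is rewritten as vanishing in a quotient, which makes it an identity of multilinear
  -- maps that can be tested on words.
  rw [← Submodule.Quotient.mk_eq_zero, ← Submodule.mkQ_apply]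
  refine schurGr_multilinear_eq ((Submodule.mkQ _).compMultilinearMap (schurOp P V μ)) 0 ?_ ha
  intro i q r ν v hν hv he
  rw [LinearMap.compMultilinearMap_apply, schurOp_word μ hν hv, _root_.zero_apply,
    Submodule.mkQ_apply, Submodule.Quotient.mk_eq_zero]
  refine Submodule.smul_mem _ _ ?_
  have := word_mem (P.comp_mem i hμ hν) fun y : Fin (∑ j, i j) => hv (finSigmaFinEquiv.symm y)
  rw [sum_finSigma] at this
  simp only [Equiv.symm_apply_apply] at this
  rwa [add_assoc, ← Finset.sum_add_distrib, ← Finset.sum_congr rfl fun j _ => he j] at this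

/-- On words this is `comp_map_outer`. The total degree of an argument is that of its operation plus
that of its letters, so the sign of σ splits; the mixed terms are those of the two shuffles by
`beforeSum_add_invSum`. -/
theorem schurOp_map {k k' : ℕ} (σ : Fin k ≃ Fin k') (μ : P.obj k) {e : Fin k' → ℤ}
    {a : Fin k' → Schur P V} (ha : ∀ l, a l ∈ schurGr P V (e l)) :
    schurOp P V (P.map σ μ) a = ksign K (permExp σ e) • schurOp P V μ fun l => a (σ l) := by
  refine schurGr_multilinear_eq (schurOp P V (P.map σ μ))
    (ksign K (permExp σ e) • (schurOp P V μ).domDomCongr σ) ?_ ha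
  intro i q r ν v hν hv he
  rw [_root_.smul_apply, MultilinearMap.domDomCongr_apply, schurOp_word _ hν hv,
    P.comp_map_outer σ i μ hν, map_smul, _root_.smul_apply,
    word_map (blockOuter σ i) _ (e := fun y => r (finSigmaFinEquiv.symm y)) (fun y => hv _),
    permExp_blockOuter, schurOp_word (i := fun j => i (σ j)) (q := fun j => q (σ j))
      (r := fun x => r ⟨σ x.1, x.2⟩) (ν := fun j => ν (σ j)) (v := fun x => v ⟨σ x.1, x.2⟩) μ
      (fun j => hν _) (fun x => hv _)]
  rw [smul_smul, smul_smul, smul_smul, ← ksign_add, ← ksign_add, ← ksign_add]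
  congr 1
  · have he' : e = q + fun j => ∑ l, r ⟨j, l⟩ := funext he
    have := beforeSum_add_invSum σ q fun j => ∑ l, r ⟨j, l⟩
    rw [he', permExp_add, shuffleExp_eq, shuffleExp_eq]
    refine ksign_congr (-invSum σ (fun j => ∑ l, r ⟨j, l⟩) q) ?_
    simp only [Function.comp_def] at this
    linarith
  · congr 1
    funext y
    obtain ⟨⟨j, l⟩, rfl⟩ := finSigmaFinEquiv.surjective y
    rw [blockOuter_finSigma, Equiv.symm_apply_apply, Equiv.symm_apply_apply]

theorem schurOp_one (a : Schur P V) : schurOp P V P.one (fun _ => a) = a := by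
  let f : Schur P V →ₗ[K] Schur P V :=
    (MultilinearMap.ofSubsingleton K (Schur P V) (Schur P V) (0 : Fin 1)).symm (schurOp P V P.one)
  have hf : ∀ a, f a = schurOp P V P.one (fun _ => a) := fun a => by
    rw [MultilinearMap.ofSubsingleton_symm_apply_apply]
  suffices h : f = LinearMap.id by rw [← hf, h, LinearMap.id_apply]
  refine schur_ext fun {n} p e μ v hμ hv => ?_
  rw [hf, LinearMap.id_apply]
  have h := schurOp_word (P := P) (V := V) (i := fun _ : Fin 1 => n) (q := fun _ => p)
    (r := fun x => e x.2) (ν := fun _ => μ) (v := fun x => v x.2) P.one (fun _ => hμ) (fun _ => hv _)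
  have h0 : shuffleExp (i := fun _ : Fin 1 => n) (fun _ => p) (fun x => e x.2) = 0 := by
    simp [shuffleExp]
  rw [h, P.one_comp, h0, ksign_zero, one_smul, word_finCongr]
  congr 1
  funext l
  congr 1
  have : finCongr (by simp) l = finSigmaFinEquiv (n := fun _ : Fin 1 => n) ⟨0, l⟩ :=
    Fin.ext (by rw [finSigmaFinEquiv_apply]; simp)
  rw [this, Equiv.symm_apply_apply]

/-- On words this is associativity of the operad; the letters match because flattening three levels
is associative (`finSigma_assoc`). -/
theorem schurOp_comp {k : ℕ} (i : Fin k → ℕ) (μ : P.obj k) {q : Fin k → ℤ} {ν : ∀ j, P.obj (i j)}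
    {r : (Σ j, Fin (i j)) → ℤ} {a : (Σ j, Fin (i j)) → Schur P V}
    (hν : ∀ j, ν j ∈ (P.obj (i j)).gr (q j)) (ha : ∀ x, a x ∈ schurGr P V (r x)) :
    schurOp P V (P.comp i μ ν) (fun y => a (finSigmaFinEquiv.symm y)) =
      ksign K (shuffleExp q r) • schurOp P V μ fun j => schurOp P V (ν j) fun l => a ⟨j, l⟩ := by
  refine schurGr_multilinear_eq ((schurOp P V (P.comp i μ ν)).domDomCongr finSigmaFinEquiv.symm)
    (ksign K (shuffleExp q r) • (schurOp P V μ).compMultilinearMap fun j => schurOp P V (ν j)) ?_ ha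
  intro m s t ρ v hρ hv hr
  rw [MultilinearMap.domDomCongr_apply, _root_.smul_apply,
    MultilinearMap.compMultilinearMap_apply]
  -- the left hand side
  rw [schurOp_word (P.comp i μ ν) (i := fun y => m (finSigmaFinEquiv.symm y))
    (q := fun y => s (finSigmaFinEquiv.symm y))
    (r := fun z => t ⟨finSigmaFinEquiv.symm z.1, z.2⟩)
    (ν := fun y => ρ (finSigmaFinEquiv.symm y))
    (v := fun z => v ⟨finSigmaFinEquiv.symm z.1, z.2⟩) (fun y => hρ _) (fun z => hv _),
    P.assoc i m μ hν hρ, map_smul, _root_.smul_apply, word_finCongr]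
  -- the right hand side
  have h1 : ∀ j, schurOp P V (ν j) (Sigma.curry (γ := fun _ _ => Schur P V)
      (fun x => word P V (ρ x) fun l => v ⟨x, l⟩) j) =
      ksign K (shuffleExp (fun l => s ⟨j, l⟩) fun z : (Σ l, Fin (m ⟨j, l⟩)) => t ⟨⟨j, z.1⟩, z.2⟩) •
        word P V (P.comp (fun l => m ⟨j, l⟩) (ν j) fun l => ρ ⟨j, l⟩)
          fun y => v ⟨⟨j, (finSigmaFinEquiv.symm y).1⟩, (finSigmaFinEquiv.symm y).2⟩ := fun j =>
    schurOp_word (ν j) (i := fun l => m ⟨j, l⟩) (q := fun l => s ⟨j, l⟩)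
      (r := fun z => t ⟨⟨j, z.1⟩, z.2⟩) (ν := fun l => ρ ⟨j, l⟩)
      (v := fun z => v ⟨⟨j, z.1⟩, z.2⟩) (fun l => hρ _) (fun z => hv _)
  rw [show (fun j => schurOp P V (ν j) (Sigma.curry (γ := fun _ _ => Schur P V)
    (fun x => word P V (ρ x) fun l => v ⟨x, l⟩) j))
    = _ from funext h1, MultilinearMap.map_smul_univ]
  rw [schurOp_word μ (i := fun j => ∑ l, m ⟨j, l⟩) (q := fun j => q j + ∑ l, s ⟨j, l⟩)
    (r := fun z => t ⟨⟨z.1, (finSigmaFinEquiv.symm z.2).1⟩, (finSigmaFinEquiv.symm z.2).2⟩)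
    (ν := fun j => P.comp (fun l => m ⟨j, l⟩) (ν j) fun l => ρ ⟨j, l⟩)
    (v := fun z => v ⟨⟨z.1, (finSigmaFinEquiv.symm z.2).1⟩, (finSigmaFinEquiv.symm z.2).2⟩)
    (fun j => P.comp_mem _ (hν j) fun l => hρ _) (fun z => hv _)]
  rw [← ksign_sum, smul_smul, smul_smul, smul_smul, ← ksign_add, ← ksign_add, ← ksign_add]
  congr 1
  · have hr' : r = fun x => s x + ∑ l, t ⟨x, l⟩ := funext hr
    have h2 : ∀ j, ∑ y : Fin (∑ l, m ⟨j, l⟩), t ⟨⟨j, (finSigmaFinEquiv.symm y).1⟩,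
        (finSigmaFinEquiv.symm y).2⟩ = ∑ l, ∑ a, t ⟨⟨j, l⟩, a⟩ := fun j => by
      rw [Equiv.sum_comp finSigmaFinEquiv.symm
        (fun w : (Σ l, Fin (m ⟨j, l⟩)) => t ⟨⟨j, w.1⟩, w.2⟩), Fintype.sum_sigma]
    simp only [shuffleExp_eq, hr', h2]
    rw [sum_before_finSigma s fun x => ∑ l, t ⟨x, l⟩]
    have h3 := beforeSum_add_right q (fun j => ∑ l, s ⟨j, l⟩) fun j => ∑ l, ∑ a, t ⟨⟨j, l⟩, a⟩
    have h4 := beforeSum_add_left q (fun j => ∑ l, s ⟨j, l⟩) fun j => ∑ l, ∑ a, t ⟨⟨j, l⟩, a⟩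
    simp only [Pi.add_def] at h3 h4
    simp only [Finset.sum_add_distrib]
    rw [h3, h4]
    -- The operations ν pass the letters twice on the right: as part of the arguments of the
    -- composite, and again in the final shuffle.
    refine ksign_congr (-beforeSum q fun j => ∑ l, ∑ a, t ⟨⟨j, l⟩, a⟩) ?_
    ring
  · congr 1
    funext y
    exact congrArg v (finSigma_assoc m y)

end FreeAlgebra

section FreeDGAlgebra

variable (P : Operad K) (V : DGModule K)

/-- The inclusion of the generators `V → P(V)`. -/
def schurIncl : V →ₗ[K] Schur P V :=
  (MultilinearMap.ofSubsingleton K V (Schur P V) (0 : Fin 1)).symm (word P V P.one)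

variable {P V}

theorem schurIncl_apply (x : V) : schurIncl P V x = word P V P.one fun _ => x := by
  rw [schurIncl, MultilinearMap.ofSubsingleton_symm_apply_apply]

theorem schurIncl_mem {i : ℤ} {x : V} (hx : x ∈ V.gr i) : schurIncl P V x ∈ schurGr P V i := by
  rw [schurIncl_apply]
  simpa using word_mem P.one_mem fun _ : Fin 1 => hx

theorem schurOp_incl {n : ℕ} (μ : P.obj n) (v : Fin n → V) :
    schurOp P V μ (fun l => schurIncl P V (v l)) = word P V μ v := by
  suffices h : (schurOp P V μ).compLinearMap (fun _ => schurIncl P V) = word P V μ from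
    congrArg (fun f => f v) h
  refine multilinear_ext_homogeneous fun e y hy => ?_
  rw [MultilinearMap.compLinearMap_apply]
  simp only [schurIncl_apply]
  have h := schurOp_word (P := P) (V := V) μ (i := fun _ => 1) (q := fun _ => 0)
    (r := fun x => e x.1) (ν := fun _ => P.one) (v := fun x => y x.1) (fun _ => P.one_mem)
    (fun x => hy _)
  have h0 : shuffleExp (i := fun _ : Fin n => 1) (fun _ => 0) (fun x => e x.1) = 0 := by
    simp [shuffleExp]
  rw [h, P.comp_one, h0, ksign_zero, one_smul, word_finCongr]
  congr 1
  funext l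
  have : finCongr (by simp) l = finSigmaFinEquiv (n := fun _ : Fin n => 1) ⟨l, 0⟩ :=
    Fin.ext (by rw [finSigmaFinEquiv_apply]; simp)
  rw [this, Equiv.symm_apply_apply]

theorem beforeSum_single_right {n : ℕ} (j : Fin n) (s : ℤ) (q : Fin n → ℤ) :
    beforeSum q (Pi.single j s) = (∑ x ∈ Finset.Ioi j, q x) * s := by
  rw [beforeSum, Finset.sum_comm, Finset.sum_eq_single j, Finset.sum_mul, ← Finset.sum_filter]
  · refine Finset.sum_congr (by ext; simp) fun x _ => by simp
  · intro y _ hy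
    simp [hy]
  · simp

theorem before_add_after {n : ℕ} (j : Fin n) (q : Fin n → ℤ) :
    ∑ x, q x = before q j + q j + ∑ x ∈ Finset.Ioi j, q x := by
  have h : ∀ x, q x = (if x < j then q x else 0) + (if x = j then q x else 0) +
      if j < x then q x else 0 := by
    intro x
    rcases lt_trichotomy x j with h | rfl | h
    · simp [h, h.ne, not_lt_of_gt h]
    · simp
    · simp [h, h.ne', not_lt_of_gt h]
  rw [Finset.sum_congr rfl fun x _ => h x, Finset.sum_add_distrib, Finset.sum_add_distrib,
    before_eq]
  congr 1
  · simp
  · rw [← Finset.sum_filter]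
    exact Finset.sum_congr (by ext; simp) fun _ _ => rfl

theorem update_eq_add_single {ι : Type*} [DecidableEq ι] (e : ι → ℤ) (j : ι) (x : ℤ) :
    Function.update e j (e j + x) = e + Pi.single j x := by
  funext t
  by_cases ht : t = j
  · subst ht; simp
  · simp [ht]

variable (P V) in
theorem exists_schurD : ∃ D : Schur P V →ₗ[K] Schur P V,
    ∀ {n : ℕ} (p : ℤ) (e : Fin n → ℤ) (μ : P.obj n) (v : Fin n → V), μ ∈ (P.obj n).gr p →
      (∀ l, v l ∈ V.gr (e l)) → D (word P V μ v) = word P V ((P.obj n).d μ) v +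
        ∑ j, ksign K (p + before e j) • word P V μ (Function.update v j (V.d (v j))) := by
  obtain ⟨D, hD⟩ := exists_schur_lift (P := P) (V := V)
    (fun n p e => word P V ∘ₗ (P.obj n).d + ∑ j, ksign K (p + before e j) •
      (MultilinearMap.compLinearMapₗ (Function.update (fun _ => LinearMap.id) j V.d)) ∘ₗ
        word P V) (by
    intro n σ p e μ v hμ hv
    simp only [LinearMap.add_apply, LinearMap.comp_apply, LinearMap.sum_apply,
      LinearMap.smul_apply, _root_.add_apply, _root_.sum_apply,
      _root_.smul_apply, MultilinearMap.compLinearMapₗ_apply,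
      MultilinearMap.compLinearMap_apply, update_id_apply]
    rw [← P.map_d, word_map σ _ hv, smul_add]
    congr 1
    rw [← Equiv.sum_comp σ, Finset.smul_sum]
    refine Finset.sum_congr rfl fun j _ => ?_
    rw [word_map σ _ (mem_update hv (V.d_mem (hv (σ j)))), smul_smul, smul_smul]
    have h2 : (fun l => Function.update v (σ j) (V.d (v (σ j))) (σ l)) =
        Function.update (fun l => v (σ l)) j (V.d (v (σ j))) := by
      funext l
      by_cases h : l = j
      · subst h; simp
      · simp [h]
    rw [h2]
    congr 1
    -- The differential is an operator of degree -1 moved to one letter: replacing v_j by d v_j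
    -- changes its degree by -1.
    have h3 := ksign_permExp_add_single (K := K) σ j (-1) e
    rw [← update_eq_add_single] at h3
    simp only [neg_mul, one_mul, ksign_neg, ← sub_eq_add_neg] at h3
    rw [ksign_add, ksign_add, mul_assoc, mul_comm (ksign K (before e (σ j))), h3]
    ring)
  refine ⟨D, fun p e μ v hμ hv => ?_⟩
  rw [hD p e μ v hμ hv]
  simp only [LinearMap.add_apply, LinearMap.comp_apply, LinearMap.sum_apply,
      LinearMap.smul_apply, _root_.add_apply, _root_.sum_apply,
      _root_.smul_apply, MultilinearMap.compLinearMapₗ_apply,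
      MultilinearMap.compLinearMap_apply, update_id_apply]

variable (P V) in
/-- The differential of `P(V)`. -/
def schurD : Schur P V →ₗ[K] Schur P V := (exists_schurD P V).choose

theorem schurD_word {n : ℕ} {p : ℤ} {e : Fin n → ℤ} {μ : P.obj n} {v : Fin n → V}
    (hμ : μ ∈ (P.obj n).gr p) (hv : ∀ l, v l ∈ V.gr (e l)) :
    schurD P V (word P V μ v) = word P V ((P.obj n).d μ) v +
        ∑ j, ksign K (p + before e j) • word P V μ (Function.update v j (V.d (v j))) :=
  (exists_schurD P V).choose_spec p e μ v hμ hv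

theorem schurD_mem {i : ℤ} {x : Schur P V} (hx : x ∈ schurGr P V i) :
    schurD P V x ∈ schurGr P V (i - 1) := by
  suffices h : schurGr P V i ≤ (schurGr P V (i - 1)).comap (schurD P V) from h hx
  refine Submodule.span_le.2 ?_
  rintro _ ⟨n, p, e, μ, v, hμ, hv, rfl, rfl⟩
  rw [SetLike.mem_coe, Submodule.mem_comap, schurD_word hμ hv]
  refine Submodule.add_mem _ ?_ (Submodule.sum_mem _ fun j _ => Submodule.smul_mem _ _ ?_)
  · have := word_mem ((P.obj n).d_mem hμ) hv
    rwa [sub_add_eq_add_sub] at this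
  · have := word_mem hμ (mem_update (j := j) hv (V.d_mem (hv j)))
    rw [sub_eq_add_neg (e j), update_eq_add_single] at this
    simpa [Finset.sum_add_distrib, ← sub_eq_add_neg, add_sub_assoc] using this

theorem schurD_incl (x : V) : schurD P V (schurIncl P V x) = schurIncl P V (V.d x) := by
  suffices h : schurD P V ∘ₗ schurIncl P V = schurIncl P V ∘ₗ V.d from LinearMap.congr_fun h x
  refine DGModule.linearMap_ext fun i x hx => ?_
  rw [LinearMap.comp_apply, LinearMap.comp_apply, schurIncl_apply, schurIncl_apply,
    schurD_word (e := fun _ => i) P.one_mem (fun _ => hx), P.d_one, map_zero,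
    _root_.zero_apply, zero_add, Fin.sum_univ_one]
  have : before (fun _ : Fin 1 => i) 0 = 0 := by
    rw [before]; exact Finset.sum_eq_zero fun l hl => absurd (Finset.mem_Iio.1 hl) (by simp)
  rw [this, add_zero, ksign_zero, one_smul]
  congr 1
  funext l
  rw [Subsingleton.elim l 0, Function.update_self]

/-- On words, `comp_d` of the operad distributes the differential over the root operation and the
operations ν_j; the remaining terms differentiate single letters. These match, block by block, the
two kinds of terms in the differential of the j-th argument. -/
theorem schurD_leibniz : IsLeibniz P (schurGr P V) (schurOp P V) (schurD P V) := by
  intro k p e μ b hμ hb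
  have key := schurGr_multilinear_eq ((schurD P V).compMultilinearMap (schurOp P V μ))
    (schurOp P V ((P.obj k).d μ) + ∑ l, ksign K (p + before e l) • (schurOp P V μ).compLinearMap
      (Function.update (fun _ => LinearMap.id) l (schurD P V))) ?_ hb
  · simpa only [LinearMap.compMultilinearMap_apply, _root_.add_apply,
      _root_.sum_apply, _root_.smul_apply, MultilinearMap.compLinearMap_apply,
      update_id_apply] using key
  intro i q r ν v hν hv he
  simp only [LinearMap.compMultilinearMap_apply, _root_.add_apply,
      _root_.sum_apply, _root_.smul_apply, MultilinearMap.compLinearMap_apply,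
      update_id_apply]
  -- Lowering the degree of ν_j changes the shuffle exponent by the letters in the blocks before j.
  have hA : ∀ j, schurOp P V μ (Function.update (fun j => word P V (ν j) fun l => v ⟨j, l⟩) j
      (word P V ((P.obj (i j)).d (ν j)) fun l => v ⟨j, l⟩)) =
      ksign K (shuffleExp q r - before (fun j => ∑ l, r ⟨j, l⟩) j) •
        word P V (P.comp i μ (Function.update ν j ((P.obj (i j)).d (ν j))))
          fun y => v (finSigmaFinEquiv.symm y) := by
    intro j
    have h1 : Function.update (fun j => word P V (ν j) fun l => v ⟨j, l⟩) j
        (word P V ((P.obj (i j)).d (ν j)) fun l => v ⟨j, l⟩) = fun j' => word P V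
          (Function.update ν j ((P.obj (i j)).d (ν j)) j') fun l => v ⟨j', l⟩ := by
      funext j'
      by_cases h : j' = j
      · subst h; simp
      · simp [h]
    have h2 : ∀ j', Function.update ν j ((P.obj (i j)).d (ν j)) j' ∈
        (P.obj (i j')).gr (Function.update q j (q j + -1) j') := by
      intro j'
      by_cases h : j' = j
      · subst h; simpa [← sub_eq_add_neg] using (P.obj _).d_mem (hν j')
      · simpa [h] using hν j'
    rw [h1, schurOp_word μ h2 hv]
    congr 2
    rw [shuffleExp_eq, update_eq_add_single, beforeSum_add_left, beforeSum_single, shuffleExp_eq]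
    ring
  -- Lowering the degree of a letter of block j changes the shuffle exponent by the operations after
  -- ν_j.
  have hB : ∀ j l, schurOp P V μ (Function.update (fun j => word P V (ν j) fun l => v ⟨j, l⟩) j
      (word P V (ν j) (Function.update (fun l => v ⟨j, l⟩) l (V.d (v ⟨j, l⟩))))) =
      ksign K (shuffleExp q r - ∑ x ∈ Finset.Ioi j, q x) • word P V (P.comp i μ ν)
        (Function.update (fun y => v (finSigmaFinEquiv.symm y)) (finSigmaFinEquiv ⟨j, l⟩)
          (V.d (v ⟨j, l⟩))) := by
    intro j l
    have h1 : Function.update (fun j => word P V (ν j) fun l => v ⟨j, l⟩) j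
        (word P V (ν j) (Function.update (fun l => v ⟨j, l⟩) l (V.d (v ⟨j, l⟩)))) =
        fun j' => word P V (ν j') fun l' => Function.update v ⟨j, l⟩ (V.d (v ⟨j, l⟩)) ⟨j', l'⟩ := by
      funext j'
      by_cases h : j' = j
      · subst h
        rw [Function.update_self]
        congr 1
        funext l'
        by_cases h : l' = l
        · subst h; simp
        · simp [h]
      · simp [h]
    have h2 : ∀ x, Function.update v ⟨j, l⟩ (V.d (v ⟨j, l⟩)) x ∈
        V.gr (Function.update r ⟨j, l⟩ (r ⟨j, l⟩ + -1) x) := by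
      intro x
      by_cases h : x = ⟨j, l⟩
      · subst h; simpa [← sub_eq_add_neg] using V.d_mem (hv ⟨j, l⟩)
      · simpa [h] using hv x
    rw [h1, schurOp_word μ hν h2]
    congr 2
    · have h3 : (fun j' => ∑ l', Function.update r ⟨j, l⟩ (r ⟨j, l⟩ + -1) ⟨j', l'⟩) =
          (fun j' => ∑ l', r ⟨j', l'⟩) + Pi.single j (-1) := by
        funext j'
        rw [update_eq_add_single]
        by_cases h : j' = j
        · subst h
          have h4 : ∀ l', (Pi.single (⟨j', l⟩ : Σ j, Fin (i j)) (-1) : _ → ℤ) ⟨j', l'⟩ =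
              if l' = l then -1 else 0 := fun l' => by
            by_cases h : l' = l
            · subst h; simp
            · simp [h]
          simp [Finset.sum_add_distrib, h4]
        · simp [h]
      rw [shuffleExp_eq, shuffleExp_eq, h3, beforeSum_add_right, beforeSum_single_right]
      ring
    · funext y
      by_cases h : y = finSigmaFinEquiv ⟨j, l⟩
      · subst h; simp
      · have : finSigmaFinEquiv.symm y ≠ ⟨j, l⟩ := fun h2 => h (by rw [← h2, Equiv.apply_symm_apply])
        simp [h, this]
  rw [schurOp_word μ hν hv, schurOp_word _ hν hv, map_smul,
    schurD_word (P.comp_mem i hμ hν) fun y => hv _, P.comp_d i hμ hν, sum_finSigma]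
  simp only [map_add, map_sum, map_smul, _root_.add_apply, _root_.sum_apply,
    _root_.smul_apply, smul_add, Finset.smul_sum, add_assoc]
  congr 1
  rw [← Finset.sum_add_distrib]
  refine Finset.sum_congr rfl fun j _ => ?_
  rw [schurD_word (hν j) fun l => hv ⟨j, l⟩, MultilinearMap.map_update_add,
    MultilinearMap.map_update_sum, hA, smul_add, Finset.smul_sum]
  have he' : e = q + fun j => ∑ l, r ⟨j, l⟩ := funext he
  congr 1
  · rw [smul_smul, smul_smul, ← ksign_add, ← ksign_add, he', before_add]
    congr 2
    ring
  · refine Finset.sum_congr rfl fun l _ => ?_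
    rw [MultilinearMap.map_update_smul, hB, Equiv.symm_apply_apply, before_finSigma, smul_smul,
      smul_smul, smul_smul, ← ksign_add, ← ksign_add, ← ksign_add, he', before_add]
    congr 1
    refine ksign_congr (∑ x ∈ Finset.Ioi j, q x) ?_
    rw [before_add_after j q]
    ring

theorem schurD_schurD (x : Schur P V) : schurD P V (schurD P V x) = 0 := by
  suffices h : schurD P V ∘ₗ schurD P V = 0 from LinearMap.congr_fun h x
  refine schur_ext fun p e μ v hμ hv => ?_
  rw [LinearMap.comp_apply, ← schurOp_incl,
    schurD_leibniz.sq schurD_mem hμ fun l => schurIncl_mem (hv l), LinearMap.zero_apply]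
  refine Finset.sum_eq_zero fun l _ => ?_
  rw [schurD_incl, schurD_incl, V.d_d, map_zero]
  exact MultilinearMap.map_update_zero _ _ _

variable (P V)

/-- The free dg algebra on `V`. -/
def freeAlg [CharZero K] : PAlgebra P where
  carrier := Schur P V
  gr := schurGr P V
  isInternal := schur_isInternal
  d := schurD P V
  d_mem := schurD_mem
  d_d := schurD_schurD
  op := schurOp P V
  op_mem := schurOp_mem
  op_d := schurD_leibniz
  op_one := schurOp_one
  op_map := schurOp_map
  op_comp := schurOp_comp

end FreeDGAlgebra

/-! ## An algebra as a module over itself -/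

section SelfModule

variable {P : Operad K} (R : PAlgebra P)

/-- `γ(μ; a_1, …, m, …, a_k)` with `m` at position `j`. -/
def PAlgebra.selfAct {k : ℕ} (j : Fin k) : P.obj k →ₗ[K] R.carrier →ₗ[K]
    MultilinearMap K (fun _ : {l : Fin k // l ≠ j} => (R : Type u)) R.carrier :=
  LinearMap.mk₂ K (fun μ m => (R.op μ).domDomRestrict (fun l => l ≠ j) fun _ => m)
    (fun μ μ' m => by ext a; simp)
    (fun c μ m => by ext a; simp)
    (fun μ m m' => by
      ext a
      have h : ∀ z, (fun l => if h : l ≠ j then a ⟨l, h⟩ else z) =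
          Function.update (fun l => if h : l ≠ j then a ⟨l, h⟩ else 0) j z := fun z => by
        funext l
        by_cases h : l = j
        · subst h; simp
        · simp [h]
      simp only [_root_.add_apply, MultilinearMap.domDomRestrict_apply]
      rw [h, h m, h m', MultilinearMap.map_update_add])
    (fun c μ m => by
      ext a
      have h : ∀ z, (fun l => if h : l ≠ j then a ⟨l, h⟩ else z) =
          Function.update (fun l => if h : l ≠ j then a ⟨l, h⟩ else 0) j z := fun z => by
        funext l
        by_cases h : l = j
        · subst h; simp
        · simp [h]
      simp only [_root_.smul_apply, MultilinearMap.domDomRestrict_apply]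
      rw [h, h m, MultilinearMap.map_update_smul])

theorem PAlgebra.selfAct_apply {k : ℕ} (j : Fin k) (μ : P.obj k) (m : R) (a : Fin k → R) :
    R.selfAct j μ m (fun l => a l) = R.op μ (Function.update a j m) := by
  simp only [selfAct, LinearMap.mk₂_apply, MultilinearMap.domDomRestrict_apply]
  congr 1
  funext l
  by_cases h : l = j
  · subst h; simp
  · simp [h]

theorem mem_update' {ι X : Type*} [DecidableEq ι] [AddCommGroup X] [Module K X]
    {gr : ℤ → Submodule K X} {e : ι → ℤ} {b : ι → X} {j : ι} (hb : ∀ l, l ≠ j → b l ∈ gr (e l))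
    {x : X} (hx : x ∈ gr (e j)) (l : ι) : Function.update b j x l ∈ gr (e l) := by
  by_cases h : l = j
  · subst h; simpa using hx
  · simpa [h] using hb l h

/-- A `P`-algebra as a module over itself. -/
abbrev PAlgebra.selfModule : AModule R where
  toDGModule := R.toDGModule
  act j := R.selfAct j
  act_mem j p e μ m a hμ hm ha := by
    rw [selfAct_apply]
    exact R.op_mem hμ (mem_update' ha hm)
  act_d j p e μ m a hμ hm ha := by
    rw [selfAct_apply, R.op_d hμ (mem_update' ha hm), selfAct_apply]
    congr 1
    refine Finset.sum_congr rfl fun l _ => ?_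
    congr 1
    split_ifs with h
    · subst h
      rw [selfAct_apply, Function.update_self, Function.update_idem]
    · rw [selfAct_apply, Function.update_of_ne h, Function.update_comm h]
  act_one m := by
    have h := R.selfAct_apply (0 : Fin 1) P.one m fun _ => 0
    rw [h, show Function.update (fun _ : Fin 1 => (0 : R)) 0 m = fun _ => m from ?_, R.op_one]
    funext l
    rw [Subsingleton.elim l 0, Function.update_self]
  act_map σ j μ e m a hm ha := by
    rw [selfAct_apply, R.op_map σ μ (mem_update' ha hm), selfAct_apply (a := fun l => a (σ l))]
    congr 2
    funext l
    by_cases h : l = j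
    · subst h; simp
    · simp [h]
  act_comp i j l₀ μ q ν r m a hν hm ha := by
    rw [selfAct_apply _ _ _ _ fun y => a (finSigmaFinEquiv.symm y)]
    have h1 : Function.update (fun y => a (finSigmaFinEquiv.symm y)) (finSigmaFinEquiv ⟨j, l₀⟩) m =
        fun y => Function.update a ⟨j, l₀⟩ m (finSigmaFinEquiv.symm y) := by
      funext y
      by_cases h : y = finSigmaFinEquiv ⟨j, l₀⟩
      · subst h; simp
      · have : finSigmaFinEquiv.symm y ≠ ⟨j, l₀⟩ := fun h2 => h (by rw [← h2, Equiv.apply_symm_apply])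
        simp [h, this]
    rw [h1, R.op_comp i μ hν (mem_update' ha hm), selfAct_apply _ _ _ _ fun l => a ⟨j, l⟩,
      selfAct_apply _ _ _ _ fun j' => R.op (ν j') fun l => a ⟨j', l⟩]
    congr 2
    funext j'
    by_cases h : j' = j
    · subst h
      rw [Function.update_self]
      congr 1
      funext l
      by_cases h : l = l₀
      · subst h; simp
      · simp [h]
    · rw [Function.update_of_ne h]
      congr 1
      funext l
      rw [Function.update_of_ne]
      intro h2
      exact h (congrArg Sigma.fst h2)

theorem PAlgebra.selfModule_act {k : ℕ} (j : Fin k) (μ : P.obj k) (m : R) (a : Fin k → R) :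
    R.selfModule.act j μ m (fun l => a l) = R.op μ (Function.update a j m) :=
  R.selfAct_apply j μ m a

end SelfModule

/-! ## Derivations -/

theorem homD_mem {X Y : DGModule K} {n : ℤ} {f : X →ₗ[K] Y} (hf : f ∈ homGr X Y (n + 1)) (m : ℤ) :
    homD X Y m f ∈ homGr X Y n := by
  intro i x hx
  rw [homD_apply]
  refine Submodule.sub_mem _ ?_ (Submodule.smul_mem _ _ ?_)
  · have := Y.d_mem (hf i x hx)
    rwa [show i + (n + 1) - 1 = i + n by ring] at this
  · have := hf _ _ (X.d_mem hx)
    rwa [show i - 1 + (n + 1) = i + n by ring] at this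

theorem homD_homD {X Y : DGModule K} (n : ℤ) (f : X →ₗ[K] Y) :
    homD X Y (n + 1) (homD X Y (n + 1 + 1) f) = 0 := by
  ext x
  simp only [homD_apply, map_sub, map_smul, Y.d_d, X.d_d, map_zero, LinearMap.zero_apply]
  rw [ksign_add_one (n + 1)]
  simp

/-- A bijection of degree `0` reflects degrees. -/
theorem DGModule.mem_of_bijective {X Y : DGModule K} {f : X →ₗ[K] Y} (hf : f ∈ homGr X Y 0)
    (hb : Function.Injective f) {i : ℤ} {x : X} (hx : f x ∈ Y.gr i) : x ∈ X.gr i := by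
  -- π and ρ are the projections to degree i. They are intertwined by f, so f (π x) = f x, and
  -- injectivity gives x = π x.
  obtain ⟨π, hπ⟩ := X.exists_linearMap fun k => if k = i then LinearMap.id else 0
  obtain ⟨ρ, hρ⟩ := Y.exists_linearMap fun k => if k = i then LinearMap.id else 0
  have h1 : f ∘ₗ π = ρ ∘ₗ f := DGModule.linearMap_ext fun k x hx => by
    rw [LinearMap.comp_apply, LinearMap.comp_apply, hπ k x hx,
      hρ k _ (mem_of_mem_homGr_zero hf hx)]
    split_ifs <;> simp
  have h2 : ∀ x, π x ∈ X.gr i := by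
    intro x
    suffices h : (X.gr i).mkQ ∘ₗ π = 0 by
      have := LinearMap.congr_fun h x
      simpa using this
    refine DGModule.linearMap_ext fun k x hk => ?_
    rw [LinearMap.comp_apply, hπ k x hk]
    split_ifs with h
    · subst h; simpa using hk
    · simp
  have h3 := LinearMap.congr_fun h1 x
  rw [LinearMap.comp_apply, LinearMap.comp_apply, hρ i _ hx, if_pos rfl, LinearMap.id_apply] at h3
  rw [← hb h3]
  exact h2 x

theorem sum_add_single {k : ℕ} {i : Fin k → ℕ} (r : (Σ j, Fin (i j)) → ℤ) (j : Fin k)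
    (l : Fin (i j)) (s : ℤ) :
    (fun j' => ∑ l', (r + Pi.single ⟨j, l⟩ s : (Σ j, Fin (i j)) → ℤ) ⟨j', l'⟩) =
      (fun j' => ∑ l', r ⟨j', l'⟩) + Pi.single j s := by
  funext j'
  by_cases h : j' = j
  · subst h
    have h4 : ∀ l', (Pi.single (⟨j', l⟩ : Σ j, Fin (i j)) s : _ → ℤ) ⟨j', l'⟩ =
        if l' = l then s else 0 := fun l' => by
      by_cases h : l' = l
      · subst h; simp
      · simp [h]
    simp [Finset.sum_add_distrib, h4]
  · simp [h]

section Free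

variable {P : Operad K} {V : DGModule K} {R : PAlgebra P} {ι : V →ₗ[K] R.toDGModule}
  {hι : ι ∈ homGr V R.toDGModule 0}

theorem PAlgebra.eval_word (R : PAlgebra P) (ι : V →ₗ[K] R.toDGModule)
    (hι : ι ∈ homGr V R.toDGModule 0) {n : ℕ} (μ : P.obj n) (v : Fin n → V) :
    R.eval ι hι (word P V μ v) = R.op μ fun l => ι (v l) := by
  rw [← mkQ_schurWord, Submodule.mkQ_apply, PAlgebra.eval, Submodule.liftQ_apply,
    PAlgebra.evalRaw_word]

theorem PAlgebra.eval_mem (R : PAlgebra P) (ι : V →ₗ[K] R.toDGModule)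
    (hι : ι ∈ homGr V R.toDGModule 0) {i : ℤ} {x : Schur P V} (hx : x ∈ schurGr P V i) :
    R.eval ι hι x ∈ R.gr i := by
  suffices h : schurGr P V i ≤ (R.gr i).comap (R.eval ι hι) from h hx
  refine Submodule.span_le.2 ?_
  rintro _ ⟨n, p, e, μ, v, hμ, hv, rfl, rfl⟩
  rw [SetLike.mem_coe, Submodule.mem_comap, R.eval_word]
  exact R.op_mem hμ fun l => mem_of_mem_homGr_zero hι (hv l)

variable [CharZero K] (hb : Function.Bijective (R.eval ι hι))

include hb

theorem exists_word_of_mem {i : ℤ} {x : R} (hx : x ∈ R.gr i) :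
    ∃ y ∈ schurGr P V i, R.eval ι hι y = x := by
  obtain ⟨y, rfl⟩ := hb.2 x
  refine ⟨y, ?_, rfl⟩
  exact DGModule.mem_of_bijective (X := (freeAlg P V).toDGModule) (Y := R.toDGModule)
    (f := R.eval ι hι) (fun i x hx => by rw [add_zero]; exact R.eval_mem ι hι hx) hb.1 hx

omit [CharZero K] in
theorem free_ext {W : Type*} [AddCommGroup W] [Module K W] {f g : R.carrier →ₗ[K] W}
    (h : ∀ {n : ℕ} (p : ℤ) (e : Fin n → ℤ) (μ : P.obj n) (v : Fin n → V), μ ∈ (P.obj n).gr p →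
      (∀ l, v l ∈ V.gr (e l)) → f (R.op μ fun l => ι (v l)) = g (R.op μ fun l => ι (v l))) :
    f = g := by
  have h1 : f ∘ₗ R.eval ι hι = g ∘ₗ R.eval ι hι := schur_ext fun p e μ v hμ hv => by
    rw [LinearMap.comp_apply, LinearMap.comp_apply, R.eval_word, h p e μ v hμ hv]
  ext x
  obtain ⟨y, rfl⟩ := hb.2 x
  exact LinearMap.congr_fun h1 y

/-- Identities of multilinear maps on homogeneous elements of a free algebra hold if they hold on
words. -/
theorem free_multilinear_eq {κ : Type*} [Fintype κ] [DecidableEq κ] {W : Type*}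
    [AddCommGroup W] [Module K W] (f g : MultilinearMap K (fun _ : κ => R.carrier) W) {e : κ → ℤ}
    (h : ∀ (i : κ → ℕ) (q : κ → ℤ) (r : (Σ j, Fin (i j)) → ℤ) (ν : ∀ j, P.obj (i j))
        (v : (Σ j, Fin (i j)) → V), (∀ j, ν j ∈ (P.obj (i j)).gr (q j)) →
        (∀ x, v x ∈ V.gr (r x)) → (∀ j, e j = q j + ∑ l, r ⟨j, l⟩) →
        f (fun j => R.op (ν j) fun l => ι (v ⟨j, l⟩)) =
          g (fun j => R.op (ν j) fun l => ι (v ⟨j, l⟩)))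
    {b : κ → R} (hb' : ∀ l, b l ∈ R.gr (e l)) : f b = g b := by
  choose y hy hyb using fun l => exists_word_of_mem hb (hb' l)
  obtain rfl : b = fun l => R.eval ι hι (y l) := funext fun l => (hyb l).symm
  refine schurGr_multilinear_eq (f.compLinearMap fun _ => R.eval ι hι)
    (g.compLinearMap fun _ => R.eval ι hι) ?_ hy
  intro i q r ν v hν hv he
  simp only [MultilinearMap.compLinearMap_apply, R.eval_word]
  exact h i q r ν v hν hv he

/-- The universal property of the free algebra, for graded algebras. -/
theorem exists_free_lift (A : PAlgebra P) (ψ : V →ₗ[K] A.toDGModule)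
    (hψ : ψ ∈ homGr V A.toDGModule 0) :
    ∃ f : R.toDGModule →ₗ[K] A.toDGModule, f ∈ homGr R.toDGModule A.toDGModule 0 ∧
      (∀ {k : ℕ} (μ : P.obj k) (b : Fin k → R), f (R.op μ b) = A.op μ fun l => f (b l)) ∧
      ∀ x, f (ι x) = ψ x := by
  let E := LinearEquiv.ofBijective (R.eval ι hι) hb
  let f : R.toDGModule →ₗ[K] A.toDGModule := A.eval ψ hψ ∘ₗ E.symm.toLinearMap
  have hf : ∀ y, f (R.eval ι hι y) = A.eval ψ hψ y := fun y => by
    have : E.symm (R.eval ι hι y) = y := E.symm_apply_apply y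
    simp only [f, LinearMap.comp_apply, LinearEquiv.coe_coe, this]
  have hf' : ∀ {n : ℕ} (μ : P.obj n) (v : Fin n → V), f (R.op μ fun l => ι (v l)) =
      A.op μ fun l => ψ (v l) := fun μ v => by
    rw [← R.eval_word ι hι, hf, A.eval_word]
  have hop : ∀ {k : ℕ} (μ : P.obj k) {e : Fin k → ℤ} {b : Fin k → R}, (∀ l, b l ∈ R.gr (e l)) →
      f (R.op μ b) = A.op μ fun l => f (b l) := by
    intro k μ e b hb'
    refine free_multilinear_eq hb (f.compMultilinearMap (R.op μ))
      ((A.op μ).compLinearMap fun _ => f) ?_ hb'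
    intro i q r ν v hν hv he
    rw [LinearMap.compMultilinearMap_apply, MultilinearMap.compLinearMap_apply]
    simp only [hf']
    have h1 := R.op_comp i μ (r := r) (a := fun x => ι (v x)) hν
      fun x => mem_of_mem_homGr_zero hι (hv x)
    have h2 := A.op_comp i μ (r := r) (a := fun x => ψ (v x)) hν
      fun x => mem_of_mem_homGr_zero hψ (hv x)
    have h3 := congrArg f h1
    rw [hf' _ fun y => v (finSigmaFinEquiv.symm y), h2, map_smul] at h3
    -- f has degree 0, so both algebras produce the same shuffle sign, which is cancelled.
    exact (smul_right_injective _ (ksign_ne_zero (K := K) _) h3).symm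
  refine ⟨f, ?_, ?_, ?_⟩
  · intro i x hx
    obtain ⟨y, hy, rfl⟩ := exists_word_of_mem hb hx
    rw [hf, add_zero]
    exact A.eval_mem ψ hψ hy
  · intro k μ b
    have h : f.compMultilinearMap (R.op μ) = (A.op μ).compLinearMap fun _ => f :=
      multilinear_ext_homogeneous (Y := fun _ => R.toDGModule) fun e y hy => hop μ hy
    exact congrArg (fun g => g b) h
  · intro x
    have := hf' P.one fun _ => x
    rwa [R.op_one, A.op_one] at this

variable {A : PAlgebra P} {f : R.toDGModule →ₗ[K] A.toDGModule} {M : AModule A}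

omit [CharZero K] in
theorem der_ext {n : ℤ} {D D' : R.toDGModule →ₗ[K] M.toDGModule} (hD : D ∈ der R f M n)
    (hD' : D' ∈ der R f M n) (h : D ∘ₗ ι = D' ∘ₗ ι) : D = D' := by
  refine free_ext hb fun p e μ v hμ hv => ?_
  rw [hD.2 hμ fun l => mem_of_mem_homGr_zero hι (hv l),
    hD'.2 hμ fun l => mem_of_mem_homGr_zero hι (hv l)]
  refine Finset.sum_congr rfl fun j _ => ?_
  have := LinearMap.congr_fun h (v j)
  rw [LinearMap.comp_apply, LinearMap.comp_apply] at this
  rw [this]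

/-- Maps on the generators of a free algebra extend to derivations. -/
theorem exists_der (hf : f ∈ homGr R.toDGModule A.toDGModule 0)
    (hf' : ∀ {k : ℕ} (μ : P.obj k) (b : Fin k → R), f (R.op μ b) = A.op μ fun l => f (b l))
    {s : ℤ} {g : V →ₗ[K] M.toDGModule} (hg : g ∈ homGr V M.toDGModule s) :
    ∃ D ∈ der R f M s, D ∘ₗ ι = g := by
  have hψ : ∀ {i x}, x ∈ V.gr i → f (ι x) ∈ A.gr i := fun hx =>
    mem_of_mem_homGr_zero hf (mem_of_mem_homGr_zero hι hx)
  have hins : ∀ {n : ℕ} (j : Fin n) (μ : P.obj n) (v : Fin n → V),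
      M.insert j (f ∘ₗ ι) g μ v = M.act j μ (g (v j)) fun l => f (ι (v l)) := fun j μ v => rfl
  -- The degree listed at position j is raised by s, since g (v_j) replaces v_j there.
  have hgm : ∀ {n : ℕ} {e : Fin n → ℤ} {v : Fin n → V} (j : Fin n), (∀ l, v l ∈ V.gr (e l)) →
      g (v j) ∈ M.gr ((e + Pi.single j s : Fin n → ℤ) j) := fun {n e v} j hv => by
    simpa using hg _ _ (hv j)
  have hψm : ∀ {n : ℕ} {e : Fin n → ℤ} {v : Fin n → V} (j : Fin n), (∀ l, v l ∈ V.gr (e l)) →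
      ∀ l, l ≠ j → f (ι (v l)) ∈ A.gr ((e + Pi.single j s : Fin n → ℤ) l) := fun {n e v} j hv l hl => by
    simpa [hl] using hψ (hv l)
  obtain ⟨L, hL⟩ := exists_schur_lift (P := P) (V := V)
    (fun n p e => ∑ j, ksign K (s * (p + before e j)) • M.insert j (f ∘ₗ ι) g) (by
    intro n σ p e μ v hμ hv
    simp only [LinearMap.sum_apply, LinearMap.smul_apply, _root_.sum_apply,
      _root_.smul_apply, hins]
    rw [← Equiv.sum_comp σ, Finset.smul_sum]
    refine Finset.sum_congr rfl fun j _ => ?_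
    rw [M.act_map σ j μ (e := e + Pi.single (σ j) s) (a := fun l => f (ι (v l))) (hgm (σ j) hv)
      (hψm (σ j) hv), smul_smul, smul_smul]
    congr 1
    have h3 := ksign_permExp_add_single (K := K) σ j s e
    rw [mul_add, mul_add, ksign_add, ksign_add, mul_assoc, mul_comm (ksign K (s * before e (σ j))),
      h3]
    ring)
  let E := LinearEquiv.ofBijective (R.eval ι hι) hb
  let D : R.toDGModule →ₗ[K] M.toDGModule := L ∘ₗ E.symm.toLinearMap
  have hDe : ∀ y, D (R.eval ι hι y) = L y := fun y => by
    have : E.symm (R.eval ι hι y) = y := E.symm_apply_apply y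
    simp only [D, LinearMap.comp_apply, LinearEquiv.coe_coe, this]
  have hDw : ∀ {n : ℕ} {p : ℤ} {e : Fin n → ℤ} {μ : P.obj n} {v : Fin n → V},
      μ ∈ (P.obj n).gr p → (∀ l, v l ∈ V.gr (e l)) → D (R.op μ fun l => ι (v l)) =
      ∑ j, ksign K (s * (p + before e j)) • M.act j μ (g (v j)) fun l => f (ι (v l)) :=
    fun hμ hv => by
      rw [← R.eval_word ι hι, hDe, hL _ _ _ _ hμ hv]
      simp only [LinearMap.sum_apply, LinearMap.smul_apply, _root_.sum_apply,
        _root_.smul_apply, hins]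
  refine ⟨D, ⟨?_, ?_⟩, ?_⟩
  · intro i x hx
    obtain ⟨y, hy, rfl⟩ := exists_word_of_mem hb hx
    suffices h : schurGr P V i ≤ (M.gr (i + s)).comap (D ∘ₗ R.eval ι hι) from h hy
    refine Submodule.span_le.2 ?_
    rintro _ ⟨n, p, e, μ, v, hμ, hv, rfl, rfl⟩
    rw [SetLike.mem_coe, Submodule.mem_comap, LinearMap.comp_apply, R.eval_word, hDw hμ hv]
    refine Submodule.sum_mem _ fun j _ => Submodule.smul_mem _ _ ?_
    have := M.act_mem j (a := fun l => f (ι (v l))) hμ (hgm j hv) (hψm j hv)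
    simpa [Finset.sum_add_distrib, add_assoc] using this
  · intro k p e μ b hμ hb'
    have hact : ∀ j : Fin k, ∃ F : MultilinearMap K (fun _ : Fin k => R.carrier) M.toDGModule,
        ∀ b, F b = M.act j μ (D (b j)) fun l => f (b l) := fun j =>
      ⟨M.insert j f D μ, fun b => rfl⟩
    choose F hF using hact
    have key := free_multilinear_eq hb (D.compMultilinearMap (R.op μ))
      (∑ j, ksign K (s * (p + before e j)) • F j) (b := b) (e := e) ?_ hb'
    · simpa only [LinearMap.compMultilinearMap_apply, _root_.sum_apply,
        _root_.smul_apply, hF] using key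
    intro i q r ν v hν hv he
    simp only [LinearMap.compMultilinearMap_apply, _root_.sum_apply,
      _root_.smul_apply, hF]
    -- An operation applied to words is flattened to one word, where D is known; its terms are then
    -- indexed by a block j and a letter l of it, as are the terms obtained by applying D inside the
    -- j-th argument.
    have h1 := congrArg D (R.op_comp i μ (r := r) (a := fun x => ι (v x)) hν
      fun x => mem_of_mem_homGr_zero hι (hv x))
    rw [map_smul, hDw (P.comp_mem i hμ hν) fun y => hv (finSigmaFinEquiv.symm y), sum_finSigma]
      at h1
    have h2 := congrArg (fun x => ksign K (shuffleExp q r) • x) h1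
    simp only [smul_smul, ksign_mul_self, one_smul] at h2
    rw [← h2, Finset.smul_sum]
    refine Finset.sum_congr rfl fun j _ => ?_
    rw [hDw (hν j) fun l => hv ⟨j, l⟩, map_sum]
    simp only [_root_.sum_apply, Finset.smul_sum]
    refine Finset.sum_congr rfl fun l _ => ?_
    have hr : ∀ x, x ≠ (⟨j, l⟩ : Σ j, Fin (i j)) →
        f (ι (v x)) ∈ A.gr ((r + Pi.single ⟨j, l⟩ s : (Σ j, Fin (i j)) → ℤ) x) := fun x hx => by
      simpa [hx] using hψ (hv x)
    have hr' : g (v ⟨j, l⟩) ∈ M.gr ((r + Pi.single ⟨j, l⟩ s : (Σ j, Fin (i j)) → ℤ) ⟨j, l⟩) := by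
      simpa using hg _ _ (hv ⟨j, l⟩)
    rw [Equiv.symm_apply_apply, M.act_comp i j l μ (a := fun x => f (ι (v x))) hν hr' hr,
      map_smul, _root_.smul_apply, smul_smul, smul_smul, smul_smul]
    simp only [hf']
    congr 1
    have h4 : (fun j' => ∑ l', (r + Pi.single ⟨j, l⟩ s : (Σ j, Fin (i j)) → ℤ) ⟨j', l'⟩) =
        (fun j' => ∑ l', r ⟨j', l'⟩) + Pi.single j s := sum_add_single r j l s
    have he' : e = q + fun j => ∑ l, r ⟨j, l⟩ := funext he
    rw [← ksign_add, ← ksign_add, ← ksign_add, shuffleExp_eq, shuffleExp_eq, h4,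
      beforeSum_add_right, beforeSum_single_right, before_finSigma, he', before_add,
      before_add_after j q]
    refine ksign_congr (beforeSum q (fun j => ∑ l, r ⟨j, l⟩) +
      s * ∑ x ∈ Finset.Ioi j, q x) ?_
    ring
  · refine DGModule.linearMap_ext fun i x hx => ?_
    rw [LinearMap.comp_apply]
    conv_lhs => rw [← R.op_one (ι x)]
    rw [hDw (v := fun _ => x) (e := fun _ => i) P.one_mem fun _ => hx, Fin.sum_univ_one]
    have h0 : before (fun _ : Fin 1 => i) 0 = 0 := by
      rw [before]; exact Finset.sum_eq_zero fun l hl => absurd (Finset.mem_Iio.1 hl) (by simp)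
    rw [h0, add_zero, mul_zero, ksign_zero, one_smul]
    conv_rhs => rw [← M.act_one (g x)]
    congr 1
    funext l
    exact absurd (Subsingleton.elim l.1 (0 : Fin 1)) l.2

end Free

theorem before_single {n : ℕ} (j : Fin n) (s : ℤ) (l : Fin n) :
    before (Pi.single j s) l = if j < l then s else 0 := by
  simp [before]

section

variable {P : Operad K} {R A : PAlgebra P} {f : R.toDGModule →ₗ[K] A.toDGModule} {M : AModule A}

/-- The derivations with values in a module form a complex. -/
theorem homD_mem_der (hf : IsPAlgebraHom f) {n : ℤ} {D : R.toDGModule →ₗ[K] M.toDGModule}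
    (hD : D ∈ der R f M (n + 1)) : homD R.toDGModule M.toDGModule (n + 1) D ∈ der R f M n := by
  refine ⟨homD_mem hD.1 _, ?_⟩
  intro k p e μ b hμ hb
  have hfb : ∀ l, f (b l) ∈ A.gr (e l) := fun l => mem_of_mem_homGr_zero hf.mem (hb l)
  have hDb : ∀ j : Fin k, ∀ l, l ≠ j →
      f (b l) ∈ A.gr ((e + Pi.single j (n + 1) : Fin k → ℤ) l) := fun j l hl => by
    simpa [hl] using hfb l
  have hDb' : ∀ j : Fin k, D (b j) ∈ M.gr ((e + Pi.single j (n + 1) : Fin k → ℤ) j) := fun j => by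
    simpa using hD.1 _ _ (hb j)
  have h1 : M.d (D (R.op μ b)) = ∑ j, (ksign K ((n + 1) * (p + before e j)) •
        M.act j ((P.obj k).d μ) (D (b j)) (fun l => f (b l)) +
      ∑ l, ksign K ((n + 1) * (p + before e j) + (p + before (e + Pi.single j (n + 1)) l)) •
        (if l = j then M.act j μ (M.d (D (b j))) (fun l => f (b l))
        else M.act j μ (D (b j)) fun l' => Function.update (fun l => f (b l)) l
          (A.d (f (b l))) l')) := by
    rw [hD.2 hμ hb, map_sum]
    refine Finset.sum_congr rfl fun j _ => ?_
    rw [map_smul, M.act_d j (a := fun l => f (b l)) hμ (hDb' j) (hDb j), smul_add,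
      Finset.smul_sum]
    simp only [smul_smul, ksign_add]
  have hu : ∀ l m, Function.update b l (R.d (b l)) m ∈
      R.gr ((e + Pi.single l (-1) : Fin k → ℤ) m) := fun l m => by
    by_cases h : m = l
    · subst h; simpa [sub_eq_add_neg] using R.d_mem (hb m)
    · simpa [h] using hb m
  have h2 : D (R.d (R.op μ b)) = ∑ j, (ksign K ((n + 1) * (p - 1 + before e j)) •
        M.act j ((P.obj k).d μ) (D (b j)) (fun l => f (b l)) +
      ∑ l, ksign K (p + before e l + (n + 1) * (p + before (e + Pi.single l (-1)) j)) •
        M.act j μ (D (Function.update b l (R.d (b l)) j))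
          fun l' => f (Function.update b l (R.d (b l)) l')) := by
    rw [R.op_d hμ hb, map_add, hD.2 ((P.obj k).d_mem hμ) hb, map_sum, Finset.sum_add_distrib,
      Finset.sum_comm]
    congr 1
    refine Finset.sum_congr rfl fun l _ => ?_
    rw [map_smul, hD.2 hμ (hu l), Finset.smul_sum]
    simp only [smul_smul, ksign_add]
  rw [homD_apply, h1, h2, Finset.smul_sum, ← Finset.sum_sub_distrib]
  -- Here D acts on argument j and the differential on argument l. The terms with l = j assemble to
  -- ∂(D) on b_j; those with l ≠ j, and those with the differential of μ, cancel, the former because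
  -- f commutes with differentials.
  refine Finset.sum_congr rfl fun j _ => ?_
  rw [smul_add, smul_smul, ← ksign_add, add_sub_add_comm,
    ksign_congr (a := n + 1 + (n + 1) * (p - 1 + before e j))
      (b := (n + 1) * (p + before e j)) 0 (by ring), sub_self, zero_add, Finset.smul_sum,
    ← Finset.sum_sub_distrib, Finset.sum_eq_single j]
  · rw [if_pos rfl, Function.update_self, before_add, before_single, if_neg (lt_irrefl j),
      before_add, before_single, if_neg (lt_irrefl j), homD_apply, map_sub, map_smul, smul_smul,
      _root_.sub_apply, _root_.smul_apply, smul_sub, smul_smul, ← ksign_add, ← ksign_add]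
    have h3 : (fun l : {l // l ≠ j} => f (Function.update b j (R.d (b j)) l)) =
        fun l : {l // l ≠ j} => f (b l) := by
      funext l
      rw [Function.update_of_ne l.2]
    rw [h3]
    congr 2
    · exact ksign_congr (p + before e j) (by ring)
    · exact ksign_congr (p + before e j) (by ring)
  · intro l _ hl
    rw [if_neg hl, Function.update_of_ne (Ne.symm hl), smul_smul, ← ksign_add]
    have h3 : (fun l' : {l // l ≠ j} => f (Function.update b l (R.d (b l)) l')) =
        fun l' : {l // l ≠ j} => Function.update (fun l => f (b l)) l (A.d (f (b l))) l' := by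
      funext l'
      by_cases h : (l' : Fin k) = l
      · rw [h, Function.update_self, Function.update_self, hf.map_d]
      · rw [Function.update_of_ne h, Function.update_of_ne h]
    rw [h3, sub_eq_zero, before_add, before_single, before_add, before_single]
    congr 1
    rcases lt_or_gt_of_ne hl with h | h
    · rw [if_pos h, if_neg h.asymm]
      exact ksign_congr 0 (by ring)
    · rw [if_neg h.asymm, if_pos h]
      exact ksign_congr 0 (by ring)
  · simp

/-- The derivations as a dg module. -/
theorem isDGFamily_der (hf : IsPAlgebraHom f) (M : AModule A) :
    IsDGFamily (der R f M) (homD R.toDGModule M.toDGModule) :=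
  ⟨fun _ _ hD => homD_mem_der hf hD, fun n D _ => homD_homD n D⟩

end

theorem IsHomogeneousFunctional.eq_degree {V : DGModule K} {u : V →ₗ[K] K} {p i : ℤ}
    (hu : IsHomogeneousFunctional u p) {x : V} (hx : x ∈ V.gr i) (h : u x ≠ 0) : i = p :=
  by_contra fun hi => h (hu i hi x hx)

theorem exists_tensor_linear_homogeneous {ι : Type*} [Fintype ι] [DecidableEq ι] {X : DGModule K}
    {Y : ι → DGModule K} {W : Type*} [AddCommGroup W] [Module K W]
    (F : ℤ → (ι → ℤ) → X ⊗[K] (⨂[K] l, Y l) →ₗ[K] W) :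
    ∃ L : X ⊗[K] (⨂[K] l, Y l) →ₗ[K] W,
      ∀ (p : ℤ) (e : ι → ℤ) (x : X) (y : ∀ l, Y l), x ∈ X.gr p →
        (∀ l, y l ∈ (Y l).gr (e l)) →
        L (x ⊗ₜ PiTensorProduct.tprod K y) = F p e (x ⊗ₜ PiTensorProduct.tprod K y) :=
  exists_tensor_homogeneous fun p e =>
    { toFun := fun x => (F p e ∘ₗ TensorProduct.mk K _ _ x).compMultilinearMap
        (PiTensorProduct.tprod K)
      map_add' := fun x x' => by ext y; simp
      map_smul' := fun r x => by ext y; simp }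

/-! ## Operations on tensors -/

section Ev

variable {P : Operad K} (B : PAlgebra P) {V : DGModule K} {Y : Type*} [AddCommGroup Y] [Module K Y]

/-- `y ⊗ v_1 ⊗ ⋯ ⊗ v_n ↦ γ_B(X y; ψ v_1, …, ψ v_n)`. -/
def PAlgebra.ev {n : ℕ} (X : Y →ₗ[K] P.obj n) (ψ : V →ₗ[K] B.toDGModule) :
    Y ⊗[K] (⨂[K] _ : Fin n, V) →ₗ[K] B.toDGModule :=
  TensorProduct.lift (PiTensorProduct.lift.toLinearMap ∘ₗ
    MultilinearMap.compLinearMapₗ (fun _ => ψ) ∘ₗ B.op ∘ₗ X)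

@[simp] theorem PAlgebra.ev_tmul {n : ℕ} (X : Y →ₗ[K] P.obj n) (ψ : V →ₗ[K] B.toDGModule) (y : Y)
    (v : Fin n → V) : B.ev X ψ (y ⊗ₜ PiTensorProduct.tprod K v) =
      B.op (X y) fun l => ψ (v l) := by
  simp [PAlgebra.ev]

theorem PAlgebra.ev_comp {n : ℕ} {Z : Type*} [AddCommGroup Z] [Module K Z] (X : Y →ₗ[K] P.obj n)
    (L : Z →ₗ[K] Y) (ψ : V →ₗ[K] B.toDGModule) (t : Z ⊗[K] (⨂[K] _ : Fin n, V)) :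
    B.ev (X ∘ₗ L) ψ t = B.ev X ψ (TensorProduct.map L LinearMap.id t) := by
  have : B.ev (X ∘ₗ L) ψ = B.ev X ψ ∘ₗ TensorProduct.map L LinearMap.id := by
    ext y v; simp
  rw [this, LinearMap.comp_apply]

theorem PAlgebra.ev_add {n : ℕ} (X X' : Y →ₗ[K] P.obj n) (ψ : V →ₗ[K] B.toDGModule) :
    B.ev (X + X') ψ = B.ev X ψ + B.ev X' ψ := by
  ext y v; simp

theorem PAlgebra.ev_smul {n : ℕ} (r : K) (X : Y →ₗ[K] P.obj n) (ψ : V →ₗ[K] B.toDGModule) :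
    B.ev (r • X) ψ = r • B.ev X ψ := by
  ext y v; simp

theorem PAlgebra.ev_sum {κ : Type*} (s : Finset κ) {n : ℕ} (X : κ → Y →ₗ[K] P.obj n)
    (ψ : V →ₗ[K] B.toDGModule) : B.ev (∑ x ∈ s, X x) ψ = ∑ x ∈ s, B.ev (X x) ψ := by
  ext y v; simp

end Ev

/-! ## Invariance and coassociativity as identities of tensors -/

section Coalgebra

variable {Q : Cooperad K} (C : QCoalgebra Q)

theorem exists_permute {m n : ℕ} (σ : Fin m ≃ Fin n) :
    ∃ L : Q.obj n ⊗[K] (⨂[K] _ : Fin n, C.toDGModule) →ₗ[K]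
      Q.obj m ⊗[K] (⨂[K] _ : Fin m, C.toDGModule),
      ∀ (p : ℤ) (e : Fin n → ℤ) (μ : Q.obj n) (y : Fin n → C), μ ∈ (Q.obj n).gr p →
        (∀ l, y l ∈ C.gr (e l)) → L (μ ⊗ₜ PiTensorProduct.tprod K y) =
          ksign K (permExp σ e) • (Q.map σ.symm μ ⊗ₜ PiTensorProduct.tprod K fun l => y (σ l)) := by
  obtain ⟨L, hL⟩ := exists_tensor_linear_homogeneous (X := Q.obj n)
    (Y := fun _ : Fin n => C.toDGModule) fun _ e => ksign K (permExp σ e) •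
      TensorProduct.map (Q.map σ.symm)
        (PiTensorProduct.reindex K (fun _ : Fin n => (C.toDGModule : Type u)) σ.symm).toLinearMap
  refine ⟨L, fun p e μ y hμ hy => ?_⟩
  rw [hL p e μ y hμ hy]
  simp

/-- The action of a relabelling of inputs on `Q(n) ⊗ C ⊗ ⋯ ⊗ C`. -/
def permute {m n : ℕ} (σ : Fin m ≃ Fin n) : Q.obj n ⊗[K] (⨂[K] _ : Fin n, C.toDGModule) →ₗ[K]
    Q.obj m ⊗[K] (⨂[K] _ : Fin m, C.toDGModule) :=
  (exists_permute C σ).choose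

variable {C}

theorem permute_tprod {m n : ℕ} (σ : Fin m ≃ Fin n) {p : ℤ} {e : Fin n → ℤ} {μ : Q.obj n}
    {y : Fin n → C} (hμ : μ ∈ (Q.obj n).gr p) (hy : ∀ l, y l ∈ C.gr (e l)) :
    permute C σ (μ ⊗ₜ PiTensorProduct.tprod K y) =
      ksign K (permExp σ e) • (Q.map σ.symm μ ⊗ₜ PiTensorProduct.tprod K fun l => y (σ l)) :=
  (exists_permute C σ).choose_spec p e μ y hμ hy

theorem contract_permute {n : ℕ} (σ : Fin n ≃ Fin n) {u : Q.obj n →ₗ[K] K} {q : Fin n → ℤ}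
    {w : Fin n → (C.toDGModule →ₗ[K] K)} (hw : ∀ l, IsHomogeneousFunctional (w l) (q l))
    (t : Q.obj n ⊗[K] (⨂[K] _ : Fin n, C.toDGModule)) :
    contract (Y := fun _ => C.toDGModule) u w (permute C σ t) =
      ksign K (permExp σ fun l => q (σ.symm l)) *
        contract (Y := fun _ => C.toDGModule) (u ∘ₗ Q.map σ.symm) (fun l => w (σ.symm l)) t := by
  suffices h : contract (Y := fun _ => C.toDGModule) u w ∘ₗ permute C σ =
      ksign K (permExp σ fun l => q (σ.symm l)) •
        contract (Y := fun _ => C.toDGModule) (u ∘ₗ Q.map σ.symm) (fun l => w (σ.symm l)) from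
    LinearMap.congr_fun h t
  refine tensor_ext_homogeneous fun p e μ y hμ hy => ?_
  have h1 : ∏ l, w l (y (σ l)) = ∏ l, w (σ.symm l) (y l) := by
    rw [← Equiv.prod_comp σ fun l => w (σ.symm l) (y l)]; simp
  rw [LinearMap.comp_apply, permute_tprod σ hμ hy, map_smul, LinearMap.smul_apply, contract_tprod,
    contract_tprod, h1, LinearMap.comp_apply]
  -- Either some factor vanishes and both sides are 0, or the degrees of the letters are forced to
  -- be those of the functionals, and the signs agree.
  by_cases h : ∀ l, w (σ.symm l) (y l) ≠ 0
  · have : e = fun l => q (σ.symm l) := funext fun l => (hw _).eq_degree (hy l) (h l)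
    rw [this]
  · push Not at h
    obtain ⟨l, hl⟩ := h
    rw [Finset.prod_eq_zero (Finset.mem_univ l) hl]
    simp

/-- The components of the decomposition of a coalgebra are invariant. -/
theorem permute_δ {m n : ℕ} (σ : Fin m ≃ Fin n) (c : C) : permute C σ (C.δ c n) = C.δ c m := by
  obtain rfl : m = n := by simpa using Fintype.card_congr σ
  refine eq_of_contract_eq fun p q u w hu hw => ?_
  rw [contract_permute σ hw, C.δ_invariant σ (u ∘ₗ Q.map σ.symm)
    (q := fun l => q (σ.symm l)) (w := fun l => w (σ.symm l)) fun l => hw _, ← mul_assoc,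
    ksign_mul_self, one_mul]
  have h1 : (u ∘ₗ Q.map σ.symm) ∘ₗ Q.map σ = u := by
    ext x
    rw [LinearMap.comp_apply, LinearMap.comp_apply, ← Q.map_trans]
    simp [Q.map_refl]
  rw [h1]
  simp

/-- The shuffle `⨂_j (Q(i_j) ⊗ C ⊗ ⋯ ⊗ C) → (⨂_j Q(i_j)) ⊗ C ⊗ ⋯ ⊗ C`. -/
theorem exists_shuffle {k : ℕ} (i : Fin k → ℕ) :
    ∃ S : MultilinearMap K (fun j => Q.obj (i j) ⊗[K] (⨂[K] _ : Fin (i j), C.toDGModule))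
      ((⨂[K] j, Q.obj (i j)) ⊗[K] (⨂[K] _ : Fin (∑ j, i j), C.toDGModule)),
      ∀ (q : Fin k → ℤ) (r : (Σ j, Fin (i j)) → ℤ) (ν : ∀ j, Q.obj (i j))
        (ρ : (Σ j, Fin (i j)) → C), (∀ j, ν j ∈ (Q.obj (i j)).gr (q j)) →
        (∀ x, ρ x ∈ C.gr (r x)) →
        S (fun j => ν j ⊗ₜ PiTensorProduct.tprod K fun l => ρ ⟨j, l⟩) =
          ksign K (shuffleExp q r) • (PiTensorProduct.tprod K ν ⊗ₜ
            PiTensorProduct.tprod K fun y => ρ (finSigmaFinEquiv.symm y)) := by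
  let T₀ : (⨂[K] j, Q.obj (i j)) →ₗ[K]
      MultilinearMap K (fun _ : (Σ j, Fin (i j)) => (C.toDGModule : Type u))
        ((⨂[K] j, Q.obj (i j)) ⊗[K] (⨂[K] _ : Fin (∑ j, i j), C.toDGModule)) :=
    { toFun := fun z => (TensorProduct.mk K _ _ z).compMultilinearMap
        ((PiTensorProduct.tprod K).domDomCongr finSigmaFinEquiv.symm)
      map_add' := fun z z' => by ext y; simp
      map_smul' := fun c z => by ext y; simp }
  obtain ⟨S, hS⟩ := exists_multilinear_blocks (X := fun j => Q.obj (i j)) (V := C.toDGModule)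
    fun q r => ksign K (shuffleExp q r) • T₀.compMultilinearMap (PiTensorProduct.tprod K)
  refine ⟨S, fun q r ν ρ hν hρ => ?_⟩
  rw [hS q r ν ρ hν hρ]
  simp [T₀]

end Coalgebra

theorem prod_finSigma {k : ℕ} {i : Fin k → ℕ} {M : Type*} [CommMonoid M]
    (f : Fin (∑ j, i j) → M) : ∏ y, f y = ∏ j, ∏ l, f (finSigmaFinEquiv ⟨j, l⟩) := by
  rw [← Equiv.prod_comp finSigmaFinEquiv, Fintype.prod_sigma]

section Coalgebra

variable {Q : Cooperad K} (C : QCoalgebra Q)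

/-- The shuffle `⨂_j (Q(i_j) ⊗ C ⊗ ⋯ ⊗ C) → (⨂_j Q(i_j)) ⊗ C ⊗ ⋯ ⊗ C`. -/
def shuffle {k : ℕ} (i : Fin k → ℕ) :
    MultilinearMap K (fun j => Q.obj (i j) ⊗[K] (⨂[K] _ : Fin (i j), C.toDGModule))
      ((⨂[K] j, Q.obj (i j)) ⊗[K] (⨂[K] _ : Fin (∑ j, i j), C.toDGModule)) :=
  (exists_shuffle i).choose

variable {C}

theorem shuffle_tprod {k : ℕ} {i : Fin k → ℕ} {q : Fin k → ℤ} {r : (Σ j, Fin (i j)) → ℤ}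
    {ν : ∀ j, Q.obj (i j)} {ρ : (Σ j, Fin (i j)) → C} (hν : ∀ j, ν j ∈ (Q.obj (i j)).gr (q j))
    (hρ : ∀ x, ρ x ∈ C.gr (r x)) :
    shuffle C i (fun j => ν j ⊗ₜ PiTensorProduct.tprod K fun l => ρ ⟨j, l⟩) =
      ksign K (shuffleExp q r) • (PiTensorProduct.tprod K ν ⊗ₜ
        PiTensorProduct.tprod K fun y => ρ (finSigmaFinEquiv.symm y)) :=
  (exists_shuffle i).choose_spec q r ν ρ hν hρ

/-- The component of arity `n` of the decomposition of a coalgebra. -/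
def QCoalgebra.δn (C : QCoalgebra Q) (n : ℕ) :
    C.toDGModule →ₗ[K] Q.obj n ⊗[K] (⨂[K] _ : Fin n, C.toDGModule) :=
  DirectSum.component K ℕ _ n ∘ₗ C.δ

theorem QCoalgebra.δn_apply (n : ℕ) (c : C) : C.δn n c = C.δ c n := rfl

/-- A homogeneous functional sees only one degree, so the shuffle sign, which depends on the
tensors, becomes a constant that depends on the functionals. -/
theorem contract_shuffle {k : ℕ} {i : Fin k → ℕ} {q : Fin k → ℤ} {r : Fin (∑ j, i j) → ℤ}
    {v : ∀ j, Q.obj (i j) →ₗ[K] K} {w : Fin (∑ j, i j) → (C.toDGModule →ₗ[K] K)}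
    (hv : ∀ j, IsHomogeneousFunctional (v j) (q j))
    (hw : ∀ j, IsHomogeneousFunctional (w j) (r j))
    (t : ∀ j, Q.obj (i j) ⊗[K] (⨂[K] _ : Fin (i j), C.toDGModule)) :
    LinearMap.mul' K K (TensorProduct.map (prodFunctional v)
      (prodFunctional (Y := fun _ => C.toDGModule) w) (shuffle C i t)) =
      ksign K (shuffleExp q fun x => r (finSigmaFinEquiv x)) *
        ∏ j, contract (Y := fun _ => C.toDGModule) (v j) (fun l => w (finSigmaFinEquiv ⟨j, l⟩))
          (t j) := by
  have key := multilinear_eq_on_span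
    ((LinearMap.mul' K K ∘ₗ TensorProduct.map (prodFunctional v)
      (prodFunctional (Y := fun _ => C.toDGModule) w)).compMultilinearMap (shuffle C i))
    (ksign K (shuffleExp q fun x => r (finSigmaFinEquiv x)) •
      (MultilinearMap.mkPiAlgebra K (Fin k) K).compLinearMap fun j =>
        contract (Y := fun _ => C.toDGModule) (v j) fun l => w (finSigmaFinEquiv ⟨j, l⟩))
    (fun j => {t | ∃ (p : ℤ) (e : Fin (i j) → ℤ) (x : Q.obj (i j)) (y : Fin (i j) → C),
      x ∈ (Q.obj (i j)).gr p ∧ (∀ l, y l ∈ C.gr (e l)) ∧ t = x ⊗ₜ PiTensorProduct.tprod K y})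
    ?_ t fun j => by
      rw [span_tensor_homogeneous (X := Q.obj (i j)) (Y := fun _ : Fin (i j) => C.toDGModule)]
      trivial
  · simpa using key
  intro t ht
  choose p e x y hx hy ht using ht
  obtain rfl : t = fun j => x j ⊗ₜ PiTensorProduct.tprod K (y j) := funext ht
  have h1 := shuffle_tprod (C := C) (i := i) (r := fun z => e z.1 z.2) (ρ := fun z => y z.1 z.2) hx
    fun z => hy z.1 z.2
  simp only [LinearMap.compMultilinearMap_apply, LinearMap.comp_apply, _root_.smul_apply,
    MultilinearMap.compLinearMap_apply, contract_tprod, MultilinearMap.mkPiAlgebra_apply]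
  rw [h1, map_smul, map_smul, TensorProduct.map_tmul, LinearMap.mul'_apply, prodFunctional_tprod,
    prodFunctional_tprod, prod_finSigma, Finset.prod_mul_distrib]
  have h6 : ∀ j l, y (finSigmaFinEquiv.symm (finSigmaFinEquiv (⟨j, l⟩ : Σ j, Fin (i j)))).1
      (finSigmaFinEquiv.symm (finSigmaFinEquiv ⟨j, l⟩)).2 = y j l := fun j l =>
    congrArg (fun z : Σ j, Fin (i j) => y z.1 z.2) (Equiv.symm_apply_apply _ _)
  simp only [h6]
  by_cases h : (∀ j, v j (x j) ≠ 0) ∧ ∀ j l, w (finSigmaFinEquiv ⟨j, l⟩) (y j l) ≠ 0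
  · have h2 : p = q := funext fun j => (hv j).eq_degree (hx j) (h.1 j)
    have h3 : (fun z : Σ j, Fin (i j) => e z.1 z.2) = fun z => r (finSigmaFinEquiv z) :=
      funext fun z => (hw _).eq_degree (hy z.1 z.2) (h.2 z.1 z.2)
    rw [h2, h3]
  · have h4 : (∏ j, v j (x j)) * ∏ j, ∏ l, w (finSigmaFinEquiv ⟨j, l⟩) (y j l) = 0 := by
      by_contra h5
      rw [mul_eq_zero, not_or, Finset.prod_eq_zero_iff, Finset.prod_eq_zero_iff] at h5
      push Not at h5
      exact h ⟨fun j => h5.1 j (Finset.mem_univ j), fun j l =>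
        Finset.prod_ne_zero_iff.1 (h5.2 j (Finset.mem_univ j)) l (Finset.mem_univ l)⟩
    rw [h4, smul_zero, smul_zero]

/-- Coassociativity as an identity of tensors. -/
theorem coassoc_tensor {k : ℕ} (i : Fin k → ℕ) (c : C) :
    TensorProduct.assoc K _ _ _ (TensorProduct.map (Q.Δ i finSigmaFinEquiv) LinearMap.id
        (C.δ c (∑ j, i j))) =
      TensorProduct.map LinearMap.id (PiTensorProduct.lift (shuffle C i) ∘ₗ
        PiTensorProduct.map fun j => C.δn (i j)) (C.δ c k) := by
  refine eq_of_contractTwo_eq (Y := fun j => Q.obj (i j)) (Z := fun _ => C.toDGModule)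
    fun p q r u v w hu hv hw => ?_
  -- `h1` and `h3` turn the contractions of the two sides into those compared by the coassociativity
  -- axiom of C.
  have h1 : contractTwo (Y := fun j => Q.obj (i j)) (Z := fun _ => C.toDGModule) u v w ∘ₗ
      (TensorProduct.assoc K _ _ _).toLinearMap ∘ₗ
        TensorProduct.map (Q.Δ i finSigmaFinEquiv) LinearMap.id =
      contract (Y := fun _ => C.toDGModule) (coev (Q.Δ i finSigmaFinEquiv) u v) w := by
    have h2 : contractTwo (Y := fun j => Q.obj (i j)) (Z := fun _ => C.toDGModule) u v w ∘ₗ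
        (TensorProduct.assoc K _ _ _).toLinearMap =
        LinearMap.mul' K K ∘ₗ TensorProduct.map (contract u v)
          (prodFunctional (Y := fun _ => C.toDGModule) w) := by
      ext x y z
      simp [contractTwo, mul_assoc]
    rw [← LinearMap.comp_assoc, h2]
    ext x y
    simp [coev]
  have h3 : contractTwo (Y := fun j => Q.obj (i j)) (Z := fun _ => C.toDGModule) u v w ∘ₗ
      TensorProduct.map LinearMap.id (PiTensorProduct.lift (shuffle C i) ∘ₗ
        PiTensorProduct.map fun j => C.δn (i j)) =
      ksign K (shuffleExp q fun x => r (finSigmaFinEquiv x)) •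
        contract (Y := fun _ => C.toDGModule) u (fun j =>
          contract (Y := fun _ => C.toDGModule) (v j) (fun l => w (finSigmaFinEquiv ⟨j, l⟩)) ∘ₗ
            C.δn (i j)) := by
    ext x y
    simp [contractTwo, contract_shuffle hv hw]
    ring
  have h4 := C.coassoc i (r := fun x => r (finSigmaFinEquiv x)) (w := fun x => w (finSigmaFinEquiv x))
    hu hv (fun x => hw _) c
  simp only [Equiv.apply_symm_apply] at h4
  refine (LinearMap.congr_fun h1 _).trans (h4.trans ?_)
  exact (LinearMap.congr_fun h3 (C.δ c k)).symm

end Coalgebra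

/-! ### The bracket and its normalisation -/

theorem toModule_eq_sum {X : ℕ → Type*} [∀ n, AddCommGroup (X n)] [∀ n, Module K (X n)]
    {W : Type*} [AddCommGroup W] [Module K W] (F : ∀ n, X n →ₗ[K] W) (x : DirectSum ℕ X) {b : ℕ}
    (hx : ∀ n, b ≤ n → x n = 0) :
    DirectSum.toModule K ℕ W F x = ∑ n ∈ Finset.range b, F n (x n) := by
  classical
  have h1 : x = ∑ n ∈ Finset.range b, DirectSum.lof K ℕ X n (x n) := by
    ext n
    rw [DFinsupp.finsetSum_apply]
    by_cases h : n < b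
    · rw [Finset.sum_eq_single n]
      · exact (DirectSum.lof_apply (R := K) n (x n)).symm
      · intro m _ hm
        exact DFinsupp.single_eq_of_ne hm.symm
      · intro h2; exact absurd (Finset.mem_range.2 h) h2
    · rw [hx n (not_lt.1 h), Finset.sum_eq_zero]
      intro m hm
      refine DFinsupp.single_eq_of_ne fun h2 => h ?_
      rw [h2]; exact Finset.mem_range.1 hm
  conv_lhs => rw [h1]
  simp [map_sum]

theorem exists_bound {X : ℕ → Type*} [∀ n, AddCommGroup (X n)] (x : DirectSum ℕ X) :
    ∃ b, ∀ n, b ≤ n → x n = 0 := by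
  classical
  refine ⟨x.support.sup id + 1, fun n hn => ?_⟩
  by_contra h
  have := Finset.le_sup (f := id) (DFinsupp.mem_support_iff.2 h)
  simp only [id] at this
  omega

theorem prod_ksign_ne_last {n : ℕ} (s : ℤ) (e : Fin (n + 1) → ℤ) :
    ∏ l : {l // l ≠ Fin.last n}, ksign K (s * e l) = ksign K (s * before e (Fin.last n)) := by
  rw [before, Finset.mul_sum, ksign_sum]
  refine Finset.prod_bij (fun l _ => l.1) (fun l _ => ?_) (fun l _ l' _ h => Subtype.ext h)
    (fun l hl => ⟨⟨l, (Finset.mem_Iio.1 hl).ne⟩, Finset.mem_univ _, rfl⟩) fun l _ => rfl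
  exact Finset.mem_Iio.2 (Fin.lt_last_iff_ne_last.2 l.2)

section

variable {P : Operad K} {Q : Cooperad K} (α : OperadicTwisting Q P) {C : QCoalgebra Q}

section Bracket

variable {A : PAlgebra P} (M : AModule A)

theorem exists_bracketAt (s : ℤ) (ψ : C.toDGModule →ₗ[K] A.toDGModule)
    (g : C.toDGModule →ₗ[K] M.toDGModule) {n : ℕ} (j : Fin n) :
    ∃ L : Q.obj n ⊗[K] (⨂[K] _ : Fin n, C.toDGModule) →ₗ[K] M.toDGModule,
      ∀ (p : ℤ) (e : Fin n → ℤ) (μ : Q.obj n) (y : Fin n → C), μ ∈ (Q.obj n).gr p →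
        (∀ l, y l ∈ C.gr (e l)) → L (μ ⊗ₜ PiTensorProduct.tprod K y) =
          ksign K (s * (p + before e j)) • M.act j (α.toFun n μ) (g (y j)) fun l => ψ (y l) :=
  exists_tensor_homogeneous (X := Q.obj n) (Y := fun _ : Fin n => C.toDGModule) fun p e =>
    ksign K (s * (p + before e j)) • (M.insert j ψ g ∘ₗ α.toFun n)

/-- The variant of the term of `α[ψ, g]` in arity `n` where `g` is applied to the `j`-th factor. -/
def bracketAt (s : ℤ) (ψ : C.toDGModule →ₗ[K] A.toDGModule)
    (g : C.toDGModule →ₗ[K] M.toDGModule) {n : ℕ} (j : Fin n) :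
    Q.obj n ⊗[K] (⨂[K] _ : Fin n, C.toDGModule) →ₗ[K] M.toDGModule :=
  (exists_bracketAt α M s ψ g j).choose

variable {α M} {s : ℤ} {ψ : C.toDGModule →ₗ[K] A.toDGModule} {g : C.toDGModule →ₗ[K] M.toDGModule}

theorem bracketAt_tprod {n : ℕ} (j : Fin n) {p : ℤ} {e : Fin n → ℤ} {μ : Q.obj n} {y : Fin n → C}
    (hμ : μ ∈ (Q.obj n).gr p) (hy : ∀ l, y l ∈ C.gr (e l)) :
    bracketAt α M s ψ g j (μ ⊗ₜ PiTensorProduct.tprod K y) =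
      ksign K (s * (p + before e j)) • M.act j (α.toFun n μ) (g (y j)) fun l => ψ (y l) :=
  (exists_bracketAt α M s ψ g j).choose_spec p e μ y hμ hy

/-- Equivariance of α and of the action: the letter to which g is applied counts with its degree
raised by s, as in `ksign_permExp_add_single`. On the invariant components of Δ_C the position of g
is then immaterial (`bracketAt_eq`). -/
theorem bracketAt_permute (hψ : ψ ∈ homGr C.toDGModule A.toDGModule 0)
    (hg : g ∈ homGr C.toDGModule M.toDGModule s) {m n : ℕ} (σ : Fin m ≃ Fin n) (j : Fin m) :
    bracketAt α M s ψ g j ∘ₗ permute C σ = bracketAt α M s ψ g (σ j) := by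
  refine tensor_ext_homogeneous (X := Q.obj n) (Y := fun _ => C.toDGModule)
    fun p e μ y hμ hy => ?_
  rw [LinearMap.comp_apply, permute_tprod σ hμ hy, map_smul,
    bracketAt_tprod j (Q.map_mem σ.symm hμ) fun l => hy (σ l), bracketAt_tprod (σ j) hμ hy]
  have h1 : α.toFun n μ = P.map σ (α.toFun m (Q.map σ.symm μ)) := by
    rw [← α.equivariant, ← Q.map_trans, Equiv.symm_trans_self, Q.map_refl]
  have h2 : g (y (σ j)) ∈ M.gr ((e + Pi.single (σ j) s : Fin n → ℤ) (σ j)) := by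
    simpa using hg _ _ (hy (σ j))
  have h3 : ∀ l, l ≠ σ j → ψ (y l) ∈ A.gr ((e + Pi.single (σ j) s : Fin n → ℤ) l) :=
    fun l hl => by simpa [hl] using hψ _ _ (hy l)
  rw [h1, M.act_map σ j _ (a := fun l => ψ (y l)) h2 h3, smul_smul, smul_smul]
  congr 1
  have h4 := ksign_permExp_add_single (K := K) σ j s e
  rw [mul_add, mul_add, ksign_add, ksign_add, mul_assoc, mul_comm (ksign K (s * before e (σ j))),
    h4]
  simp only [Function.comp_def]
  ring

theorem bracketAt_eq (hψ : ψ ∈ homGr C.toDGModule A.toDGModule 0)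
    (hg : g ∈ homGr C.toDGModule M.toDGModule s) {n : ℕ} (j j' : Fin n) (c : C) :
    bracketAt α M s ψ g j (C.δ c n) = bracketAt α M s ψ g j' (C.δ c n) := by
  have h := bracketAt_permute (α := α) hψ hg (Equiv.swap j j') j
  rw [Equiv.swap_apply_left] at h
  rw [← h, LinearMap.comp_apply, permute_δ]

/-- The sign operators on the cooperad element and on the letters before the last one produce the
Koszul sign of g factor by factor. -/
theorem bracketTerm_eq (n : ℕ) : bracketTerm α M s ψ g (n + 1) =
    ((n.factorial : ℕ) : K)⁻¹ • bracketAt α M s ψ g (Fin.last n) := by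
  refine tensor_ext_homogeneous (X := Q.obj (n + 1)) (Y := fun _ => C.toDGModule)
    fun p e μ y hμ hy => ?_
  rw [LinearMap.smul_apply, bracketAt_tprod _ hμ hy, bracketTerm, LinearMap.smul_apply]
  congr 1
  rw [TensorProduct.lift.tmul]
  simp only [LinearMap.comp_apply, LinearEquiv.coe_coe, PiTensorProduct.lift.tprod]
  change M.act _ _ (g (y (Fin.last n))) (fun l : {l // l ≠ Fin.last n} =>
    ψ (C.toDGModule.sgn s (y l))) = _
  have h1 : (fun l : {l // l ≠ Fin.last n} => ψ (C.toDGModule.sgn s (y l))) =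
      fun l : {l // l ≠ Fin.last n} => ksign K (s * e l) • ψ (y l) := funext fun l => by
    rw [DGModule.sgn_of_mem _ s (hy l), map_smul]
  rw [h1, MultilinearMap.map_smul_univ, DGModule.sgn_of_mem _ s hμ, map_smul, map_smul,
    LinearMap.smul_apply, _root_.smul_apply, smul_smul, prod_ksign_ne_last,
    mul_add, ksign_add, mul_comm]

/-- All n positions contribute equally, and n / n! = 1 / (n - 1)!. This reconciles the normalisation
of ⋆_α with that of the bracket; in arity 0 both sides vanish. -/
theorem sum_bracketAt [CharZero K] (hψ : ψ ∈ homGr C.toDGModule A.toDGModule 0)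
    (hg : g ∈ homGr C.toDGModule M.toDGModule s) (n : ℕ) (c : C) :
    ((n.factorial : ℕ) : K)⁻¹ • ∑ j : Fin n, bracketAt α M s ψ g j (C.δ c n) =
      bracketTerm α M s ψ g n (C.δ c n) := by
  cases n with
  | zero => simp [bracketTerm]
  | succ n =>
    rw [bracketTerm_eq, Finset.sum_congr rfl fun j _ => bracketAt_eq hψ hg j (Fin.last n) c,
      Finset.sum_const, Finset.card_univ, Fintype.card_fin, LinearMap.smul_apply,
      ← Nat.cast_smul_eq_nsmul K, smul_smul]
    congr 1
    have h1 : ((n.factorial : ℕ) : K) ≠ 0 := Nat.cast_ne_zero.2 n.factorial_ne_zero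
    have h2 : ((n + 1 : ℕ) : K) ≠ 0 := Nat.cast_ne_zero.2 n.succ_ne_zero
    rw [Nat.factorial_succ, Nat.cast_mul]
    field_simp

end Bracket

theorem star_eq (B : PAlgebra P) (ψ : C.toDGModule →ₗ[K] B.toDGModule) (c : C) :
    star α C B ψ c = DirectSum.toModule K ℕ B.toDGModule
      (fun n => ((n.factorial : ℕ) : K)⁻¹ • B.ev (α.toFun n) ψ) (C.δ c) := by
  have h : star α C B ψ = DirectSum.toModule K ℕ B.toDGModule
      (fun n => ((n.factorial : ℕ) : K)⁻¹ • B.ev (α.toFun n) ψ) ∘ₗ C.δ := by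
    rw [star, decompose, ← LinearMap.comp_assoc]
    congr 1
    refine DirectSum.linearMap_ext K fun n => ?_
    ext μ y
    have := B.evalRaw_word ψ (α.toFun n μ) y
    rw [schurWord] at this
    simp [DirectSum.lmap_lof, this]
  rw [h, LinearMap.comp_apply]

variable {α}

/-- A derivation on the values of `⋆_α`. -/
theorem der_star [CharZero K] {R A : PAlgebra P} {f : R.toDGModule →ₗ[K] A.toDGModule}
    {M : AModule A} {s : ℤ} {D : R.toDGModule →ₗ[K] M.toDGModule} (hD : D ∈ der R f M s)
    (hf : f ∈ homGr R.toDGModule A.toDGModule 0) {ι : C.toDGModule →ₗ[K] R.toDGModule}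
    (hι : ι ∈ homGr C.toDGModule R.toDGModule 0) (c : C) :
    D (star α C R ι c) = ksign K s • bracket α M s (f ∘ₗ ι) (D ∘ₗ ι) c := by
  have hfι : f ∘ₗ ι ∈ homGr C.toDGModule A.toDGModule 0 := fun i x hx => by
    rw [add_zero]
    exact mem_of_mem_homGr_zero hf (mem_of_mem_homGr_zero hι hx)
  have hDι : D ∘ₗ ι ∈ homGr C.toDGModule M.toDGModule s := fun i x hx =>
    hD.1 _ _ (mem_of_mem_homGr_zero hι hx)
  have h1 : ∀ n, D ∘ₗ R.ev (α.toFun n) ι =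
      ksign K s • ∑ j, bracketAt α M s (f ∘ₗ ι) (D ∘ₗ ι) j := fun n => by
    refine tensor_ext_homogeneous (X := Q.obj n) (Y := fun _ => C.toDGModule)
      fun p e μ y hμ hy => ?_
    rw [LinearMap.comp_apply, R.ev_tmul, hD.2 (α.mem n hμ) fun l =>
      mem_of_mem_homGr_zero hι (hy l), LinearMap.smul_apply, LinearMap.sum_apply, Finset.smul_sum]
    refine Finset.sum_congr rfl fun j _ => ?_
    rw [bracketAt_tprod j hμ hy, smul_smul, ← ksign_add]
    congr 1
    -- D passes the operation α(μ) of degree p - 1, whereas the bracket counts the degree p of μ;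
    -- this is the factor (-1)^s.
    exact ksign_congr (-s) (by ring)
  obtain ⟨b, hb⟩ := exists_bound (C.δ c)
  rw [star_eq, toModule_eq_sum _ _ hb, map_sum, bracket, LinearMap.comp_apply,
    toModule_eq_sum _ _ hb, Finset.smul_sum]
  refine Finset.sum_congr rfl fun n _ => ?_
  rw [← sum_bracketAt hfι hDι, LinearMap.smul_apply, map_smul, smul_comm]
  congr 1
  have := LinearMap.congr_fun (h1 n) (C.δ c n)
  simpa using this

end

/-! ### Evaluation of α ⋆ α on the decomposition of C -/

section

variable {P : Operad K} {Q : Cooperad K} {C : QCoalgebra Q}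

theorem unitCounit_mem (n : ℕ) {q : ℤ} {ν : Q.obj n} (hν : ν ∈ (Q.obj n).gr q) :
    unitCounit Q P n ν ∈ (P.obj n).gr q := by
  by_cases hn : n = 1
  · subst hn
    rw [unitCounit, LinearMap.smulRight_apply]
    by_cases hq : q = 0
    · subst hq
      exact Submodule.smul_mem _ _ P.one_mem
    · rw [Q.counit_homogeneous q hq ν hν, zero_smul]
      exact zero_mem _
  · rw [unitCounit]
    · exact zero_mem _
    · exact hn

theorem unitCounit_of_ne_zero (n : ℕ) {q : ℤ} (hq : q ≠ 0) {ν : Q.obj n}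
    (hν : ν ∈ (Q.obj n).gr q) : unitCounit Q P n ν = 0 := by
  by_cases hn : n = 1
  · subst hn
    rw [unitCounit, LinearMap.smulRight_apply, Q.counit_homogeneous q hq ν hν, zero_smul]
  · rw [unitCounit]
    · rfl
    · exact hn

theorem counit_δ_tensor (c : C) : TensorProduct.lid K C.toDGModule
    (TensorProduct.map Q.counit (PiTensorProduct.subsingletonEquiv (0 : Fin 1)).toLinearMap
      (C.δ c 1)) = c := by
  rw [← sub_eq_zero, ← Module.forall_dual_apply_eq_zero_iff K]
  intro w
  have h : w ∘ₗ (TensorProduct.lid K C.toDGModule).toLinearMap ∘ₗ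
      TensorProduct.map Q.counit (PiTensorProduct.subsingletonEquiv (0 : Fin 1)).toLinearMap =
      contract (Y := fun _ => C.toDGModule) Q.counit fun _ : Fin 1 => w := by
    ext μ y
    simp
  rw [map_sub, ← C.counit_δ w c, ← h]
  simp

variable (B : PAlgebra P) {ψ : C.toDGModule →ₗ[K] B.toDGModule}

/-- The counit axiom of C followed by the unit axiom of B. The arity is a variable equal to 1, since
block sizes given by `Function.update` are 1 only up to a proof. -/
theorem ev_unitCounit {n : ℕ} (hn : n = 1) (c : C) :
    B.ev (unitCounit Q P n) ψ (C.δ c n) = ψ c := by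
  subst hn
  have h : B.ev (unitCounit Q P 1) ψ = ψ ∘ₗ (TensorProduct.lid K C.toDGModule).toLinearMap ∘ₗ
      TensorProduct.map Q.counit (PiTensorProduct.subsingletonEquiv (0 : Fin 1)).toLinearMap := by
    ext μ y
    have : (fun l => ψ (y l)) = fun _ => ψ (y 0) := funext fun l => by rw [Subsingleton.elim l 0]
    simp [unitCounit, this, B.op_one]
  rw [h]
  exact congrArg ψ (counit_δ_tensor c)

variable {B} (α : OperadicTwisting Q P)

/-- `B.op_comp` undoes the shuffle. Away from j the maps β are nonzero in degree 0 only, so no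
operation before ν_j contributes a sign; what remains is the sign of moving the map β_j of degree -1
past μ and the arguments before j. -/
theorem ev_shuffle (hψ : ψ ∈ homGr C.toDGModule B.toDGModule 0) {n : ℕ} {i : Fin n → ℕ} (j : Fin n)
    {β : ∀ l, Q.obj (i l) →ₗ[K] P.obj (i l)}
    (hβ : ∀ l q ν, ν ∈ (Q.obj (i l)).gr q →
      β l ν ∈ (P.obj (i l)).gr (q + (Pi.single j (-1) : Fin n → ℤ) l))
    (hβ' : ∀ l, l ≠ j → ∀ q, q ≠ 0 → ∀ ν ∈ (Q.obj (i l)).gr q, β l ν = 0)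
    {p : ℤ} {e : Fin n → ℤ} {μ : Q.obj n} (hμ : μ ∈ (Q.obj n).gr p)
    {t : ∀ l, Q.obj (i l) ⊗[K] (⨂[K] _ : Fin (i l), C.toDGModule)}
    (ht : ∀ l, t l ∈ tensorGr (Q.obj (i l)) (fun _ => C.toDGModule) (e l)) :
    B.ev (P.compT i ∘ₗ TensorProduct.map (α.toFun n ∘ₗ (Q.obj n).sgn 1) (PiTensorProduct.map β)) ψ
      ((TensorProduct.assoc K _ _ _).symm (μ ⊗ₜ shuffle C i t)) =
      ksign K (-1 * (p + before e j)) • B.op (α.toFun n μ) fun l => B.ev (β l) ψ (t l) := by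
  refine multilinear_eq_on_span
    ((B.ev (P.compT i ∘ₗ TensorProduct.map (α.toFun n ∘ₗ (Q.obj n).sgn 1)
      (PiTensorProduct.map β)) ψ ∘ₗ (TensorProduct.assoc K _ _ _).symm.toLinearMap ∘ₗ
      TensorProduct.mk K _ _ μ).compMultilinearMap (shuffle C i))
    (ksign K (-1 * (p + before e j)) • (B.op (α.toFun n μ)).compLinearMap fun l => B.ev (β l) ψ)
    _ ?_ t ht
  intro t ht
  choose q r ν ρ hν hρ hqr ht using ht
  obtain rfl : t = fun l => ν l ⊗ₜ PiTensorProduct.tprod K (ρ l) := funext ht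
  have h1 := shuffle_tprod (C := C) (i := i) (r := fun z => r z.1 z.2) (ρ := fun z => ρ z.1 z.2) hν
    fun z => hρ z.1 z.2
  simp only [LinearMap.compMultilinearMap_apply, LinearMap.comp_apply, _root_.smul_apply,
    MultilinearMap.compLinearMap_apply, TensorProduct.mk_apply, LinearEquiv.coe_coe,
    PAlgebra.ev_tmul]
  rw [h1, TensorProduct.tmul_smul, map_smul, map_smul, TensorProduct.assoc_symm_tmul,
    PAlgebra.ev_tmul, LinearMap.comp_apply, TensorProduct.map_tmul, PiTensorProduct.map_tprod,
    LinearMap.comp_apply, DGModule.sgn_of_mem _ _ hμ, Operad.compT, TensorProduct.lift.tmul]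
  simp only [LinearMap.comp_apply, LinearEquiv.coe_coe, PiTensorProduct.lift.tprod, map_smul,
    LinearMap.smul_apply, _root_.smul_apply]
  have h2 := B.op_comp i (α.toFun n μ) (r := fun z => r z.1 z.2) (a := fun z => ψ (ρ z.1 z.2))
    (fun l => hβ l _ _ (hν l)) fun z => mem_of_mem_homGr_zero hψ (hρ z.1 z.2)
  rw [h2, smul_smul, smul_smul]
  -- If some operation away from j has nonzero degree, its β vanishes and so do both sides.
  by_cases h : ∀ l, l ≠ j → q l = 0
  · congr 1
    have h3 : before q j = 0 := Finset.sum_eq_zero fun l hl => h l (Finset.mem_Iio.1 hl).ne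
    have h4 : e = q + fun l => ∑ x, r l x := funext fun l => (hqr l).symm
    have h5 : shuffleExp q (fun z : Σ l, Fin (i l) => r z.1 z.2) =
        beforeSum q fun l => ∑ x, r l x := shuffleExp_eq _ _
    have h6 : shuffleExp (fun l => q l + (Pi.single j (-1) : Fin n → ℤ) l)
        (fun z : Σ l, Fin (i l) => r z.1 z.2) =
        beforeSum q (fun l => ∑ x, r l x) + -1 * before (fun l => ∑ x, r l x) j := by
      rw [← beforeSum_single, ← beforeSum_add_left]
      exact shuffleExp_eq _ _
    rw [← ksign_add, ← ksign_add, h5, h6, h4, before_add, h3]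
    exact ksign_congr (beforeSum q (fun l => ∑ x, r l x) + p) (by ring)
  · push Not at h
    obtain ⟨l, hl, hq⟩ := h
    have h3 : B.op (α.toFun n μ) (fun l => B.op (β l (ν l)) fun x => ψ (ρ l x)) = 0 := by
      refine MultilinearMap.map_coord_zero _ l ?_
      rw [hβ' l hl _ hq _ (hν l), map_zero]
      rfl
    rw [h3, smul_zero, smul_zero]

variable {α}

/-- Coassociativity replaces the decomposition of the cooperad element by a decomposition of each
letter. The blocks other than j return their letter by the counit, and block j evaluates α on the
decomposition of the j-th letter. -/
theorem ev_decompose (hψ : ψ ∈ homGr C.toDGModule B.toDGModule 0) {n : ℕ} {i : Fin n → ℕ}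
    (j : Fin n) (hi : ∀ l, l ≠ j → i l = 1) (c : C) :
    B.ev (P.compT i ∘ₗ TensorProduct.map (α.toFun n ∘ₗ (Q.obj n).sgn 1)
      (PiTensorProduct.map fun l => if l = j then α.toFun (i l) else unitCounit Q P (i l)) ∘ₗ
        Q.Δ i finSigmaFinEquiv) ψ (C.δ c (∑ l, i l)) =
      bracketAt α B.selfModule (-1) ψ (B.ev (α.toFun (i j)) ψ ∘ₗ C.δn (i j)) j (C.δ c n) := by
  rw [← LinearMap.comp_assoc, B.ev_comp]
  have h1 := coassoc_tensor i c
  rw [← LinearEquiv.eq_symm_apply] at h1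
  rw [h1]
  refine LinearMap.congr_fun (f := B.ev (P.compT i ∘ₗ
    TensorProduct.map (α.toFun n ∘ₗ (Q.obj n).sgn 1) (PiTensorProduct.map fun l =>
      if l = j then α.toFun (i l) else unitCounit Q P (i l))) ψ ∘ₗ
    (TensorProduct.assoc K _ _ _).symm.toLinearMap ∘ₗ
      TensorProduct.map LinearMap.id (PiTensorProduct.lift (shuffle C i) ∘ₗ
        PiTensorProduct.map fun l => C.δn (i l))) ?_ (C.δ c n)
  refine tensor_ext_homogeneous (X := Q.obj n) (Y := fun _ => C.toDGModule)
    fun p e μ y hμ hy => ?_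
  refine Eq.trans ?_ (bracketAt_tprod (M := B.selfModule) j hμ hy).symm
  refine Eq.trans ?_ (congrArg (ksign K (-1 * (p + before e j)) • ·)
    (B.selfModule_act j (α.toFun n μ) (B.ev (α.toFun (i j)) ψ (C.δn (i j) (y j)))
      fun l => ψ (y l)).symm)
  simp only [LinearMap.comp_apply, TensorProduct.map_tmul, PiTensorProduct.map_tprod,
    PiTensorProduct.lift.tprod, LinearEquiv.coe_coe, LinearMap.id_apply]
  refine (ev_shuffle α hψ j (e := e) (t := fun l => C.δn (i l) (y l)) ?_ ?_ hμ
    fun l => C.δ_mem _ (hy l)).trans (congrArg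
      (fun z => (ksign K (-1 * (p + before e j)) • B.op (α.toFun n μ) z : B)) ?_)
  rotate_left 2
  · funext l
    by_cases h : l = j
    · subst h; simp
    · rw [if_neg h, Function.update_of_ne h]
      exact ev_unitCounit B (hi l h) (y l)
  · intro l q ν hν
    by_cases h : l = j
    · subst h
      simpa [sub_eq_add_neg] using α.mem _ hν
    · simpa [h] using unitCounit_mem _ hν
  · intro l h q hq ν hν
    rw [if_neg h]
    exact unitCounit_of_ne_zero _ hq hν

/-- Relabelling does not change the evaluation on the components of the decomposition. -/
theorem ev_conj (hψ : ψ ∈ homGr C.toDGModule B.toDGModule 0) {m n : ℕ} (σ : Fin m ≃ Fin n)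
    (X : Q.obj m →ₗ[K] P.obj m) (c : C) :
    B.ev (P.map σ ∘ₗ X ∘ₗ Q.map σ.symm) ψ (C.δ c n) = B.ev X ψ (C.δ c m) := by
  rw [← permute_δ σ c]
  refine LinearMap.congr_fun (g := B.ev X ψ ∘ₗ permute C σ) ?_ (C.δ c n)
  refine tensor_ext_homogeneous (X := Q.obj n) (Y := fun _ => C.toDGModule)
    fun p e μ y hμ hy => ?_
  rw [PAlgebra.ev_tmul, LinearMap.comp_apply (B.ev X ψ), permute_tprod σ hμ hy, map_smul,
    PAlgebra.ev_tmul]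
  exact B.op_map σ _ fun l => mem_of_mem_homGr_zero hψ (hy l)

end

/-- Summation along the antidiagonals n = k + l, which for n < b + m cover the rectangle outside
which G vanishes. -/
theorem sum_range_triangle {W : Type*} [AddCommMonoid W] (G : ℕ → ℕ → W) (b m : ℕ)
    (h₁ : ∀ k l, b ≤ k → G k l = 0) (h₂ : ∀ k l, m ≤ l → G k l = 0) :
    ∑ n ∈ Finset.range (b + m), ∑ k ∈ Finset.range (n + 1), G k (n - k) =
      ∑ k ∈ Finset.range b, ∑ l ∈ Finset.range m, G k l := by
  rw [← Finset.sum_product', ← Finset.sum_fiberwise_of_maps_to (t := Finset.range (b + m))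
    (g := fun p : ℕ × ℕ => p.1 + p.2)]
  · refine Finset.sum_congr rfl fun n _ => ?_
    rw [← Finset.Nat.sum_antidiagonal_eq_sum_range_succ G n]
    symm
    refine Finset.sum_subset (fun p hp => ?_) fun p hp hp' => ?_
    · exact Finset.HasAntidiagonal.mem_antidiagonal.2 (Finset.mem_filter.1 hp).2
    · by_cases h : p.1 < b
      · refine h₂ _ _ (not_lt.1 fun h' => hp' ?_)
        exact Finset.mem_filter.2 ⟨Finset.mem_product.2 ⟨Finset.mem_range.2 h,
          Finset.mem_range.2 h'⟩, Finset.HasAntidiagonal.mem_antidiagonal.1 hp⟩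
      · exact h₁ _ _ (not_lt.1 h)
  · intro p hp
    have := Finset.mem_product.1 hp
    simp only [Finset.mem_range] at this ⊢
    omega

section

variable {P : Operad K} {Q : Cooperad K} {α : OperadicTwisting Q P} {C : QCoalgebra Q}
  {B : PAlgebra P} {ψ : C.toDGModule →ₗ[K] B.toDGModule}

theorem ev_mem (hψ : ψ ∈ homGr C.toDGModule B.toDGModule 0) {n : ℕ} {g : ℤ}
    {t : Q.obj n ⊗[K] (⨂[K] _ : Fin n, C.toDGModule)}
    (ht : t ∈ tensorGr (Q.obj n) (fun _ => C.toDGModule) g) :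
    B.ev (α.toFun n) ψ t ∈ B.gr (g - 1) := by
  suffices h : tensorGr (Q.obj n) (fun _ => C.toDGModule) g ≤
      (B.gr (g - 1)).comap (B.ev (α.toFun n) ψ) from h ht
  refine Submodule.span_le.2 ?_
  rintro _ ⟨p, q, x, y, hx, hy, rfl, rfl⟩
  rw [SetLike.mem_coe, Submodule.mem_comap, PAlgebra.ev_tmul, add_sub_right_comm]
  exact B.op_mem (α.mem n hx) fun l => mem_of_mem_homGr_zero hψ (hy l)

theorem star_mem (hψ : ψ ∈ homGr C.toDGModule B.toDGModule 0) :
    star α C B ψ ∈ homGr C.toDGModule B.toDGModule (-1) := by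
  intro i c hc
  obtain ⟨b, hb⟩ := exists_bound (C.δ c)
  rw [star_eq, toModule_eq_sum _ _ hb]
  exact Submodule.sum_mem _ fun n _ => Submodule.smul_mem _ _ (ev_mem hψ (C.δ_mem n hc))

theorem map_star {B' : PAlgebra P} {f : B.toDGModule →ₗ[K] B'.toDGModule}
    (hf : ∀ {k : ℕ} (μ : P.obj k) (b : Fin k → B), f (B.op μ b) = B'.op μ fun l => f (b l))
    (c : C) : f (star α C B ψ c) = star α C B' (f ∘ₗ ψ) c := by
  obtain ⟨b, hb⟩ := exists_bound (C.δ c)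
  rw [star_eq, toModule_eq_sum _ _ hb, star_eq, toModule_eq_sum _ _ hb, map_sum]
  refine Finset.sum_congr rfl fun n _ => ?_
  rw [LinearMap.smul_apply, LinearMap.smul_apply, map_smul]
  congr 1
  have h : f ∘ₗ B.ev (α.toFun n) ψ = B'.ev (α.toFun n) (f ∘ₗ ψ) := by
    ext μ y
    simp [hf]
  exact LinearMap.congr_fun h _

/-- A labelling e differs from the lexicographic one by a permutation of the n inputs, which is
invisible after evaluation on an invariant (`ev_conj`). The value therefore does not depend on e. -/
theorem ev_convolution_term (hψ : ψ ∈ homGr C.toDGModule B.toDGModule 0) {n k m : ℕ}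
    (j : Fin (k + 1))
    (e : (Σ l : Fin (k + 1), Fin (Function.update (fun _ => 1) j m l)) ≃ Fin n) (c : C) :
    B.ev (P.map (finSigmaFinEquiv.symm.trans e) ∘ₗ P.compT _ ∘ₗ
        TensorProduct.map (α.toFun (k + 1) ∘ₗ (Q.obj (k + 1)).sgn 1)
          (PiTensorProduct.map fun l => if l = j then α.toFun _ else unitCounit Q P _) ∘ₗ
        Q.Δ (Function.update (fun _ => 1) j m) e) ψ (C.δ c n) =
      bracketAt α B.selfModule (-1) ψ (B.ev (α.toFun m) ψ ∘ₗ C.δn m) j (C.δ c (k + 1)) := by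
  have h1 : Q.Δ (Function.update (fun _ => 1) j m) e =
      Q.Δ (Function.update (fun _ => 1) j m) finSigmaFinEquiv ∘ₗ
        Q.map (finSigmaFinEquiv.symm.trans e).symm := by
    refine LinearMap.ext fun x => ?_
    have h := Q.Δ_map (Function.update (fun _ => 1) j m) finSigmaFinEquiv
      (finSigmaFinEquiv.symm.trans e) (Q.map (finSigmaFinEquiv.symm.trans e).symm x)
    rw [← Q.map_trans, Equiv.symm_trans_self, Q.map_refl, ← Equiv.trans_assoc,
      Equiv.self_trans_symm, Equiv.refl_trans] at h
    rw [h, LinearMap.comp_apply]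
  have h2 := ev_conj hψ (finSigmaFinEquiv.symm.trans e) (P.compT _ ∘ₗ
    TensorProduct.map (α.toFun (k + 1) ∘ₗ (Q.obj (k + 1)).sgn 1)
      (PiTensorProduct.map fun l => if l = j then α.toFun _ else unitCounit Q P _) ∘ₗ
    Q.Δ (Function.update (fun _ => 1) j m) finSigmaFinEquiv) c
  rw [ev_decompose hψ j fun l hl => Function.update_of_ne hl _ _] at h2
  rw [h1]
  refine Eq.trans ?_ (h2.trans ?_)
  · rfl
  · have h3 : Function.update (fun _ : Fin (k + 1) => 1) j m j = m := Function.update_self _ _ _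
    exact congrArg (fun m => bracketAt α B.selfModule (-1) ψ
      (B.ev (α.toFun m) ψ ∘ₗ C.δn m) j (C.δ c (k + 1))) h3

/-- There are n! labellings e, all with the same value, and they cancel the factor 1/n! of the norm
identification. -/
theorem ev_convolution [CharZero K] (hψ : ψ ∈ homGr C.toDGModule B.toDGModule 0) (n : ℕ) (c : C) :
    ((n.factorial : ℕ) : K)⁻¹ • B.ev (convolution Q P α.toFun α.toFun n) ψ (C.δ c n) =
      ∑ k ∈ Finset.range (n + 1), ((((k + 1).factorial : ℕ) : K)⁻¹ *
        (((n - k).factorial : ℕ) : K)⁻¹) • ∑ j : Fin (k + 1), bracketAt α B.selfModule (-1) ψ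
          (B.ev (α.toFun (n - k)) ψ ∘ₗ C.δn (n - k)) j (C.δ c (k + 1)) := by
  rw [convolution, B.ev_sum, LinearMap.sum_apply, Finset.smul_sum]
  refine Finset.sum_congr rfl fun k hk => ?_
  rw [B.ev_smul, B.ev_sum, LinearMap.smul_apply, LinearMap.sum_apply, smul_smul,
    Finset.smul_sum, Finset.smul_sum]
  refine Finset.sum_congr rfl fun j _ => ?_
  rw [B.ev_sum, LinearMap.sum_apply, Finset.sum_congr rfl fun e _ => ev_convolution_term hψ j e c,
    Finset.sum_const, Finset.card_univ]
  have hk' : k ≤ n := Nat.lt_succ_iff.1 (Finset.mem_range.1 hk)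
  -- k blocks of size 1 and one block of size n - k.
  have h1 : Fintype.card (Σ l : Fin (k + 1), Fin (Function.update (fun _ => 1) j (n - k) l)) =
      Fintype.card (Fin n) := by
    rw [Fintype.card_sigma]
    simp only [Fintype.card_fin]
    rw [Finset.sum_update_of_mem (Finset.mem_univ j)]
    simp [Finset.card_sdiff]
    omega
  rw [Fintype.card_equiv (Fintype.equivOfCardEq h1), h1, Fintype.card_fin,
    ← Nat.cast_smul_eq_nsmul K, smul_smul]
  congr 1
  have h2 : ((n.factorial : ℕ) : K) ≠ 0 := Nat.cast_ne_zero.2 n.factorial_ne_zero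
  rw [Nat.cast_mul]
  field_simp

/-- The sum that defines ⋆_α(ψ) is finite on each element only, so it cannot be taken out of the
bracket as a sum of maps. For a fixed tensor a bound on the arities exists: on a homogeneous pure
tensor it is that of the j-th letter, and bounds add under sums. -/
theorem exists_bracketAt_star_bound {n : ℕ} (j : Fin n)
    (t : Q.obj n ⊗[K] (⨂[K] _ : Fin n, C.toDGModule)) :
    ∃ b, (∀ m, b ≤ m → bracketAt α B.selfModule (-1) ψ (B.ev (α.toFun m) ψ ∘ₗ C.δn m) j t = 0) ∧
      ∀ b', b ≤ b' → bracketAt α B.selfModule (-1) ψ (star α C B ψ) j t =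
        ∑ m ∈ Finset.range b', ((m.factorial : ℕ) : K)⁻¹ •
          bracketAt α B.selfModule (-1) ψ (B.ev (α.toFun m) ψ ∘ₗ C.δn m) j t := by
  have ht : t ∈ Submodule.span K {t | ∃ (p : ℤ) (e : Fin n → ℤ) (μ : Q.obj n) (y : Fin n → C),
      μ ∈ (Q.obj n).gr p ∧ (∀ l, y l ∈ C.gr (e l)) ∧ t = μ ⊗ₜ PiTensorProduct.tprod K y} := by
    rw [span_tensor_homogeneous (X := Q.obj n) (Y := fun _ : Fin n => C.toDGModule)]
    trivial
  induction ht using Submodule.span_induction with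
  | zero => exact ⟨0, fun _ _ => map_zero _, fun _ _ => by simp⟩
  | add t t' _ _ h h' =>
    obtain ⟨b, h1, h2⟩ := h
    obtain ⟨b', h1', h2'⟩ := h'
    refine ⟨b + b', fun m hm => ?_, fun m hm => ?_⟩
    · rw [map_add, h1 m (by omega), h1' m (by omega), add_zero]
    · rw [map_add, h2 m (by omega), h2' m (by omega), ← Finset.sum_add_distrib]
      exact Finset.sum_congr rfl fun _ _ => by rw [map_add, smul_add]
  | smul r t _ h =>
    obtain ⟨b, h1, h2⟩ := h
    refine ⟨b, fun m hm => ?_, fun m hm => ?_⟩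
    · rw [map_smul, h1 m hm, smul_zero]
    · rw [map_smul, h2 m hm, Finset.smul_sum]
      exact Finset.sum_congr rfl fun _ _ => by rw [map_smul, smul_comm]
  | mem t ht =>
    obtain ⟨p, e, μ, y, hμ, hy, rfl⟩ := ht
    -- With the tensor fixed, the term depends on g linearly and only through g (y_j).
    have hL : ∃ L : B.carrier →ₗ[K] B.selfModule.toDGModule,
        ∀ g : C.toDGModule →ₗ[K] B.selfModule.toDGModule,
        bracketAt α B.selfModule (-1) ψ g j (μ ⊗ₜ PiTensorProduct.tprod K y) = L (g (y j)) :=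
      ⟨{ toFun := fun z => ksign K (-1 * (p + before e j)) •
            B.selfModule.act j (α.toFun n μ) z fun l => ψ (y l)
         map_add' := fun z z' => by rw [map_add, _root_.add_apply, smul_add]
         map_smul' := fun r z => by
          rw [map_smul, _root_.smul_apply, smul_comm]; rfl }, fun g => bracketAt_tprod j hμ hy⟩
    obtain ⟨L, hL⟩ := hL
    obtain ⟨b, hb⟩ := exists_bound (C.δ (y j))
    refine ⟨b, fun m hm => ?_, fun b' hb' => ?_⟩
    · refine (hL _).trans ?_
      have : (B.ev (α.toFun m) ψ ∘ₗ C.δn m) (y j) = 0 := by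
        rw [LinearMap.comp_apply, QCoalgebra.δn_apply, hb m hm, map_zero]
      exact (congrArg L this).trans (map_zero L)
    · have h : star α C B ψ (y j) = ∑ m ∈ Finset.range b', ((m.factorial : ℕ) : K)⁻¹ •
          (B.ev (α.toFun m) ψ ∘ₗ C.δn m) (y j) := by
        rw [star_eq, toModule_eq_sum _ _ fun n hn => hb n (hb'.trans hn)]
        rfl
      refine (hL _).trans ((congrArg L h).trans ?_)
      rw [map_sum]
      refine Finset.sum_congr rfl fun m _ => ?_
      rw [map_smul]
      exact congrArg _ (hL _).symm

/-- The sum `∑_n γ ∘ ((α ⋆ α) ∘ ψ) ∘ Δ_C(n)` is the bracket of `ψ` and `⋆_α(ψ)`. -/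
theorem bracket_star [CharZero K] (hψ : ψ ∈ homGr C.toDGModule B.toDGModule 0) (c : C) :
    bracket α B.selfModule (-1) ψ (star α C B ψ) c = DirectSum.toModule K ℕ B.toDGModule
      (fun n => ((n.factorial : ℕ) : K)⁻¹ • B.ev (convolution Q P α.toFun α.toFun n) ψ)
      (C.δ c) := by
  obtain ⟨b, hb⟩ := exists_bound (C.δ c)
  choose f hf₁ hf₂ using fun x : Σ n, Fin n =>
    exists_bracketAt_star_bound (α := α) (B := B) (ψ := ψ) x.2 (C.δ c x.1)
  -- A common bound for the arities of the upper vertex, over all root arities k + 1 ≤ b and all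
  -- positions.
  obtain ⟨m, hm⟩ : ∃ m, ∀ k, k < b → ∀ j : Fin (k + 1), f ⟨k + 1, j⟩ ≤ m :=
    ⟨∑ k ∈ Finset.range b, ∑ j : Fin (k + 1), f ⟨k + 1, j⟩, fun k hk j =>
      (Finset.single_le_sum (f := fun j : Fin (k + 1) => f ⟨k + 1, j⟩)
        (fun _ _ => Nat.zero_le _) (Finset.mem_univ j)).trans
      (Finset.single_le_sum (f := fun k => ∑ j : Fin (k + 1), f ⟨k + 1, j⟩)
        (fun _ _ => Nat.zero_le _) (Finset.mem_range.2 hk))⟩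
  -- The contribution of trees with k + 1 inputs at the root vertex and l at the upper one, hence
  -- with k + l leaves.
  let G : ℕ → ℕ → B.selfModule.carrier := fun k l => ((((k + 1).factorial : ℕ) : K)⁻¹ *
    ((l.factorial : ℕ) : K)⁻¹) • ∑ j : Fin (k + 1), bracketAt α B.selfModule (-1) ψ
      (B.ev (α.toFun l) ψ ∘ₗ C.δn l) j (C.δ c (k + 1))
  have h₁ : ∀ k l, b ≤ k → G k l = 0 := fun k l hk => by
    simp only [G]
    rw [hb (k + 1) (by omega), Finset.sum_eq_zero fun j _ => map_zero _, smul_zero]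
  have h₂ : ∀ k l, m ≤ l → G k l = 0 := fun k l hl => by
    by_cases hk : k < b
    · simp only [G]
      rw [Finset.sum_eq_zero fun j _ => hf₁ ⟨k + 1, j⟩ l ((hm k hk j).trans hl), smul_zero]
    · exact h₁ k l (not_lt.1 hk)
  have h₃ : bracket α B.selfModule (-1) ψ (star α C B ψ) c =
      ∑ k ∈ Finset.range b, ∑ l ∈ Finset.range m, G k l := by
    -- The range is enlarged by one so that the vanishing arity 0 can be split off, leaving the root
    -- arities k + 1 with k < b.
    rw [bracket, LinearMap.comp_apply, toModule_eq_sum _ _ (b := b + 1) fun n hn => hb n (by omega),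
      Finset.sum_range_succ', bracketTerm, LinearMap.zero_apply, add_zero]
    refine Finset.sum_congr rfl fun k hk => ?_
    rw [← sum_bracketAt (M := B.selfModule) hψ (star_mem hψ), Finset.sum_congr rfl fun j _ =>
      hf₂ ⟨k + 1, j⟩ m (hm k (Finset.mem_range.1 hk) j), Finset.sum_comm, Finset.smul_sum]
    refine Finset.sum_congr rfl fun l _ => ?_
    simp only [G]
    rw [← Finset.smul_sum, smul_smul]
  rw [h₃, ← sum_range_triangle G b m h₁ h₂,
    toModule_eq_sum _ _ (b := b + m) fun n hn => hb n (by omega)]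
  exact Finset.sum_congr rfl fun n _ => (ev_convolution hψ n c).symm

end

/-! ### The differential of ⋆_α -/

theorem tensorD_tprod {X : DGModule K} {n : ℕ} {Y : Fin n → DGModule K} {p : ℤ} {e : Fin n → ℤ}
    {x : X} {y : ∀ j, Y j} (hx : x ∈ X.gr p) (hy : ∀ j, y j ∈ (Y j).gr (e j)) :
    tensorD X Y (x ⊗ₜ PiTensorProduct.tprod K y) = X.d x ⊗ₜ PiTensorProduct.tprod K y +
      ∑ j, ksign K (p + before e j) •
        (x ⊗ₜ PiTensorProduct.tprod K (Function.update y j ((Y j).d (y j)))) := by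
  rw [tensorD, LinearMap.add_apply, TensorProduct.map_tmul, LinearMap.id_apply,
    LinearMap.sum_apply]
  congr 1
  refine Finset.sum_congr rfl fun j _ => ?_
  have h : (fun l => (if l < j then (Y l).sgn 1 else if l = j then (Y l).d else LinearMap.id) (y l))
      = fun l => ksign K (if l < j then e l else 0) • Function.update y j ((Y j).d (y j)) l := by
    funext l
    rcases lt_trichotomy l j with h | h | h
    · rw [if_pos h, if_pos h, DGModule.sgn_of_mem _ _ (hy l), Function.update_of_ne h.ne, one_mul]
    · subst h
      simp
    · rw [if_neg h.asymm, if_neg h.ne', if_neg h.asymm, Function.update_of_ne h.ne', ksign_zero,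
        one_smul, LinearMap.id_apply]
  rw [TensorProduct.map_tmul, PiTensorProduct.map_tprod, DGModule.sgn_of_mem _ _ hx, h,
    MultilinearMap.map_smul_univ, TensorProduct.tmul_smul, ← TensorProduct.smul_tmul', smul_smul,
    ← ksign_sum, before_eq, one_mul, ksign_add, mul_comm]

section

variable {P : Operad K} {Q : Cooperad K} {α : OperadicTwisting Q P} {C : QCoalgebra Q}
  {B : PAlgebra P} {ψ : C.toDGModule →ₗ[K] B.toDGModule}

/-- A differential on a letter appears twice, once behind α(μ) of degree p - 1 and once behind μ of
degree p, so these terms cancel; ψ commutes with differentials. What is left is ∂(α). -/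
theorem ev_tensorD (hψ : ψ ∈ homGr C.toDGModule B.toDGModule 0)
    (hd : ∀ c, B.d (ψ c) = ψ (C.d c)) (n : ℕ)
    (t : Q.obj n ⊗[K] (⨂[K] _ : Fin n, C.toDGModule)) :
    B.d (B.ev (α.toFun n) ψ t) +
      B.ev (α.toFun n) ψ (tensorD (Q.obj n) (fun _ => C.toDGModule) t) =
      B.ev (homD (Q.obj n) (P.obj n) (-1) (α.toFun n)) ψ t := by
  refine LinearMap.congr_fun (f := B.d ∘ₗ B.ev (α.toFun n) ψ +
    B.ev (α.toFun n) ψ ∘ₗ tensorD (Q.obj n) (fun _ => C.toDGModule)) ?_ t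
  refine tensor_ext_homogeneous (X := Q.obj n) (Y := fun _ => C.toDGModule)
    fun p e μ y hμ hy => ?_
  rw [LinearMap.add_apply, LinearMap.comp_apply, LinearMap.comp_apply, tensorD_tprod hμ hy,
    map_add, map_sum, PAlgebra.ev_tmul, PAlgebra.ev_tmul, PAlgebra.ev_tmul,
    B.op_d (α.mem n hμ) fun l => mem_of_mem_homGr_zero hψ (hy l), homD_apply, ksign_neg, ksign_one,
    neg_one_smul, sub_neg_eq_add, map_add, _root_.add_apply, add_add_add_comm]
  rw [add_eq_left, ← Finset.sum_add_distrib]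
  refine Finset.sum_eq_zero fun l _ => ?_
  have h : (fun m => ψ (Function.update y l (C.d (y l)) m)) =
      Function.update (fun m => ψ (y m)) l (B.d (ψ (y l))) := by
    funext m
    rw [hd]
    by_cases hm : m = l
    · subst hm; simp
    · simp [hm]
  rw [map_smul, PAlgebra.ev_tmul, h, ← add_smul, sub_add_eq_add_sub, ksign_sub_one]
  simp

theorem d_star (hψ : ψ ∈ homGr C.toDGModule B.toDGModule 0)
    (hd : ∀ c, B.d (ψ c) = ψ (C.d c)) (c : C) :
    B.d (star α C B ψ c) + star α C B ψ (C.d c) = DirectSum.toModule K ℕ B.toDGModule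
      (fun n => ((n.factorial : ℕ) : K)⁻¹ •
        B.ev (homD (Q.obj n) (P.obj n) (-1) (α.toFun n)) ψ) (C.δ c) := by
  obtain ⟨b, hb⟩ := exists_bound (C.δ c)
  have hb' : ∀ n, b ≤ n → C.δ (C.d c) n = 0 := fun n hn => by
    rw [C.δ_d, hb n hn, map_zero]
  rw [star_eq, star_eq, toModule_eq_sum _ _ hb, toModule_eq_sum _ _ hb', toModule_eq_sum _ _ hb,
    map_sum, ← Finset.sum_add_distrib]
  refine Finset.sum_congr rfl fun n _ => ?_
  rw [LinearMap.smul_apply, LinearMap.smul_apply, LinearMap.smul_apply, map_smul, ← smul_add,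
    C.δ_d, ev_tensorD hψ hd]

/-- `d(⋆_α ψ) + (⋆_α ψ) d + α[ψ, ⋆_α ψ] = 0` for `ψ` that commutes with the differentials. -/
theorem d_star_add_bracket [CharZero K] (hψ : ψ ∈ homGr C.toDGModule B.toDGModule 0)
    (hd : ∀ c, B.d (ψ c) = ψ (C.d c)) (c : C) :
    B.d (star α C B ψ c) + star α C B ψ (C.d c) +
      bracket α B.selfModule (-1) ψ (star α C B ψ) c = 0 := by
  rw [d_star hψ hd, bracket_star hψ, ← LinearMap.add_apply]
  obtain ⟨b, hb⟩ := exists_bound (C.δ c)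
  rw [LinearMap.add_apply, toModule_eq_sum _ _ hb, toModule_eq_sum _ _ hb,
    ← Finset.sum_add_distrib]
  refine Finset.sum_eq_zero fun n _ => ?_
  -- In each arity the sum is the Maurer–Cartan expression of α, evaluated.
  rw [LinearMap.smul_apply, LinearMap.smul_apply, ← smul_add, ← LinearMap.add_apply, ← B.ev_add,
    α.maurerCartan]
  have : B.ev (0 : Q.obj n →ₗ[K] P.obj n) ψ = 0 := by ext; simp
  rw [this, LinearMap.zero_apply, smul_zero]

end

/-! ### The quasi-free algebra -/

section Twist

variable {P : Operad K} (R : PAlgebra P)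

/-- A derivation of degree -1 along the identity has the signs of a differential and no term for the
operation, so subtracting it preserves the Leibniz rule. -/
theorem isLeibniz_sub_der {D : R.toDGModule →ₗ[K] R.selfModule.toDGModule}
    (hD : D ∈ der R (A := R) LinearMap.id R.selfModule (-1)) :
    IsLeibniz P R.gr R.op (R.d - D) := by
  intro k p e μ a hμ ha
  have h := hD.2 hμ ha
  rw [LinearMap.sub_apply, R.op_d hμ ha, h, add_sub_assoc, ← Finset.sum_sub_distrib]
  congr 1
  refine Finset.sum_congr rfl fun l _ => ?_
  have h1 := R.selfModule_act l μ (D (a l)) a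
  simp only [LinearMap.id_apply]
  rw [h1, neg_one_mul, ksign_neg, ← smul_sub, LinearMap.sub_apply, MultilinearMap.map_update_sub]

/-- The dg algebra with the differential changed by a derivation. -/
def PAlgebra.twist {D : R.carrier →ₗ[K] R.carrier}
    (hD : D ∈ der R (A := R) LinearMap.id R.selfModule (-1))
    (h : ∀ x, (R.d - D) ((R.d - D) x) = 0) : PAlgebra P where
  carrier := R.carrier
  gr := R.gr
  isInternal := R.isInternal
  d := R.d - D
  d_mem {i x} hx := Submodule.sub_mem _ (R.d_mem hx) (by
    have := hD.1 i x hx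
    rwa [← sub_eq_add_neg] at this)
  d_d := h
  op := R.op
  op_mem := R.op_mem
  op_d := isLeibniz_sub_der R hD
  op_one := R.op_one
  op_map := R.op_map
  op_comp := R.op_comp

end Twist

section

variable {P : Operad K} {Q : Cooperad K} {α : OperadicTwisting Q P} {C : QCoalgebra Q}

/-- On generators D(⋆_α(ι)) = -α[ι, ⋆_α(ι)] by `der_star`, so the square is minus the expression
that vanishes in `d_star_add_bracket`. `IsLeibniz.sq` extends this to all words. -/
theorem twist_sq_zero [CharZero K] {R : PAlgebra P} {ι : C.toDGModule →ₗ[K] R.toDGModule}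
    (hι : ι ∈ homGr C.toDGModule R.toDGModule 0) (hb : Function.Bijective (R.eval ι hι))
    (hd : ∀ c, R.d (ι c) = ι (C.d c)) {D : R.carrier →ₗ[K] R.carrier}
    (hD : D ∈ der R (A := R) LinearMap.id R.selfModule (-1)) (hDι : D ∘ₗ ι = star α C R ι)
    (x : R) : (R.d - D) ((R.d - D) x) = 0 := by
  have hDc : ∀ c, D (ι c) = star α C R ι c := fun c => LinearMap.congr_fun hDι c
  have hgen : ∀ c, (R.d - D) ((R.d - D) (ι c)) = 0 := fun c => by
    have h1 := der_star hD (f := LinearMap.id) (fun i x hx => by simpa using hx) hι c (α := α)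
    rw [LinearMap.id_comp, ksign_neg, ksign_one, neg_one_smul] at h1
    have h2 : bracket α R.selfModule (-1) ι (D ∘ₗ ι) c =
        bracket α R.selfModule (-1) ι (star α C R ι) c :=
      congrArg (fun g => bracket α R.selfModule (-1) ι g c) hDι
    have h3 := d_star_add_bracket (α := α) hι hd c
    have h4 : D (star α C R ι c) = -bracket α R.selfModule (-1) ι (star α C R ι) c :=
      h1.trans (congrArg Neg.neg h2)
    simp only [LinearMap.sub_apply, map_sub]
    rw [hd, hd, C.d_d, map_zero, hDc, hDc, h4, zero_sub, sub_neg_eq_add]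
    rw [← neg_eq_zero, ← h3]
    abel
  have hmem : ∀ {i : ℤ} {x : R.carrier}, x ∈ R.gr i → (R.d - D) x ∈ R.gr (i - 1) :=
    fun {i x} hx => Submodule.sub_mem _ (R.d_mem hx) (by
      have := hD.1 i x hx
      rwa [← sub_eq_add_neg] at this)
  suffices h : (R.d - D) ∘ₗ (R.d - D) = 0 from LinearMap.congr_fun h x
  refine free_ext hb fun p e μ v hμ hv => ?_
  have hsq := IsLeibniz.sq (isLeibniz_sub_der R hD) hmem hμ fun l =>
    mem_of_mem_homGr_zero hι (hv l)
  refine Eq.trans hsq ?_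
  refine Finset.sum_eq_zero fun l _ => ?_
  rw [hgen]
  exact MultilinearMap.map_update_zero _ _ _

theorem freeAlg_bijective [CharZero K] (V : DGModule K)
    (hι : schurIncl P V ∈ homGr V (freeAlg P V).toDGModule 0) :
    Function.Bijective ((freeAlg P V).eval (schurIncl P V) hι) := by
  have h : (freeAlg P V).eval (schurIncl P V) hι = LinearMap.id := by
    refine schur_ext fun p e μ v hμ hv => ?_
    exact ((freeAlg P V).eval_word _ hι μ v).trans (schurOp_incl μ v)
  rw [h]
  exact Function.bijective_id

/-- A graded algebra map from a free algebra that commutes with the differentials on generators is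
a morphism of dg algebras. -/
theorem isPAlgebraHom_of_generators {V : DGModule K} {R A : PAlgebra P}
    {ι : V →ₗ[K] R.toDGModule} {hι : ι ∈ homGr V R.toDGModule 0}
    (hb : Function.Bijective (R.eval ι hι)) {f : R.toDGModule →ₗ[K] A.toDGModule}
    (hf : f ∈ homGr R.toDGModule A.toDGModule 0)
    (hop : ∀ {k : ℕ} (μ : P.obj k) (b : Fin k → R), f (R.op μ b) = A.op μ fun l => f (b l))
    (hd : ∀ x, f (R.d (ι x)) = A.d (f (ι x))) : IsPAlgebraHom f := by
  refine ⟨hf, fun b => ?_, hop⟩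
  suffices h : f ∘ₗ R.d = A.d ∘ₗ f from LinearMap.congr_fun h b
  refine free_ext hb fun p e μ v hμ hv => ?_
  have hv' : ∀ l, ι (v l) ∈ R.gr (e l) := fun l => mem_of_mem_homGr_zero hι (hv l)
  rw [LinearMap.comp_apply, LinearMap.comp_apply, R.op_d hμ hv', hop, map_add, hop, map_sum,
    A.op_d hμ fun l => mem_of_mem_homGr_zero hf (hv' l)]
  congr 1
  refine Finset.sum_congr rfl fun l _ => ?_
  rw [map_smul, hop, ← hd]
  congr 2
  funext m
  by_cases hm : m = l
  · subst hm; simp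
  · simp [hm]

/-- The quasi-free algebra `P ∘_α C` and the extension of `φ`. -/
theorem exists_twistedComposite [CharZero K] {A : PAlgebra P} (φ : AlgebraicTwisting α C A) :
    ∃ (R : PAlgebra P) (ι : C.toDGModule →ₗ[K] R.toDGModule)
      (f : R.toDGModule →ₗ[K] A.toDGModule), IsTwistedComposite φ R ι f := by
  let R₀ := freeAlg P C.toDGModule
  let ι : C.toDGModule →ₗ[K] R₀.toDGModule := schurIncl P C.toDGModule
  have hι : ι ∈ homGr C.toDGModule R₀.toDGModule 0 := fun i x hx => by
    rw [add_zero]; exact schurIncl_mem hx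
  have hb : Function.Bijective (R₀.eval ι hι) := freeAlg_bijective _ hι
  obtain ⟨D, hD, hDι⟩ := exists_der hb (A := R₀) (f := LinearMap.id) (M := R₀.selfModule)
    (fun i x hx => by simpa using hx) (fun _ _ => rfl) (star_mem (α := α) hι)
  have hsq := twist_sq_zero hι hb schurD_incl hD hDι
  -- Only the differential changes, so the operations, ⋆_α and the bijectivity of the evaluation
  -- carry over definitionally.
  let R := R₀.twist hD hsq
  let ι' : C.toDGModule →ₗ[K] R.toDGModule := ι
  have hι' : ι' ∈ homGr C.toDGModule R.toDGModule 0 := hι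
  have hd : ∀ c, R.d (ι' c) = ι' (C.d c) - star α C R ι' c := fun c =>
    congrArg₂ (fun x y : R₀.carrier => x - y) (schurD_incl c) (LinearMap.congr_fun hDι c)
  have hb' : Function.Bijective (R.eval ι' hι') := hb
  obtain ⟨f, hf, hop, hfι⟩ := exists_free_lift hb' A φ.toFun φ.mem
  refine ⟨R, ι', f, hι', hb', hd, isPAlgebraHom_of_generators hb' hf hop fun c => ?_, hfι⟩
  -- The Maurer–Cartan equation of φ reads dφ = φd - ⋆_α(φ), which is the compatibility of f with
  -- the differentials on generators.
  have h1 := LinearMap.congr_fun φ.maurerCartan c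
  rw [LinearMap.add_apply, homD_apply, ksign_zero, one_smul, LinearMap.zero_apply] at h1
  have h2 : f ∘ₗ ι' = φ.toFun := LinearMap.ext hfι
  rw [hd, map_sub, map_star hop, h2, hfι, hfι, sub_eq_iff_eq_add, ← sub_eq_zero, ← neg_eq_zero,
    ← h1]
  abel

end

/-! ### Comparison of complexes by restriction -/

section Complexes

variable {X Y X' Y' : DGModule K} {H : ℤ → Submodule K (X →ₗ[K] Y)}
  {D : ℤ → (X →ₗ[K] Y) →ₗ[K] (X →ₗ[K] Y)} {H' : ℤ → Submodule K (X' →ₗ[K] Y')}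
  {D' : ℤ → (X' →ₗ[K] Y') →ₗ[K] (X' →ₗ[K] Y')}

/-- Levelwise isomorphisms that commute with the differentials give an isomorphism of complexes. -/
theorem IsDGFamily.exists_iso (h : IsDGFamily H D) (h' : IsDGFamily H' D')
    (e : ∀ n, H n ≃ₗ[K] H' n)
    (he : ∀ (n : ℤ) (f : H (n + 1)),
      (e n ⟨D (n + 1) f.1, h.map_mem n f.1 f.2⟩).1 = D' (n + 1) (e (n + 1) f).1) :
    ∃ E : h.complex ≅ h'.complex, (∀ (n : ℤ) (f : H n),
      (h'.equiv n).symm (E.hom.f n (h.equiv n f)) = e n f) ∧ ∀ (n : ℤ) (f : H' n),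
      (h.equiv n).symm (E.inv.f n (h'.equiv n f)) = (e n).symm f := by
  let F : ∀ n, h.complex.X n ≅ h'.complex.X n := fun n => LinearEquiv.toModuleIso (e n)
  refine ⟨HomologicalComplex.Hom.isoOfComponents F ?_, fun n f => rfl, fun n f => rfl⟩
  rintro i n hin
  obtain rfl : n + 1 = i := hin
  ext f
  have h1 := h.d_equiv n f
  have h2 := h'.d_equiv n (e (n + 1) f)
  change h'.complex.d (n + 1) n (h'.equiv (n + 1) (e (n + 1) f)) =
    (F n).hom (h.complex.d (n + 1) n (h.equiv (n + 1) f))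
  rw [h1, h2]
  exact Subtype.ext (he n f).symm

/-- If `H` restricts bijectively to `H'` along `ι` and the differentials correspond, then `H'` is
a dg module as well. -/
theorem IsDGFamily.of_restriction (h : IsDGFamily H D) {ι : X' →ₗ[K] X}
    {D'' : ℤ → (X' →ₗ[K] Y) →ₗ[K] (X' →ₗ[K] Y)} {H'' : ℤ → Submodule K (X' →ₗ[K] Y)}
    (hι : ∀ n, ∀ f ∈ H n, f ∘ₗ ι ∈ H'' n) (hs : ∀ n, ∀ g ∈ H'' n, ∃ f ∈ H n, f ∘ₗ ι = g)
    (hD : ∀ n, ∀ f ∈ H n, D n f ∘ₗ ι = D'' n (f ∘ₗ ι)) : IsDGFamily H'' D'' := by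
  refine ⟨fun n g hg => ?_, fun n g hg => ?_⟩
  · obtain ⟨f, hf, rfl⟩ := hs _ g hg
    rw [← hD _ f hf]
    exact hι _ _ (h.map_mem _ _ hf)
  · obtain ⟨f, hf, rfl⟩ := hs _ g hg
    rw [← hD _ f hf, ← hD _ _ (h.map_mem _ _ hf), h.sq_zero _ _ hf, LinearMap.zero_comp]

/-- The restriction along `ι`, if bijective. -/
theorem exists_restriction_equiv {ι : X' →ₗ[K] X} {H'' : ℤ → Submodule K (X' →ₗ[K] Y)}
    (hι : ∀ n, ∀ f ∈ H n, f ∘ₗ ι ∈ H'' n) (hs : ∀ n, ∀ g ∈ H'' n, ∃ f ∈ H n, f ∘ₗ ι = g)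
    (hi : ∀ n, ∀ f ∈ H n, ∀ f' ∈ H n, f ∘ₗ ι = f' ∘ₗ ι → f = f') (n : ℤ) :
    ∃ e : H n ≃ₗ[K] H'' n, ∀ f, (e f).1 = f.1 ∘ₗ ι :=
  ⟨LinearEquiv.ofBijective ((LinearMap.lcomp K Y ι).restrict (hι n)) <| by
    refine ⟨fun f f' h => Subtype.ext (hi n f.1 f.2 f'.1 f'.2 (congrArg Subtype.val h)),
      fun g => ?_⟩
    obtain ⟨f, hf, h⟩ := hs n g.1 g.2
    exact ⟨⟨f, hf⟩, Subtype.ext h⟩, fun f => rfl⟩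

end Complexes

section

variable {P : Operad K} {Q : Cooperad K} {α : OperadicTwisting Q P} {C : QCoalgebra Q}
  {A : PAlgebra P} {φ : AlgebraicTwisting α C A} {R : PAlgebra P} {ι : C.toDGModule →ₗ[K] R.toDGModule}
  {f : R.toDGModule →ₗ[K] A.toDGModule} (h : IsTwistedComposite φ R ι f) (M : AModule A)

include h

theorem IsTwistedComposite.comp_eq : f ∘ₗ ι = φ.toFun := LinearMap.ext h.augmentation_generator

variable {M}

/-- The differential of derivations corresponds to the twisted differential. -/
theorem IsTwistedComposite.homD_comp [CharZero K] {n : ℤ} {D : R.toDGModule →ₗ[K] M.toDGModule}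
    (hD : D ∈ der R f M n) :
    homD R.toDGModule M.toDGModule n D ∘ₗ ι = twistedD φ M n (D ∘ₗ ι) := by
  ext c
  have h1 := der_star (α := α) hD h.augmentation.mem h.mem c
  rw [h.comp_eq] at h1
  rw [LinearMap.comp_apply, homD_apply, h.d_generator, map_sub, h1, smul_sub, smul_smul,
    ksign_mul_self, one_smul, twistedD, LinearMap.add_apply, LinearMap.add_apply, homD_apply]
  simp only [LinearMap.comp_apply, bracketOp, LinearMap.coe_mk, AddHom.coe_mk]
  abel

theorem IsTwistedComposite.comp_mem (n : ℤ) (D : R.toDGModule →ₗ[K] M.toDGModule)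
    (hD : D ∈ der R f M n) : D ∘ₗ ι ∈ homGr C.toDGModule M.toDGModule n := fun _ _ hx =>
  hD.1 _ _ (mem_of_mem_homGr_zero h.mem hx)

theorem IsTwistedComposite.exists_der [CharZero K] (n : ℤ) (g : C.toDGModule →ₗ[K] M.toDGModule)
    (hg : g ∈ homGr C.toDGModule M.toDGModule n) : ∃ D ∈ der R f M n, D ∘ₗ ι = g :=
  DGOperad.exists_der h.bijective h.augmentation.mem h.augmentation.map_op hg

variable (M)

/-- `(Hom(C, M), ∂_φ)` is a dg module. -/
theorem IsTwistedComposite.isDGFamily [CharZero K] :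
    IsDGFamily (homGr C.toDGModule M.toDGModule) (twistedD φ M) :=
  (isDGFamily_der h.augmentation M).of_restriction h.comp_mem h.exists_der
    fun _ _ hD => h.homD_comp hD

end

/-- Any model of P ∘_α C suffices: every linear map on C is the restriction of a derivation, and ∂_φ
is the restricted differential, so it inherits its square and degree. -/
theorem isDGFamily_twistedD [CharZero K] {P : Operad K} {Q : Cooperad K}
    {α : OperadicTwisting Q P} {C : QCoalgebra Q} {A : PAlgebra P} (φ : AlgebraicTwisting α C A)
    (M : AModule A) : IsDGFamily (homGr C.toDGModule M.toDGModule) (twistedD φ M) := by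
  obtain ⟨R, ι, f, h⟩ := exists_twistedComposite φ
  exact h.isDGFamily M

/-! ### The free module as the part linear in C of the free algebra on A ⊕ C -/

/-- The direct sum of two dg modules. -/
def DGModule.prod [CharZero K] (X Y : DGModule K) : DGModule K where
  carrier := X × Y
  gr i := (X.gr i).prod (Y.gr i)
  isInternal := by
    obtain ⟨E, hE⟩ := X.exists_weight
    obtain ⟨E', hE'⟩ := Y.exists_weight
    refine isInternal_of_weight _ (E.prodMap E') (fun i x hx => ?_) ?_
    · rw [LinearMap.prodMap_apply, hE i _ hx.1, hE' i _ hx.2]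
      rfl
    · rw [eq_top_iff]
      have h1 : LinearMap.range (LinearMap.inl K X Y) ≤ ⨆ i, (X.gr i).prod (Y.gr i) := by
        rw [LinearMap.range_eq_map, ← X.span_homogeneous, Submodule.map_span, Submodule.span_le]
        rintro _ ⟨x, ⟨i, hx⟩, rfl⟩
        exact Submodule.mem_iSup_of_mem i ⟨hx, zero_mem _⟩
      have h2 : LinearMap.range (LinearMap.inr K X Y) ≤ ⨆ i, (X.gr i).prod (Y.gr i) := by
        rw [LinearMap.range_eq_map, ← Y.span_homogeneous, Submodule.map_span, Submodule.span_le]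
        rintro _ ⟨x, ⟨i, hx⟩, rfl⟩
        exact Submodule.mem_iSup_of_mem i ⟨zero_mem _, hx⟩
      rw [← LinearMap.sup_range_inl_inr]
      exact sup_le h1 h2
  d := X.d.prodMap Y.d
  d_mem hx := ⟨X.d_mem hx.1, Y.d_mem hx.2⟩
  d_d x := by ext <;> simp [X.d_d, Y.d_d]

/-- A partial composite, written as one operation. The vector of its arguments is a reordering of
the vectors `b` (without `b_t`) and `s`. -/
theorem exists_partial_comp {P : Operad K} {k n : ℕ} (t : Fin k) (ρ : P.obj k) {p : ℤ} {μ : P.obj n}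
    (hμ : μ ∈ (P.obj n).gr p) (e : Fin k → ℤ) (d : Fin n → ℤ) :
    ∃ (N : ℕ) (c : P.obj N) (f : Fin N → {l // l ≠ t} ⊕ Fin n),
      (∀ j, ∃ y₀, ∀ y, f y = Sum.inr j ↔ y = y₀) ∧
      ∀ (B : PAlgebra P) (b : Fin k → B) (s : Fin n → B), (∀ l, l ≠ t → b l ∈ B.gr (e l)) →
        (∀ l, s l ∈ B.gr (d l)) → B.op ρ (Function.update b t (B.op μ s)) =
          B.op c fun y => Sum.elim (fun l => b l.1) s (f y) := by
  -- Every argument of ρ is put in the form of an operation: μ at position t, the unit on the single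
  -- argument b_l elsewhere. The map g records which argument each input takes.
  have h : ∀ l : Fin k, ∃ (m : ℕ) (ν : P.obj m) (q : ℤ) (r : Fin m → ℤ)
      (g : Fin m → {l // l ≠ t} ⊕ Fin n), ν ∈ (P.obj m).gr q ∧
      (l ≠ t → ∀ y j, g y ≠ Sum.inr j) ∧
      (l = t → ∃ ε : Fin n ≃ Fin m, ∀ y, g y = Sum.inr (ε.symm y)) ∧
      ∀ (B : PAlgebra P) (b : Fin k → B) (s : Fin n → B), (∀ l, l ≠ t → b l ∈ B.gr (e l)) →
        (∀ l, s l ∈ B.gr (d l)) → (∀ y, Sum.elim (fun l => b l.1) s (g y) ∈ B.gr (r y)) ∧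
        Function.update b t (B.op μ s) l = B.op ν fun y => Sum.elim (fun l => b l.1) s (g y) := by
    intro l
    by_cases hl : l = t
    · subst hl
      exact ⟨n, μ, p, d, Sum.inr, hμ, fun h => absurd rfl h, fun _ => ⟨Equiv.refl _, fun _ => rfl⟩,
        fun B b s hb hs => ⟨hs, by simp⟩⟩
    · exact ⟨1, P.one, 0, fun _ => e l, fun _ => Sum.inl ⟨l, hl⟩, P.one_mem,
        fun _ _ _ => Sum.inl_ne_inr, fun h => absurd h hl,
        fun B b s hb hs => ⟨fun _ => hb l hl, by simp [hl, B.op_one]⟩⟩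
  choose i ν q r g hν hg₁ hg₂ hB using h
  -- The shuffle sign depends only on the degrees e, d and those of the operations, so it can be
  -- absorbed into the operation, which then serves all algebras and arguments.
  refine ⟨∑ l, i l, ksign K (shuffleExp q fun x => r x.1 x.2) • P.comp i ρ ν,
    fun y => g (finSigmaFinEquiv.symm y).1 (finSigmaFinEquiv.symm y).2, fun j => ?_, ?_⟩
  · obtain ⟨ε, hε⟩ := hg₂ t rfl
    refine ⟨finSigmaFinEquiv ⟨t, ε j⟩, fun y => ?_⟩
    obtain ⟨⟨l, z⟩, rfl⟩ := finSigmaFinEquiv.surjective y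
    have hz : g (finSigmaFinEquiv.symm (finSigmaFinEquiv (⟨l, z⟩ : Σ l, Fin (i l)))).1
        (finSigmaFinEquiv.symm (finSigmaFinEquiv ⟨l, z⟩)).2 = g l z :=
      congrArg (fun x : Σ l, Fin (i l) => g x.1 x.2) (Equiv.symm_apply_apply _ _)
    rw [Equiv.apply_eq_iff_eq]
    refine Iff.trans (Eq.to_iff (congrArg (· = Sum.inr j) hz)) ?_
    by_cases hl : l = t
    · subst hl
      rw [hε, Sum.inr.injEq, Equiv.symm_apply_eq]
      exact ⟨fun h => by rw [h], fun h => by simpa using h⟩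
    · refine ⟨fun h => absurd h (hg₁ l hl z j), fun h => absurd (congrArg Sigma.fst h) hl⟩
  · intro B b s hb hs
    have h1 := B.op_comp i ρ (r := fun x => r x.1 x.2)
      (a := fun x => Sum.elim (fun l => b l.1) s (g x.1 x.2)) hν fun x => (hB x.1 B b s hb hs).1 x.2
    rw [map_smul, _root_.smul_apply, h1, smul_smul, ksign_mul_self, one_smul]
    congr 1
    funext l
    exact (hB l B b s hb hs).2

section Extension

variable [CharZero K] {P : Operad K} (A : PAlgebra P) (C : DGModule K)

/-- The free algebra on `A ⊕ C` with the morphism to `A` that extends the projection, with the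
inclusions of `A` and `C`. -/
structure Extension where
  S : PAlgebra P
  ι : A.toDGModule.prod C →ₗ[K] S.toDGModule
  mem : ι ∈ homGr (A.toDGModule.prod C) S.toDGModule 0
  bijective : Function.Bijective (S.eval ι mem)
  γ : S.toDGModule →ₗ[K] A.toDGModule
  hom : IsPAlgebraHom γ
  γ_ι : ∀ v, γ (ι v) = v.1
  d_ι : ∀ v, S.d (ι v) = ι ((A.toDGModule.prod C).d v)

theorem nonempty_extension : Nonempty (Extension A C) := by
  let V := A.toDGModule.prod C
  have hι : schurIncl P V ∈ homGr V (freeAlg P V).toDGModule 0 := fun i x hx => by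
    rw [add_zero]; exact schurIncl_mem hx
  have hb := freeAlg_bijective V hι
  let pr : V →ₗ[K] A.toDGModule := LinearMap.fst K A.carrier C.carrier
  obtain ⟨γ, hγ, hop, hγι⟩ := exists_free_lift hb A pr fun i x hx => by
    rw [add_zero]; exact hx.1
  refine ⟨⟨freeAlg P V, schurIncl P V, hι, hb, γ, isPAlgebraHom_of_generators hb hγ hop
    fun x => ?_, hγι, schurD_incl⟩⟩
  exact (congrArg γ (schurD_incl x)).trans ((hγι _).trans (congrArg A.d (hγι x)).symm)

variable {A C} (X : Extension A C)

/-- The inclusion of `A`. -/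
def Extension.iA : A.toDGModule →ₗ[K] X.S.toDGModule :=
  X.ι ∘ₗ (LinearMap.inl K A.carrier C.carrier : A.carrier →ₗ[K] (A.toDGModule.prod C).carrier)

/-- The inclusion of `C`. -/
def Extension.iC : C →ₗ[K] X.S.toDGModule :=
  X.ι ∘ₗ (LinearMap.inr K A.carrier C.carrier : C.carrier →ₗ[K] (A.toDGModule.prod C).carrier)

theorem Extension.iA_mem {i : ℤ} {a : A} (ha : a ∈ A.gr i) : X.iA a ∈ X.S.gr i :=
  mem_of_mem_homGr_zero X.mem (x := (a, 0)) ⟨ha, zero_mem _⟩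

theorem Extension.iC_mem {i : ℤ} {c : C} (hc : c ∈ C.gr i) : X.iC c ∈ X.S.gr i :=
  mem_of_mem_homGr_zero X.mem (x := (0, c)) ⟨zero_mem _, hc⟩

@[simp] theorem Extension.γ_iA (a : A) : X.γ (X.iA a) = a := X.γ_ι _

@[simp] theorem Extension.γ_iC (c : C) : X.γ (X.iC c) = 0 := X.γ_ι _

theorem Extension.d_iA (a : A) : X.S.d (X.iA a) = X.iA (A.d a) :=
  (X.d_ι _).trans (congrArg X.ι (Prod.ext rfl (map_zero C.d)))

theorem Extension.d_iC (c : C) : X.S.d (X.iC c) = X.iC (C.d c) :=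
  (X.d_ι _).trans (congrArg X.ι (Prod.ext (map_zero A.d) rfl))

theorem Extension.γ_mem {i : ℤ} {s : X.S} (hs : s ∈ X.S.gr i) : X.γ s ∈ A.gr i :=
  mem_of_mem_homGr_zero X.hom.mem hs

end Extension

/-- The multilinear map `v ↦ B (g v_j) (f v_l)_{l ≠ j}`. -/
def insertAt {k : ℕ} {V W Y Z : Type*} [AddCommGroup V] [Module K V] [AddCommGroup W] [Module K W]
    [AddCommGroup Y] [Module K Y] [AddCommGroup Z] [Module K Z] (j : Fin k)
    (B : Y →ₗ[K] MultilinearMap K (fun _ : {l : Fin k // l ≠ j} => Z) W) (f : V →ₗ[K] Z)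
    (g : V →ₗ[K] Y) : MultilinearMap K (fun _ : Fin k => V) W :=
  have h₁ : ∀ (c : Fin k → V) (z : V), (fun t : {t : Fin k // t ≠ j} =>
      f (Function.update c j z t.1)) = fun t => f (c t.1) := fun c z => by
    funext t
    rw [Function.update_of_ne t.2]
  have h₂ : ∀ (c : Fin k → V) (l : Fin k) (h : l ≠ j) (z : V), (fun t : {t : Fin k // t ≠ j} =>
      f (Function.update c l z t.1)) =
        Function.update (fun t : {t : Fin k // t ≠ j} => f (c t.1)) ⟨l, h⟩ (f z) := fun c l h z => by
    funext t
    by_cases ht : t = ⟨l, h⟩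
    · subst ht; simp
    · rw [Function.update_of_ne ht, Function.update_of_ne]
      exact fun h2 => ht (Subtype.ext h2)
  { toFun := fun c => B (g (c j)) fun l => f (c l.1)
    map_update_add' := by
      intro inst c l x y
      obtain rfl : inst = instDecidableEqFin k := Subsingleton.elim _ _
      by_cases h : l = j
      · subst h
        simp [h₁]
      · simp [h₂ c l h, Function.update_of_ne (Ne.symm h)]
    map_update_smul' := by
      intro inst c l r x
      obtain rfl : inst = instDecidableEqFin k := Subsingleton.elim _ _
      by_cases h : l = j
      · subst h
        simp [h₁]
      · simp [h₂ c l h, Function.update_of_ne (Ne.symm h)] }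

section FreeModule

variable {P : Operad K} (A : PAlgebra P) (C : DGModule K)

/-- The class of `μ ⊗ a_1 ⊗ ⋯ ⊗ x ⊗ ⋯ ⊗ a_n` in the free module. -/
def freeMk {n : ℕ} (j : Fin n) : P.obj n →ₗ[K] C →ₗ[K]
    MultilinearMap K (fun _ : {l : Fin n // l ≠ j} => (A : Type u)) (FreeAModule A C) :=
  LinearMap.mk₂ K (fun μ x => (Submodule.mkQ _ ∘ₗ DirectSum.lof K (Σ n : ℕ, Fin n) (fun x =>
    P.obj x.1 ⊗[K] (C ⊗[K] (⨂[K] _ : {l : Fin x.1 // l ≠ x.2}, A.toDGModule))) ⟨n, j⟩ ∘ₗ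
      TensorProduct.mk K _ _ μ ∘ₗ TensorProduct.mk K _ _ x).compMultilinearMap
        (PiTensorProduct.tprod K))
    (fun μ μ' x => by ext a; simp) (fun r μ x => by ext a; simp)
    (fun μ x x' => by ext a; simp [TensorProduct.tmul_add])
    (fun r μ x => by ext a; simp)

variable {A C}

theorem freeMk_apply {n : ℕ} (j : Fin n) (μ : P.obj n) (x : C) (a : Fin n → A) :
    freeMk A C j μ x (fun l => a l) = Submodule.mkQ _ (freeWord A j μ x a) := by
  simp [freeMk, freeWord]

theorem freeMk_map {n : ℕ} (σ : Fin n ≃ Fin n) (j : Fin n) (μ : P.obj n) {e : Fin n → ℤ} {x : C}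
    {a : Fin n → A} (hx : x ∈ C.gr (e (σ j))) (ha : ∀ l, l ≠ σ j → a l ∈ A.gr (e l)) :
    freeMk A C (σ j) (P.map σ μ) x (fun l => a l) =
      ksign K (permExp σ e) • freeMk A C j μ x fun l => a (σ l) := by
  rw [freeMk_apply _ _ _ a, freeMk_apply _ _ _ fun l => a (σ l), ← map_smul, ← sub_eq_zero,
    ← map_sub, Submodule.mkQ_apply, Submodule.Quotient.mk_eq_zero]
  exact Submodule.subset_span (Or.inl ⟨n, σ, j, μ, e, x, a, hx, ha, rfl⟩)

theorem freeMk_comp {k : ℕ} (i : Fin k → ℕ) (j : Fin k) (hj : 1 = i j) (l₀ : Fin (i j))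
    (μ : P.obj k) {q : Fin k → ℤ} {ν : ∀ j, P.obj (i j)} {r : (Σ j, Fin (i j)) → ℤ} {x : C}
    {a : (Σ j, Fin (i j)) → A} (hν : ∀ j, ν j ∈ (P.obj (i j)).gr (q j))
    (hνj : ν j = P.map (finCongr hj) P.one) (hx : x ∈ C.gr (r ⟨j, l₀⟩))
    (ha : ∀ y, y ≠ ⟨j, l₀⟩ → a y ∈ A.gr (r y)) :
    freeMk A C (finSigmaFinEquiv ⟨j, l₀⟩) (P.comp i μ ν) x
        (fun y => a (finSigmaFinEquiv.symm (y : Fin (∑ j, i j)))) =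
      ksign K (shuffleExp q r) • freeMk A C j μ x fun j' => A.op (ν j') fun l => a ⟨j', l⟩ := by
  rw [freeMk_apply _ _ _ fun y => a (finSigmaFinEquiv.symm y),
    freeMk_apply _ _ _ fun j' => A.op (ν j') fun l => a ⟨j', l⟩, ← map_smul, ← sub_eq_zero,
    ← map_sub, Submodule.mkQ_apply, Submodule.Quotient.mk_eq_zero]
  exact Submodule.subset_span (Or.inr ⟨k, i, j, hj, l₀, μ, q, ν, r, x, a, hν, hνj, hx, ha, rfl⟩)

end FreeModule

section Extension

variable [CharZero K] {P : Operad K} {A : PAlgebra P} {C : DGModule K} (X : Extension A C)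

/-- The sum runs over the position of the letter from C, the other letters being projected to A. A
word without letters in C is killed, as is a word with two of them, since a letter of C projects to
0 in A. -/
theorem Extension.exists_κ : ∃ κ : X.S.toDGModule →ₗ[K] FreeAModule A C,
    ∀ {n : ℕ} (μ : P.obj n) (v : Fin n → A.toDGModule.prod C),
      κ (X.S.op μ fun l => X.ι (v l)) = ∑ j, freeMk A C j μ (v j).2 fun l => (v l).1 := by
  let V := A.toDGModule.prod C
  let T : ∀ {n : ℕ} (j : Fin n),
      P.obj n →ₗ[K] MultilinearMap K (fun _ : Fin n => (V : Type u)) (FreeAModule A C) := fun {n} j =>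
    { toFun := fun μ => insertAt j (freeMk A C j μ)
        (LinearMap.fst K A.carrier C.carrier : V.carrier →ₗ[K] A.carrier)
        (LinearMap.snd K A.carrier C.carrier : V.carrier →ₗ[K] C.carrier)
      map_add' := fun μ μ' => by ext v; simp [insertAt]
      map_smul' := fun r μ => by ext v; simp [insertAt] }
  have hT : ∀ {n : ℕ} (j : Fin n) (μ : P.obj n) (v : Fin n → V),
      T j μ v = freeMk A C j μ (v j).2 fun l => (v l).1 := fun j μ v => rfl
  obtain ⟨L, hL⟩ := exists_schur_lift (P := P) (V := V) (fun n p e => ∑ j, T j) (by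
    intro n σ p e μ v hμ hv
    simp only [LinearMap.sum_apply, _root_.sum_apply, hT]
    rw [← Equiv.sum_comp σ, Finset.smul_sum]
    refine Finset.sum_congr rfl fun j _ => ?_
    exact freeMk_map σ j μ (a := fun l => (v l).1) (hv (σ j)).2 fun l _ => (hv l).1)
  have hL' : ∀ {n : ℕ} (μ : P.obj n) (v : Fin n → V), L (word P V μ v) =
      ∑ j, freeMk A C j μ (v j).2 fun l => (v l).1 := fun {n} μ v => by
    have h : LinearMap.compMultilinearMapₗ K L ∘ₗ word P V (n := n) = ∑ j, T j := by
      refine DGModule.linearMap_ext fun p μ hμ => multilinear_ext_homogeneous fun e y hy => ?_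
      exact hL p e μ y hμ hy
    have h2 := congrArg (fun f => f v) (LinearMap.congr_fun h μ)
    simp only [LinearMap.sum_apply, _root_.sum_apply, hT] at h2
    exact h2
  let E := LinearEquiv.ofBijective (X.S.eval X.ι X.mem) X.bijective
  refine ⟨L ∘ₗ E.symm.toLinearMap, fun μ v => ?_⟩
  have h1 : E.symm (X.S.eval X.ι X.mem (word P V μ v)) = word P V μ v := E.symm_apply_apply _
  rw [X.S.eval_word] at h1
  rw [LinearMap.comp_apply, LinearEquiv.coe_coe, h1, hL']

/-- The projection to the free module: words with exactly one letter in `C` are kept. -/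
def Extension.κ : X.S.toDGModule →ₗ[K] FreeAModule A C := X.exists_κ.choose

theorem Extension.κ_word {n : ℕ} (μ : P.obj n) (v : Fin n → A.toDGModule.prod C) :
    X.κ (X.S.op μ fun l => X.ι (v l)) = ∑ j, freeMk A C j μ (v j).2 fun l => (v l).1 :=
  X.exists_κ.choose_spec μ v

/-- The other arguments matter only through their values in A. For words this is the coequalizer
relation, with the unit inserted at position j, and it extends to all homogeneous arguments by
multilinearity. -/
theorem Extension.κ_op {k : ℕ} (j : Fin k) (μ : P.obj k) {s : Fin k → X.S} {e : Fin k → ℤ}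
    (hs : ∀ l, l ≠ j → s l ∈ X.S.gr (e l)) {i₀ : ℤ} {x : C} (hx : x ∈ C.gr i₀) :
    X.κ (X.S.op μ (Function.update s j (X.iC x))) = freeMk A C j μ x fun l => X.γ (s l) := by
  have key := free_multilinear_eq X.bijective (e := fun l : {l // l ≠ j} => e l)
    (X.κ.compMultilinearMap (X.S.selfAct j μ (X.iC x)))
    ((freeMk A C j μ x).compLinearMap fun _ => X.γ) ?_ (b := fun l => s l) fun l => hs l l.2
  · rw [← X.S.selfAct_apply]
    exact key
  intro i q r ν v hν hv _
  -- The family indexed by the positions other than j is extended to all positions; the value 0 at j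
  -- is overwritten by x.
  let s' : Fin k → X.S := fun l =>
    if h : l ≠ j then X.S.op (ν ⟨l, h⟩) fun y => X.ι (v ⟨⟨l, h⟩, y⟩) else 0
  have hs' : (fun l : {l // l ≠ j} => s' l) = fun l => X.S.op (ν l) fun y => X.ι (v ⟨l, y⟩) :=
    funext fun l => dif_pos l.2
  rw [← hs', LinearMap.compMultilinearMap_apply, X.S.selfAct_apply,
    MultilinearMap.compLinearMap_apply]
  have h : ∀ l : Fin k, ∃ (n : ℕ) (ν : P.obj n) (q : ℤ) (r : Fin n → ℤ)
      (v : Fin n → A.toDGModule.prod C), ν ∈ (P.obj n).gr q ∧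
      (∀ y, v y ∈ (A.toDGModule.prod C).gr (r y)) ∧
      (Function.update s' j (X.iC x) l = X.S.op ν fun y => X.ι (v y)) ∧
      (l = j → ∃ hn : 1 = n, ν = P.map (finCongr hn) P.one ∧ ∀ y, v y = (0, x)) := by
    intro l
    by_cases hl : l = j
    · subst hl
      refine ⟨1, P.one, 0, fun _ => i₀, fun _ => (0, x), P.one_mem, fun _ => ⟨zero_mem _, hx⟩, ?_,
        fun _ => ⟨rfl, (P.map_refl _).symm, fun _ => rfl⟩⟩
      rw [Function.update_self, X.S.op_one]
      rfl
    · refine ⟨_, ν ⟨l, hl⟩, q ⟨l, hl⟩, fun y => r ⟨⟨l, hl⟩, y⟩, fun y => v ⟨⟨l, hl⟩, y⟩, hν _,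
        fun _ => hv _, ?_, fun h => absurd h hl⟩
      rw [Function.update_of_ne hl]
      exact dif_pos hl
  clear_value s'
  clear hs' hν hv
  choose i ν q r v hν hv hs' hj using h
  obtain ⟨hn, hνj, hvj⟩ := hj j rfl
  have h1 := X.S.op_comp i μ (r := fun y => r y.1 y.2) (a := fun y => X.ι (v y.1 y.2)) hν
    fun y => mem_of_mem_homGr_zero X.mem (hv y.1 y.2)
  rw [← funext hs'] at h1
  have h2 := congrArg X.κ h1
  rw [map_smul, X.κ_word _ fun y => v (finSigmaFinEquiv.symm y).1 (finSigmaFinEquiv.symm y).2] at h2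
  let l₀ : Fin (i j) := Fin.cast hn 0
  -- Choosing any other position for the letter of C leaves the A-component of (0, x), which is 0,
  -- among the remaining letters.
  have hne : ∀ y, y ≠ finSigmaFinEquiv (⟨j, l₀⟩ : Σ j, Fin (i j)) →
      (freeMk A C y (P.comp i μ ν) (v (finSigmaFinEquiv.symm y).1 (finSigmaFinEquiv.symm y).2).2
        fun l => (v (finSigmaFinEquiv.symm l.1).1 (finSigmaFinEquiv.symm l.1).2).1) = 0 := by
    intro y hy
    refine MultilinearMap.map_coord_zero _ ⟨finSigmaFinEquiv ⟨j, l₀⟩, hy.symm⟩ ?_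
    have h3 := congrArg (fun z : Σ j, Fin (i j) => (v z.1 z.2).1)
      (Equiv.symm_apply_apply finSigmaFinEquiv (⟨j, l₀⟩ : Σ j, Fin (i j)))
    exact h3.trans (congrArg Prod.fst (hvj l₀))
  rw [Finset.sum_eq_single_of_mem _ (Finset.mem_univ (finSigmaFinEquiv ⟨j, l₀⟩))
    fun y _ hy => hne y hy] at h2
  have h3 : (v (finSigmaFinEquiv.symm (finSigmaFinEquiv (⟨j, l₀⟩ : Σ j, Fin (i j)))).1
      (finSigmaFinEquiv.symm (finSigmaFinEquiv ⟨j, l₀⟩)).2).2 = x :=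
    (congrArg (fun z : Σ j, Fin (i j) => (v z.1 z.2).2)
      (Equiv.symm_apply_apply finSigmaFinEquiv (⟨j, l₀⟩ : Σ j, Fin (i j)))).trans
      (congrArg Prod.snd (hvj l₀))
  have hx' : x ∈ C.gr (r j l₀) := by
    have := (hv j l₀).2
    rwa [hvj l₀] at this
  rw [h3, freeMk_comp i j hn l₀ μ (r := fun y => r y.1 y.2) (a := fun y => (v y.1 y.2).1) hν hνj hx'
    fun y _ => (hv y.1 y.2).1] at h2
  rw [← smul_right_injective _ (ksign_ne_zero (K := K) _) h2]
  congr 1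
  funext l
  have h4 := congrArg X.γ (hs' l)
  rw [X.hom.map_op, Function.update_of_ne l.2] at h4
  rw [h4]
  simp only [X.γ_ι]

end Extension

theorem freeRaw_ext {P : Operad K} {A : PAlgebra P} {C : DGModule K} {W : Type*} [AddCommGroup W]
    [Module K W] {f g : FreeRaw A C →ₗ[K] W}
    (h : ∀ {n : ℕ} (j : Fin n) (p : ℤ) (e : Fin n → ℤ) (μ : P.obj n) (x : C) (a : Fin n → A),
      μ ∈ (P.obj n).gr p → x ∈ C.gr (e j) → (∀ l, a l ∈ A.gr (e l)) →
      f (freeWord A j μ x a) = g (freeWord A j μ x a)) : f = g := by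
  refine DirectSum.linearMap_ext K fun y => TensorProduct.ext ?_
  refine DGModule.linearMap_ext fun p μ hμ => TensorProduct.ext ?_
  refine DGModule.linearMap_ext fun i x hx => PiTensorProduct.ext ?_
  refine multilinear_ext_homogeneous (Y := fun _ => A.toDGModule) fun e a ha => ?_
  have h2 : (fun l : {l // l ≠ y.2} => if hl : (l : Fin y.1) ≠ y.2 then a ⟨l, hl⟩ else 0) = a :=
    funext fun l => dif_pos l.2
  have h1 := h y.2 p (fun l => if hl : l ≠ y.2 then e ⟨l, hl⟩ else i) μ x
    (fun l => if hl : l ≠ y.2 then a ⟨l, hl⟩ else 0) hμ (by simpa using hx) fun l => by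
      by_cases hl : l ≠ y.2
      · rw [dif_pos hl, dif_pos hl]; exact ha _
      · rw [dif_neg hl, dif_neg hl]; exact zero_mem _
  rw [freeWord, h2] at h1
  exact h1

section Extension

variable [CharZero K] {P : Operad K} {A : PAlgebra P} {C : DGModule K} (X : Extension A C)

/-- The nested operation is a single one with x at one input (`exists_partial_comp`), so `κ_op`
applies; replacing arguments by their images in A does not change their values under γ. -/
theorem Extension.κ_op_op {k n : ℕ} (t : Fin k) (j : Fin n) (ρ : P.obj k) {p : ℤ} {μ : P.obj n}
    (hμ : μ ∈ (P.obj n).gr p) {b : Fin k → X.S} {e : Fin k → ℤ}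
    (hb : ∀ l, l ≠ t → b l ∈ X.S.gr (e l)) {s : Fin n → X.S} {d : Fin n → ℤ}
    (hs : ∀ l, l ≠ j → s l ∈ X.S.gr (d l)) {x : C} (hx : x ∈ C.gr (d j)) :
    X.κ (X.S.op ρ (Function.update b t (X.S.op μ (Function.update s j (X.iC x))))) =
      X.κ (X.S.op ρ (Function.update (fun l => X.iA (X.γ (b l))) t
        (X.S.op μ (Function.update (fun l => X.iA (X.γ (s l))) j (X.iC x))))) := by
  obtain ⟨N, c, f, hf, hc⟩ := exists_partial_comp t ρ hμ e d
  obtain ⟨y₀, hy₀⟩ := hf j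
  have h1 : ∀ (b : Fin k → X.S) (s : Fin n → X.S),
      (fun y => Sum.elim (fun l : {l // l ≠ t} => b l.1) (Function.update s j (X.iC x)) (f y)) =
        Function.update (fun y => Sum.elim (fun l : {l // l ≠ t} => b l.1) s (f y)) y₀ (X.iC x) := by
    intro b s
    funext y
    by_cases hy : y = y₀
    · rw [hy, (hy₀ y₀).2 rfl, Function.update_self, Sum.elim_inr, Function.update_self]
    · rw [Function.update_of_ne hy]
      rcases hfy : f y with l | l
      · rfl
      · rw [Sum.elim_inr, Sum.elim_inr, Function.update_of_ne]
        rintro rfl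
        exact hy ((hy₀ y).1 hfy)
  have h2 : ∀ (b : Fin k → X.S) (s : Fin n → X.S), (∀ l, l ≠ t → b l ∈ X.S.gr (e l)) →
      (∀ l, l ≠ j → s l ∈ X.S.gr (d l)) → ∀ y, y ≠ y₀ →
      Sum.elim (fun l : {l // l ≠ t} => b l.1) s (f y) ∈
        X.S.gr (Sum.elim (fun l : {l // l ≠ t} => e l.1) d (f y)) := by
    intro b s hb hs y hy
    rcases hfy : f y with l | l
    · exact hb l l.2
    · refine hs l ?_
      rintro rfl
      exact hy ((hy₀ y).1 hfy)
  have h3 : ∀ (b : Fin k → X.S) (s : Fin n → X.S), (∀ l, l ≠ t → b l ∈ X.S.gr (e l)) →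
      (∀ l, l ≠ j → s l ∈ X.S.gr (d l)) →
      X.κ (X.S.op ρ (Function.update b t (X.S.op μ (Function.update s j (X.iC x))))) =
        freeMk A C y₀ c x fun y => X.γ (Sum.elim (fun l : {l // l ≠ t} => b l.1) s (f y)) := by
    intro b s hb hs
    rw [hc X.S b _ hb (mem_update' hs (X.iC_mem hx)), h1, X.κ_op y₀ c (h2 b s hb hs) hx]
  rw [h3 b s hb hs, h3 _ _ (fun l hl => X.iA_mem (X.γ_mem (hb l hl)))
    fun l hl => X.iA_mem (X.γ_mem (hs l hl))]
  congr 1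
  funext y
  rcases f y with l | l <;> simp

/-- The inclusion of `P(A, C)`, before passage to coinvariants, in the free algebra. -/
def Extension.J : FreeRaw A C →ₗ[K] X.S.toDGModule :=
  DirectSum.toModule K (Σ n : ℕ, Fin n) X.S.toDGModule fun y =>
    TensorProduct.lift (PiTensorProduct.lift.toLinearMap ∘ₗ TensorProduct.lift (X.S.selfAct y.2)) ∘ₗ
      TensorProduct.map (TensorProduct.map LinearMap.id X.iC)
        (PiTensorProduct.map fun _ => X.iA) ∘ₗ
        (TensorProduct.assoc K _ _ _).symm.toLinearMap

theorem Extension.J_word {n : ℕ} (j : Fin n) (μ : P.obj n) (x : C) (a : Fin n → A) :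
    X.J (freeWord A j μ x a) =
      X.S.op μ (Function.update (fun l => X.iA (a l)) j (X.iC x)) := by
  rw [← X.S.selfAct_apply]
  simp [Extension.J, freeWord]

theorem Extension.κ_J (z : FreeRaw A C) : X.κ (X.J z) = Submodule.mkQ _ z := by
  suffices h : X.κ ∘ₗ X.J = Submodule.mkQ _ from LinearMap.congr_fun h z
  refine freeRaw_ext fun j p e μ x a hμ hx ha => ?_
  rw [LinearMap.comp_apply, X.J_word, X.κ_op j μ (fun l _ => X.iA_mem (ha l)) hx, ← freeMk_apply]
  simp

/-- The equivariance relations already hold in S. The hypothesis on G takes care of the coequalizer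
relations: it allows an argument γ_S(ν; a, …) to be replaced by the letter γ_A(ν; a, …). -/
theorem Extension.exists_linearMap_mkQ {W : Type*} [AddCommGroup W] [Module K W]
    (G : X.S.toDGModule →ₗ[K] W)
    (hG : ∀ {k : ℕ} (j : Fin k) (p : ℤ) (μ : P.obj k) (e : Fin k → ℤ) (s : Fin k → X.S) (x : C),
      μ ∈ (P.obj k).gr p → (∀ l, l ≠ j → s l ∈ X.S.gr (e l)) → x ∈ C.gr (e j) →
      G (X.S.op μ (Function.update s j (X.iC x))) =
        G (X.S.op μ (Function.update (fun l => X.iA (X.γ (s l))) j (X.iC x)))) :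
    ∃ L : FreeAModule A C →ₗ[K] W, ∀ z, L (Submodule.mkQ _ z) = G (X.J z) := by
  have hG' : ∀ {k : ℕ} (j : Fin k) (μ : P.obj k) (e : Fin k → ℤ) (s : Fin k → X.S) (x : C),
      (∀ l, l ≠ j → s l ∈ X.S.gr (e l)) → x ∈ C.gr (e j) →
      G (X.S.op μ (Function.update s j (X.iC x))) =
        G (X.S.op μ (Function.update (fun l => X.iA (X.γ (s l))) j (X.iC x))) := by
    intro k j μ e s x hs hx
    have hμ : μ ∈ Submodule.span K {μ | ∃ p, μ ∈ (P.obj k).gr p} := by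
      rw [DGModule.span_homogeneous]; trivial
    induction hμ using Submodule.span_induction with
    | zero => simp
    | add μ μ' _ _ h h' => simp [h, h']
    | smul r μ _ h => simp [h]
    | mem μ hμ =>
      obtain ⟨p, hμ⟩ := hμ
      exact hG j p μ e s x hμ hs hx
  refine ⟨Submodule.liftQ _ (G ∘ₗ X.J) ?_, fun z => rfl⟩
  rw [Submodule.span_le]
  rintro _ (⟨n, σ, j, μ, e, x, a, hx, ha, rfl⟩ |
    ⟨k, i, j, hj, l₀, μ, q, ν, r, x, a, hν, hνj, hx, ha, rfl⟩)
  · have h1 := X.S.selfModule.act_map σ j μ (a := fun l => X.iA (a l)) (X.iC_mem hx)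
      fun l hl => X.iA_mem (ha l hl)
    rw [X.S.selfModule_act _ _ _ fun l => X.iA (a l),
      X.S.selfModule_act _ _ _ fun l => X.iA (a (σ l))] at h1
    simp only [SetLike.mem_coe, LinearMap.mem_ker, map_sub, map_smul, LinearMap.comp_apply,
      X.J_word]
    rw [h1, map_smul, sub_self]
  · have h1 := X.S.selfModule.act_comp i j l₀ μ (a := fun y => X.iA (a y)) hν (X.iC_mem hx)
      fun l hl => X.iA_mem (ha l hl)
    rw [X.S.selfModule_act _ _ _ fun y => X.iA (a (finSigmaFinEquiv.symm y)), hνj,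
      X.S.selfModule.act_unit hj,
      X.S.selfModule_act _ _ _ fun j' => X.S.op (ν j') fun l => X.iA (a ⟨j', l⟩)] at h1
    simp only [SetLike.mem_coe, LinearMap.mem_ker, map_sub, map_smul, LinearMap.comp_apply,
      X.J_word]
    have h2 : ∀ l, l ≠ j → X.S.op (ν l) (fun y => X.iA (a ⟨l, y⟩)) ∈
        X.S.gr (Function.update (fun l => q l + ∑ y, r ⟨l, y⟩) j (r ⟨j, l₀⟩) l) := fun l hl => by
      rw [Function.update_of_ne hl]
      exact X.S.op_mem (hν l) fun y => X.iA_mem (ha _ fun h => hl (congrArg Sigma.fst h))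
    rw [h1, map_smul, hG' j μ (Function.update (fun l => q l + ∑ y, r ⟨l, y⟩) j (r ⟨j, l₀⟩)) _ x h2
      (by simpa using hx), sub_eq_zero]
    simp [X.hom.map_op]

end Extension

section Extension

variable [CharZero K] {P : Operad K} {A : PAlgebra P} {C : DGModule K} (X : Extension A C)

theorem Extension.range_J_le {Q : Submodule K X.S}
    (h : ∀ {n : ℕ} (j : Fin n) (p : ℤ) (e : Fin n → ℤ) (μ : P.obj n) (x : C) (a : Fin n → A),
      μ ∈ (P.obj n).gr p → x ∈ C.gr (e j) → (∀ l, a l ∈ A.gr (e l)) →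
      X.S.op μ (Function.update (fun l => X.iA (a l)) j (X.iC x)) ∈ Q) :
    LinearMap.range X.J ≤ Q := by
  have h1 : Q.mkQ ∘ₗ X.J = 0 := freeRaw_ext fun j p e μ x a hμ hx ha => by
    have := h j p e μ x a hμ hx ha
    simpa [X.J_word] using this
  rintro _ ⟨z, rfl⟩
  have := LinearMap.congr_fun h1 z
  simpa using this

theorem Extension.word_mem_range {n : ℕ} (j : Fin n) (μ : P.obj n) (x : C) (a : Fin n → A) :
    X.S.op μ (Function.update (fun l => X.iA (a l)) j (X.iC x)) ∈ LinearMap.range X.J :=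
  ⟨_, X.J_word j μ x a⟩

theorem Extension.iC_mem_range (x : C) : X.iC x ∈ LinearMap.range X.J := by
  have h := X.word_mem_range 0 P.one x fun _ => 0
  rwa [show Function.update (fun _ : Fin 1 => X.iA 0) 0 (X.iC x) = fun _ => X.iC x from
    funext fun l => by rw [Subsingleton.elim l 0, Function.update_self], X.S.op_one] at h

/-- An operation applied to letters of A and one word linear in C is again, after flattening by
`exists_partial_comp`, a word with one letter in C. -/
theorem Extension.op_mem_range {k : ℕ} (t : Fin k) (ρ : P.obj k) {e : Fin k → ℤ} {b : Fin k → A}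
    (hb : ∀ l, l ≠ t → b l ∈ A.gr (e l)) {s : X.S} (hs : s ∈ LinearMap.range X.J) :
    X.S.op ρ (Function.update (fun l => X.iA (b l)) t s) ∈ LinearMap.range X.J := by
  suffices h : LinearMap.range X.J ≤
      (LinearMap.range X.J).comap ((X.S.op ρ).toLinearMap (fun l => X.iA (b l)) t) from h hs
  refine X.range_J_le fun j p d μ x a hμ hx ha => ?_
  obtain ⟨N, c, f, hf, hc⟩ := exists_partial_comp t ρ hμ e d
  obtain ⟨y₀, hy₀⟩ := hf j
  rw [Submodule.mem_comap, MultilinearMap.toLinearMap_apply,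
    hc X.S _ _ (fun l hl => X.iA_mem (hb l hl)) (mem_update' (fun l _ => X.iA_mem (ha l))
      (X.iC_mem hx))]
  convert X.word_mem_range y₀ c x fun y => Sum.elim (fun l : {l // l ≠ t} => b l.1) a (f y) using 2
  funext y
  by_cases hy : y = y₀
  · rw [hy, (hy₀ y₀).2 rfl, Function.update_self, Sum.elim_inr, Function.update_self]
  · rw [Function.update_of_ne hy]
    rcases hfy : f y with l | l
    · rfl
    · rw [Sum.elim_inr, Sum.elim_inr, Function.update_of_ne]
      rintro rfl
      exact hy ((hy₀ y).1 hfy)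

theorem Extension.κ_op_of_mem {k : ℕ} (t : Fin k) (ρ : P.obj k) {e : Fin k → ℤ} {b : Fin k → X.S}
    (hb : ∀ l, l ≠ t → b l ∈ X.S.gr (e l)) {s : X.S} (hs : s ∈ LinearMap.range X.J) :
    X.κ (X.S.op ρ (Function.update b t s)) =
      X.κ (X.S.op ρ (Function.update (fun l => X.iA (X.γ (b l))) t s)) := by
  suffices h : LinearMap.range X.J ≤ LinearMap.eqLocus (X.κ ∘ₗ (X.S.op ρ).toLinearMap b t)
      (X.κ ∘ₗ (X.S.op ρ).toLinearMap (fun l => X.iA (X.γ (b l))) t) from h hs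
  refine X.range_J_le fun j p d μ x a hμ hx ha => ?_
  rw [LinearMap.mem_eqLocus, LinearMap.comp_apply, LinearMap.comp_apply,
    MultilinearMap.toLinearMap_apply, MultilinearMap.toLinearMap_apply,
    X.κ_op_op t j ρ hμ hb (fun l _ => X.iA_mem (ha l)) hx,
    X.κ_op_op t j ρ hμ (fun l hl => X.iA_mem (X.γ_mem (hb l hl))) (fun l _ => X.iA_mem (ha l)) hx]
  simp

theorem Extension.κ_congr {k : ℕ} (j : Fin k) (μ : P.obj k) {s s' : Fin k → X.S} {e e' : Fin k → ℤ}
    (hs : ∀ l, l ≠ j → s l ∈ X.S.gr (e l)) (hs' : ∀ l, l ≠ j → s' l ∈ X.S.gr (e' l))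
    (h : ∀ l, l ≠ j → X.γ (s l) = X.γ (s' l)) {i₀ : ℤ} {x : C} (hx : x ∈ C.gr i₀) :
    X.κ (X.S.op μ (Function.update s j (X.iC x))) =
      X.κ (X.S.op μ (Function.update s' j (X.iC x))) := by
  rw [X.κ_op j μ hs hx, X.κ_op j μ hs' hx]
  congr 1
  exact funext fun l => h l l.2

/-- The differential of a word. -/
theorem Extension.d_op {k : ℕ} (j : Fin k) {p : ℤ} {μ : P.obj k} {e : Fin k → ℤ} {s : Fin k → X.S}
    {x : C} (hμ : μ ∈ (P.obj k).gr p) (hs : ∀ l, l ≠ j → s l ∈ X.S.gr (e l))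
    (hx : x ∈ C.gr (e j)) :
    X.S.d (X.S.op μ (Function.update s j (X.iC x))) =
      X.S.op ((P.obj k).d μ) (Function.update s j (X.iC x)) +
      ∑ l, ksign K (p + before e l) • (if l = j then X.S.op μ (Function.update s j (X.iC (C.d x)))
        else X.S.op μ (Function.update (Function.update s l (X.S.d (s l))) j (X.iC x))) := by
  rw [X.S.op_d hμ (mem_update' hs (X.iC_mem hx))]
  congr 1
  refine Finset.sum_congr rfl fun l _ => ?_
  congr 1
  split_ifs with h
  · subst h
    rw [Function.update_self, Function.update_idem, X.d_iC]
  · rw [Function.update_of_ne h, Function.update_comm h]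

theorem Extension.d_mem_range {s : X.S} (hs : s ∈ LinearMap.range X.J) :
    X.S.d s ∈ LinearMap.range X.J := by
  suffices h : LinearMap.range X.J ≤ (LinearMap.range X.J).comap X.S.d from h hs
  refine X.range_J_le fun j p d μ x a hμ hx ha => ?_
  rw [Submodule.mem_comap, X.d_op j hμ (fun l _ => X.iA_mem (ha l)) hx]
  refine add_mem (X.word_mem_range _ _ _ _) (Submodule.sum_mem _ fun l _ =>
    Submodule.smul_mem _ _ ?_)
  split_ifs with h
  · exact X.word_mem_range _ _ _ _
  · convert X.word_mem_range j μ x (Function.update a l (A.d (a l))) using 3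
    funext l'
    by_cases h' : l' = l
    · subst h'; simp [X.d_iA]
    · simp [h']

/-- Maps on the free algebra descend to the free module if they respect the relations. -/
theorem Extension.exists_descend {W : Type*} [AddCommGroup W] [Module K W]
    (G : X.S.toDGModule →ₗ[K] W)
    (hG : ∀ {k : ℕ} (j : Fin k) (p : ℤ) (μ : P.obj k) (e : Fin k → ℤ) (s : Fin k → X.S) (x : C),
      μ ∈ (P.obj k).gr p → (∀ l, l ≠ j → s l ∈ X.S.gr (e l)) → x ∈ C.gr (e j) →
      G (X.S.op μ (Function.update s j (X.iC x))) =
        G (X.S.op μ (Function.update (fun l => X.iA (X.γ (s l))) j (X.iC x)))) :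
    ∃ L : FreeAModule A C →ₗ[K] W, ∀ s ∈ LinearMap.range X.J, L (X.κ s) = G s := by
  obtain ⟨L, hL⟩ := X.exists_linearMap_mkQ G hG
  refine ⟨L, ?_⟩
  rintro _ ⟨z, rfl⟩
  rw [X.κ_J, hL]

theorem Extension.exists_κ_eq (w : FreeAModule A C) : ∃ s ∈ LinearMap.range X.J, X.κ s = w := by
  obtain ⟨z, rfl⟩ := Submodule.mkQ_surjective _ w
  exact ⟨X.J z, ⟨z, rfl⟩, X.κ_J z⟩

/-- Each term of the differential of a word keeps x or d x at position j, and γ commutes with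
differentials, so the values of the other arguments in A still agree. -/
theorem Extension.exists_freeD : ∃ D : FreeAModule A C →ₗ[K] FreeAModule A C,
    ∀ s ∈ LinearMap.range X.J, D (X.κ s) = X.κ (X.S.d s) := by
  refine X.exists_descend (X.κ ∘ₗ X.S.d) fun j p μ e s x hμ hs hx => ?_
  have hs' : ∀ l, l ≠ j → X.iA (X.γ (s l)) ∈ X.S.gr (e l) := fun l hl => X.iA_mem (X.γ_mem (hs l hl))
  have hu : ∀ (s : Fin _ → X.S), (∀ l, l ≠ j → s l ∈ X.S.gr (e l)) → ∀ l, l ≠ j → ∀ l', l' ≠ j →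
      Function.update s l (X.S.d (s l)) l' ∈ X.S.gr ((e + Pi.single l (-1) : Fin _ → ℤ) l') := by
    intro s hs l hl l' hl'
    by_cases h : l' = l
    · subst h; simpa [sub_eq_add_neg] using X.S.d_mem (hs l' hl')
    · simpa [h] using hs l' hl'
  rw [LinearMap.comp_apply, LinearMap.comp_apply, X.d_op j hμ hs hx, X.d_op j hμ hs' hx, map_add,
    map_add, map_sum, map_sum]
  congr 1
  · exact X.κ_congr j _ hs hs' (fun l _ => by simp) hx
  · refine Finset.sum_congr rfl fun l _ => ?_
    rw [map_smul, map_smul]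
    congr 1
    split_ifs with h
    · exact X.κ_congr j _ hs hs' (fun l _ => by simp) (C.d_mem hx)
    · refine X.κ_congr j _ (hu s hs l h) (hu _ hs' l h) (fun l' _ => ?_) hx
      by_cases h' : l' = l
      · subst h'
        simp only [Function.update_self, X.hom.map_d, X.γ_iA]
      · simp [h']

/-- Replacing an argument by its image in A preserves its degree, so the weight of a word descends.
-/
theorem Extension.exists_freeWeight : ∃ E : FreeAModule A C →ₗ[K] FreeAModule A C,
    ∀ i, ∀ s ∈ LinearMap.range X.J, s ∈ X.S.gr i → E (X.κ s) = (2 : K) ^ i • X.κ s := by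
  obtain ⟨E, hE⟩ := X.S.exists_weight
  obtain ⟨E', hE'⟩ := X.exists_descend (X.κ ∘ₗ E) fun j p μ e s x hμ hs hx => by
    have hs' : ∀ l, l ≠ j → X.iA (X.γ (s l)) ∈ X.S.gr (e l) :=
      fun l hl => X.iA_mem (X.γ_mem (hs l hl))
    rw [LinearMap.comp_apply, LinearMap.comp_apply,
      hE _ _ (X.S.op_mem hμ (mem_update' hs (X.iC_mem hx))),
      hE _ _ (X.S.op_mem hμ (mem_update' hs' (X.iC_mem hx))), map_smul, map_smul,
      X.κ_congr j _ hs hs' (fun l _ => by simp) hx]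
  refine ⟨E', fun i s hs hi => ?_⟩
  rw [hE' s hs, LinearMap.comp_apply, hE i s hi, map_smul]

theorem Extension.exists_freeAct {k : ℕ} (j : Fin k) :
    ∃ L : P.obj k →ₗ[K] FreeAModule A C →ₗ[K]
      MultilinearMap K (fun _ : {l : Fin k // l ≠ j} => (A : Type u)) (FreeAModule A C),
    ∀ (μ : P.obj k), ∀ s ∈ LinearMap.range X.J, ∀ a : Fin k → A, L μ (X.κ s) (fun l => a l) =
      X.κ (X.S.selfModule.act j μ s fun l => X.iA (a l)) := by
  -- After `flip`, G is a map of s with values in maps of the operation and the arguments, so a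
  -- single descent yields the whole action.
  let G : P.obj k →ₗ[K] X.S.carrier →ₗ[K]
      MultilinearMap K (fun _ : {l : Fin k // l ≠ j} => (A : Type u)) (FreeAModule A C) :=
    (X.S.selfAct j).compr₂ (MultilinearMap.compLinearMapₗ (fun _ : {l : Fin k // l ≠ j} => X.iA) ∘ₗ
      LinearMap.compMultilinearMapₗ K X.κ)
  have hG : ∀ μ s (a : {l : Fin k // l ≠ j} → A), G μ s a =
      X.κ (X.S.selfAct j μ s fun l => X.iA (a l)) := fun μ s a => rfl
  obtain ⟨L, hL⟩ := X.exists_descend (W := P.obj k →ₗ[K]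
      MultilinearMap K (fun _ : {l : Fin k // l ≠ j} => (A : Type u)) (FreeAModule A C)) G.flip (by
    intro n t p μ e s x hμ hs hx
    refine LinearMap.ext fun ρ => ?_
    refine multilinear_ext_homogeneous (Y := fun _ => A.toDGModule) fun d a ha => ?_
    have h1 : ∀ s' : X.S, G.flip s' ρ a = X.κ (X.S.op ρ (Function.update
        (fun l => X.iA (if hl : l ≠ j then a ⟨l, hl⟩ else 0)) j s')) := fun s' => by
      rw [← X.S.selfAct_apply, LinearMap.flip_apply, hG]
      congr 2
      funext l
      rw [dif_pos l.2]
    have h2 : ∀ l, l ≠ j → X.iA (if hl : l ≠ j then a ⟨l, hl⟩ else 0) ∈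
        X.S.gr (if hl : l ≠ j then d ⟨l, hl⟩ else 0) := fun l hl => by
      rw [dif_pos hl, dif_pos hl]
      exact X.iA_mem (ha _)
    rw [h1, h1, X.κ_op_op j t ρ hμ h2 hs hx,
      X.κ_op_op j t ρ hμ h2 (fun l hl => X.iA_mem (X.γ_mem (hs l hl))) hx]
    simp)
  refine ⟨L.flip, fun μ s hs a => ?_⟩
  rw [LinearMap.flip_apply, hL s hs]
  rfl

end Extension

section Extension

variable [CharZero K] {P : Operad K} {A : PAlgebra P} {C : DGModule K} (X : Extension A C)

/-- The free module as a dg module; its elements are represented by the elements of the free algebra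
that lie in the span of the words with one letter in `C`. -/
def Extension.freeDG : DGModule K where
  carrier := FreeAModule A C
  gr i := (LinearMap.range X.J ⊓ X.S.gr i).map X.κ
  isInternal := by
    obtain ⟨E, hE⟩ := X.exists_freeWeight
    refine isInternal_of_weight _ E ?_ ?_
    · rintro i _ ⟨s, hs, rfl⟩
      exact hE i s hs.1 hs.2
    · rw [eq_top_iff]
      intro w _
      obtain ⟨s, hs, rfl⟩ := X.exists_κ_eq w
      suffices h : LinearMap.range X.J ≤
        (⨆ i, (LinearMap.range X.J ⊓ X.S.gr i).map X.κ).comap X.κ from h hs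
      refine X.range_J_le fun j p e μ x a hμ hx ha => ?_
      exact Submodule.mem_iSup_of_mem (p + ∑ l, e l) ⟨_, ⟨X.word_mem_range _ _ _ _,
        X.S.op_mem hμ (mem_update' (fun l _ => X.iA_mem (ha l)) (X.iC_mem hx))⟩, rfl⟩
  d := X.exists_freeD.choose
  d_mem := by
    rintro i _ ⟨s, hs, rfl⟩
    exact ⟨_, ⟨X.d_mem_range hs.1, X.S.d_mem hs.2⟩, (X.exists_freeD.choose_spec s hs.1).symm⟩
  d_d w := by
    obtain ⟨s, hs, rfl⟩ := X.exists_κ_eq w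
    rw [X.exists_freeD.choose_spec s hs, X.exists_freeD.choose_spec _ (X.d_mem_range hs), X.S.d_d,
      map_zero]

theorem Extension.freeDG_d {s : X.S} (hs : s ∈ LinearMap.range X.J) :
    X.freeDG.d (X.κ s) = X.κ (X.S.d s) :=
  X.exists_freeD.choose_spec s hs

/-- The action of `A` on the free module. -/
def Extension.freeAct {k : ℕ} (j : Fin k) : P.obj k →ₗ[K] X.freeDG.carrier →ₗ[K]
    MultilinearMap K (fun _ : {l : Fin k // l ≠ j} => (A : Type u)) X.freeDG.carrier :=
  (X.exists_freeAct j).choose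

theorem Extension.freeAct_κ {k : ℕ} (j : Fin k) (μ : P.obj k) {s : X.S}
    (hs : s ∈ LinearMap.range X.J) (a : Fin k → A) :
    X.freeAct j μ (X.κ s) (fun l => a l) = X.κ (X.S.op μ (Function.update (fun l => X.iA (a l)) j s)) :=
  ((X.exists_freeAct j).choose_spec μ s hs a).trans
    (congrArg X.κ (X.S.selfModule_act j μ s fun l => X.iA (a l)))

/-- The free module over `A`, with the differential given by those of `P`, `A` and `C`. -/
def Extension.freeModule : AModule A where
  toDGModule := X.freeDG
  act j := X.freeAct j
  act_mem := by
    rintro k j p e μ _ a hμ ⟨s, hs, rfl⟩ ha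
    rw [X.freeAct_κ j μ hs.1]
    exact ⟨_, ⟨X.op_mem_range j μ ha hs.1,
      X.S.op_mem hμ (mem_update' (fun l hl => X.iA_mem (ha l hl)) hs.2)⟩, rfl⟩
  act_d := by
    rintro k j p e μ _ a hμ ⟨s, hs, rfl⟩ ha
    have hm : ∀ l, l ≠ j → X.iA (a l) ∈ X.S.gr (e l) := fun l hl => X.iA_mem (ha l hl)
    rw [X.freeAct_κ j μ hs.1, X.freeAct_κ j _ hs.1, X.freeDG_d (X.op_mem_range j μ ha hs.1),
      X.S.op_d hμ (mem_update' hm hs.2), map_add, map_sum]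
    congr 1
    refine Finset.sum_congr rfl fun l _ => ?_
    rw [map_smul]
    congr 1
    split_ifs with h
    · subst h
      rw [X.freeDG_d hs.1, X.freeAct_κ l μ (X.d_mem_range hs.1), Function.update_self,
        Function.update_idem]
    · rw [X.freeAct_κ j μ hs.1, Function.update_of_ne h, Function.update_comm (Ne.symm h)]
      congr 3
      funext l'
      by_cases h' : l' = l
      · subst h'; simp [X.d_iA]
      · simp [h']
  act_one w := by
    obtain ⟨s, hs, rfl⟩ := X.exists_κ_eq w
    rw [X.freeAct_κ 0 P.one hs fun _ => 0]
    rw [show Function.update (fun _ : Fin 1 => X.iA 0) 0 s = fun _ => s from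
      funext fun l => by rw [Subsingleton.elim l 0, Function.update_self], X.S.op_one]
  act_map := by
    rintro k k' σ j μ e _ a ⟨s, hs, rfl⟩ ha
    have h := X.S.selfModule.act_map σ j μ (a := fun l => X.iA (a l)) hs.2
      fun l hl => X.iA_mem (ha l hl)
    rw [X.S.selfModule_act _ _ _ fun l => X.iA (a l),
      X.S.selfModule_act _ _ _ fun l => X.iA (a (σ l))] at h
    rw [X.freeAct_κ (σ j) _ hs.1, X.freeAct_κ j μ hs.1 fun l => a (σ l), h, map_smul]
    rfl
  act_comp := by
    rintro k i j l₀ μ q ν r _ a hν ⟨s, hs, rfl⟩ ha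
    have h := X.S.selfModule.act_comp i j l₀ μ (a := fun y => X.iA (a y)) hν hs.2
      fun l hl => X.iA_mem (ha l hl)
    have ha' : ∀ l, l ≠ l₀ → a ⟨j, l⟩ ∈ A.gr (r ⟨j, l⟩) := fun l hl =>
      ha _ fun h => hl (eq_of_heq (Sigma.mk.inj h).2)
    have hop : ∀ j', j' ≠ j → X.S.op (ν j') (fun y => X.iA (a ⟨j', y⟩)) ∈
        X.S.gr (q j' + ∑ l, r ⟨j', l⟩) := fun j' hj =>
      X.S.op_mem (hν j') fun y => X.iA_mem (ha _ fun h => hj (congrArg Sigma.fst h))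
    rw [X.S.selfModule_act _ _ _ fun y => X.iA (a (finSigmaFinEquiv.symm y)),
      X.S.selfModule_act _ _ _ fun l => X.iA (a ⟨j, l⟩),
      X.S.selfModule_act _ _ _ fun j' => X.S.op (ν j') fun l => X.iA (a ⟨j', l⟩)] at h
    -- The arguments γ_S(ν_{j'}; …) with j' ≠ j are not letters of A, but under κ they may be
    -- replaced by their values in A.
    rw [X.freeAct_κ _ _ hs.1 fun y => a (finSigmaFinEquiv.symm y),
      X.freeAct_κ l₀ (ν j) hs.1 fun l => a ⟨j, l⟩,
      X.freeAct_κ j μ (X.op_mem_range l₀ (ν j) ha' hs.1) fun j' => A.op (ν j') fun l => a ⟨j', l⟩,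
      h, map_smul, X.κ_op_of_mem j μ hop (X.op_mem_range l₀ (ν j) ha' hs.1)]
    simp only [X.hom.map_op, X.γ_iA]
    rfl

theorem Extension.freeModule_act {k : ℕ} (j : Fin k) (μ : P.obj k) {s : X.S}
    (hs : s ∈ LinearMap.range X.J) (a : Fin k → A) :
    X.freeModule.act j μ (X.κ s) (fun l => a l) =
      X.κ (X.S.op μ (Function.update (fun l => X.iA (a l)) j s)) :=
  X.freeAct_κ j μ hs a

/-- The inclusion of the generators in the free module. -/
def Extension.freeIncl : C →ₗ[K] X.freeModule.toDGModule := X.κ ∘ₗ X.iC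

theorem Extension.freeIncl_mem : X.freeIncl ∈ homGr C X.freeModule.toDGModule 0 := fun i x hx => by
  rw [add_zero]
  exact ⟨_, ⟨X.iC_mem_range x, X.iC_mem hx⟩, rfl⟩

theorem Extension.d_freeIncl (x : C) : X.freeModule.d (X.freeIncl x) = X.freeIncl (C.d x) :=
  (X.freeDG_d (X.iC_mem_range x)).trans (congrArg X.κ (X.d_iC x))

theorem Extension.eval_freeIncl :
    X.freeModule.eval X.freeIncl X.freeIncl_mem = (LinearMap.id : FreeAModule A C →ₗ[K] _) := by
  refine Submodule.linearMap_qext _ (freeRaw_ext fun j p e μ x a hμ hx ha => ?_)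
  refine Eq.trans (X.freeModule.evalRaw_word X.freeIncl j μ x a) ?_
  refine (X.freeModule_act j μ (X.iC_mem_range x) a).trans ?_
  rw [← X.J_word, X.κ_J]
  rfl

end Extension

/-- The free graded module over `A`, with its untwisted differential. -/
theorem exists_freeModule [CharZero K] {P : Operad K} (A : PAlgebra P) (C : DGModule K) :
    ∃ (T : AModule A) (ι : C →ₗ[K] T.toDGModule) (hι : ι ∈ homGr C T.toDGModule 0),
      Function.Bijective (T.eval ι hι) ∧ ∀ x, T.d (ι x) = ι (C.d x) := by
  obtain ⟨X⟩ := nonempty_extension A C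
  refine ⟨X.freeModule, X.freeIncl, X.freeIncl_mem, ?_, X.d_freeIncl⟩
  rw [show X.freeModule.eval X.freeIncl X.freeIncl_mem = _ from X.eval_freeIncl]
  exact Function.bijective_id

/-! ### Maps of modules and their extension from generators -/

section

variable {P : Operad K} {A : PAlgebra P}

theorem AModule.eval_word (M : AModule A) {C : DGModule K} (ι : C →ₗ[K] M.toDGModule)
    (hι : ι ∈ homGr C M.toDGModule 0) {n : ℕ} (j : Fin n) (μ : P.obj n) (x : C) (a : Fin n → A) :
    M.eval ι hι (freeMk A C j μ x fun l => a l) = M.act j μ (ι x) fun l => a l := by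
  rw [freeMk_apply, Submodule.mkQ_apply, AModule.eval, Submodule.liftQ_apply, AModule.evalRaw_word]

/-- The equation that defines the maps of `A`-modules can be tested on homogeneous elements. -/
theorem mem_homA_of_homogeneous {T M : AModule A} {n : ℤ} {h : T.toDGModule →ₗ[K] M.toDGModule}
    (h₁ : h ∈ homGr T.toDGModule M.toDGModule n)
    (h₂ : ∀ {k : ℕ} (j : Fin k) {p : ℤ} {e : Fin k → ℤ} {μ : P.obj k} {t : T} {a : Fin k → A},
      μ ∈ (P.obj k).gr p → t ∈ T.gr (e j) → (∀ l, l ≠ j → a l ∈ A.gr (e l)) →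
      h (T.act j μ t fun l => a l) =
        ksign K (n * (p + before e j)) • M.act j μ (h t) fun l => a l) : h ∈ homA T M n := by
  refine ⟨h₁, fun {k} j {p e μ t a} hμ ha => ?_⟩
  have ht : t ∈ Submodule.span K {t | ∃ i, t ∈ T.gr i} := by
    rw [DGModule.span_homogeneous]; trivial
  induction ht using Submodule.span_induction with
  | zero => simp
  | add t t' _ _ h h' => simp [h, h']
  | smul r t _ h => simp [h, smul_comm r]
  | mem t ht =>
    obtain ⟨i, ht⟩ := ht
    -- The degree listed at j is not used by `before e j`, so it can be set to that of t.
    have h3 := h₂ j (e := Function.update e j i) (a := a) hμ (by simpa using ht) fun l hl => by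
      simpa [hl] using ha l hl
    rw [h3]
    congr 3
    rw [before, before]
    congr 1
    refine Finset.sum_congr rfl fun l hl => ?_
    rw [Function.update_of_ne (Finset.mem_Iio.1 hl).ne]

/-- The maps of `A`-modules form a complex. -/
theorem homD_mem_homA {T M : AModule A} {n : ℤ} {h : T.toDGModule →ₗ[K] M.toDGModule}
    (hh : h ∈ homA T M (n + 1)) : homD T.toDGModule M.toDGModule (n + 1) h ∈ homA T M n := by
  refine mem_homA_of_homogeneous (homD_mem hh.1 _) fun {k} j {p e μ t a} hμ ht ha => ?_
  have hht : h t ∈ M.gr ((e + Pi.single j (n + 1) : Fin k → ℤ) j) := by simpa using hh.1 _ _ ht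
  have ha' : ∀ l, l ≠ j → a l ∈ A.gr ((e + Pi.single j (n + 1) : Fin k → ℤ) l) := fun l hl => by
    simpa [hl] using ha l hl
  have hu : ∀ l, l ≠ j → ∀ m, m ≠ j → Function.update a l (A.d (a l)) m ∈
      A.gr ((e + Pi.single l (-1) : Fin k → ℤ) m) := fun l hl m hm => by
    by_cases h : m = l
    · subst h; simpa [sub_eq_add_neg] using A.d_mem (ha m hm)
    · simpa [h] using ha m hm
  rw [homD_apply, hh.2 j hμ ha, map_smul, M.act_d j hμ hht ha', T.act_d j hμ ht ha, map_add,
    hh.2 j ((P.obj k).d_mem hμ) ha, map_sum, smul_add, smul_add, smul_smul, ← ksign_add,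
    add_sub_add_comm, ksign_congr (a := n + 1 + (n + 1) * (p - 1 + before e j))
      (b := (n + 1) * (p + before e j)) 0 (by ring), sub_self, zero_add, Finset.smul_sum,
    Finset.smul_sum, ← Finset.sum_sub_distrib, Finset.sum_eq_single j]
  · rw [if_pos rfl, if_pos rfl, before_add, before_single, if_neg (lt_irrefl j), map_smul,
      hh.2 j hμ ha, homD_apply, map_sub, map_smul, smul_smul, smul_smul, smul_smul,
      _root_.sub_apply, _root_.smul_apply, smul_sub, smul_smul, ← ksign_add, ← ksign_add,
      ← ksign_add, ← ksign_add]
    congr 2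
    · exact ksign_congr (p + before e j) (by ring)
    · exact ksign_congr (p + before e j) (by ring)
  · intro l _ hl
    rw [if_neg hl, if_neg hl, map_smul, hh.2 j hμ (hu l hl), smul_smul, smul_smul, smul_smul,
      ← ksign_add, ← ksign_add, ← ksign_add, sub_eq_zero, before_add, before_single, before_add,
      before_single]
    congr 1
    rcases lt_or_gt_of_ne hl with h | h
    · rw [if_pos h, if_neg h.asymm]
      exact ksign_congr 0 (by ring)
    · rw [if_neg h.asymm, if_pos h]
      exact ksign_congr 0 (by ring)
  · simp

/-- The maps of `A`-modules as a dg module. -/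
theorem isDGFamily_homA (T M : AModule A) :
    IsDGFamily (homA T M) (homD T.toDGModule M.toDGModule) :=
  ⟨fun _ _ hD => homD_mem_homA hD, fun n D _ => homD_homD n D⟩

/-- A map of modules on the values of `α[ψ, -]`. -/
theorem homA_bracket {Q : Cooperad K} {α : OperadicTwisting Q P} {C : QCoalgebra Q}
    {T M : AModule A} {n s : ℤ} {h : T.toDGModule →ₗ[K] M.toDGModule} (hh : h ∈ homA T M n)
    {ψ : C.toDGModule →ₗ[K] A.toDGModule} (hψ : ψ ∈ homGr C.toDGModule A.toDGModule 0)
    (g : C.toDGModule →ₗ[K] T.toDGModule) (c : C) :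
    h (bracket α T s ψ g c) = ksign K n • bracket α M (s + n) ψ (h ∘ₗ g) c := by
  have h1 : ∀ k, h ∘ₗ bracketTerm α T s ψ g k =
      ksign K n • bracketTerm α M (s + n) ψ (h ∘ₗ g) k := by
    rintro (_ | k)
    · simp [bracketTerm]
    rw [bracketTerm_eq, bracketTerm_eq, LinearMap.comp_smul, smul_comm]
    congr 1
    refine tensor_ext_homogeneous (X := Q.obj (k + 1)) (Y := fun _ => C.toDGModule)
      fun p e μ y hμ hy => ?_
    have hψy : ∀ l, l ≠ Fin.last k → (fun l => ψ (y l)) l ∈ A.gr (e l) :=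
      fun l _ => mem_of_mem_homGr_zero hψ (hy l)
    rw [LinearMap.comp_apply, LinearMap.smul_apply, bracketAt_tprod _ hμ hy,
      bracketAt_tprod _ hμ hy, map_smul, hh.2 (Fin.last k) (α.mem _ hμ) hψy, smul_smul, smul_smul, ← ksign_add, ← ksign_add]
    congr 1
    -- As for derivations, the factor (-1)^n reflects that h passes α(μ) of degree p - 1.
    exact ksign_congr (-n) (by ring)
  have h2 : h ∘ₗ DirectSum.toModule K ℕ T.toDGModule (bracketTerm α T s ψ g) =
      ksign K n • DirectSum.toModule K ℕ M.toDGModule (bracketTerm α M (s + n) ψ (h ∘ₗ g)) := by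
    refine DirectSum.linearMap_ext K fun k => LinearMap.ext fun t => ?_
    have := LinearMap.congr_fun (h1 k) t
    simpa using this
  exact LinearMap.congr_fun h2 (C.δ c)

end

section Extension

variable {P : Operad K} {A : PAlgebra P} {C : DGModule K}

section

variable {T : AModule A} {ι : C →ₗ[K] T.toDGModule} {hι : ι ∈ homGr C T.toDGModule 0}
  (hb : Function.Bijective (T.eval ι hι)) {M : AModule A}

include hb

theorem homA_ext {n : ℤ} {h h' : T.toDGModule →ₗ[K] M.toDGModule} (hh : h ∈ homA T M n)
    (hh' : h' ∈ homA T M n) (H : h ∘ₗ ι = h' ∘ₗ ι) : h = h' := by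
  have h1 : h ∘ₗ T.eval ι hι = h' ∘ₗ T.eval ι hι := by
    refine Submodule.linearMap_qext _ (freeRaw_ext fun j p e μ x a hμ hx ha => ?_)
    have h2 : T.eval ι hι (Submodule.mkQ _ (freeWord A j μ x a)) = T.act j μ (ι x) fun l => a l := by
      rw [← freeMk_apply, T.eval_word]
    simp only [LinearMap.comp_apply]
    rw [h2, hh.2 j hμ fun l _ => ha l, hh'.2 j hμ fun l _ => ha l]
    have := LinearMap.congr_fun H x
    rw [LinearMap.comp_apply, LinearMap.comp_apply] at this
    rw [this]
  ext t
  obtain ⟨y, rfl⟩ := hb.2 t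
  exact LinearMap.congr_fun h1 y

end

section

variable [CharZero K] (X : Extension A C) {M : AModule A}

/-- The terms of the Leibniz rule with D at another position contain both γ s and D (b_l), so either
vanishing condition removes them. The first is used for letters of C, the second for letters of A,
on which D vanishes. -/
theorem Extension.der_op {n : ℤ} {D : X.S.toDGModule →ₗ[K] M.toDGModule}
    (hD : D ∈ der X.S X.γ M n) {k : ℕ} (j : Fin k) {p : ℤ} {e : Fin k → ℤ} {μ : P.obj k}
    {b : Fin k → X.S} {s : X.S} (hμ : μ ∈ (P.obj k).gr p)
    (hb : ∀ l, l ≠ j → b l ∈ X.S.gr (e l)) (hs : s ∈ X.S.gr (e j))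
    (h : X.γ s = 0 ∨ ∀ l, l ≠ j → D (b l) = 0) :
    D (X.S.op μ (Function.update b j s)) =
      ksign K (n * (p + before e j)) • M.act j μ (D s) fun l => X.γ (b l) := by
  rw [hD.2 hμ (mem_update' hb hs), Finset.sum_eq_single_of_mem j (Finset.mem_univ j),
    Function.update_self]
  · congr 2
    funext l
    rw [Function.update_of_ne l.2]
  · intro l _ hl
    rw [Function.update_of_ne hl]
    rcases h with h | h
    · rw [MultilinearMap.map_coord_zero _ ⟨j, Ne.symm hl⟩, smul_zero]
      rw [Function.update_self, h]
    · rw [h l hl, map_zero, _root_.zero_apply, smul_zero]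

theorem Extension.exists_der (n : ℤ) {g : C →ₗ[K] M.toDGModule}
    (hg : g ∈ homGr C M.toDGModule n) :
    ∃ D ∈ der X.S X.γ M n, (∀ a, D (X.iA a) = 0) ∧ ∀ x, D (X.iC x) = g x := by
  let pr : A.toDGModule.prod C →ₗ[K] C.carrier := LinearMap.snd K A.carrier C.carrier
  obtain ⟨D, hD, hDι⟩ := DGOperad.exists_der X.bijective (M := M) X.hom.mem X.hom.map_op (s := n)
    (g := g ∘ₗ pr) fun i x hx => hg i _ hx.2
  exact ⟨D, hD, fun a => (LinearMap.congr_fun hDι _).trans (map_zero g),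
    fun x => LinearMap.congr_fun hDι _⟩

end

section

variable [CharZero K] {T : AModule A} {ι : C →ₗ[K] T.toDGModule} {hι : ι ∈ homGr C T.toDGModule 0}
  (hb : Function.Bijective (T.eval ι hι)) {M : AModule A}

include hb

/-- Maps on the generators of a free module extend to maps of modules. -/
theorem exists_homA {n : ℤ} {g : C →ₗ[K] M.toDGModule} (hg : g ∈ homGr C M.toDGModule n) :
    ∃ h ∈ homA T M n, h ∘ₗ ι = g := by
  obtain ⟨X⟩ := nonempty_extension A C
  -- Both derivations vanish on A. On the range of `J`, D₀ is κ followed by the evaluation in T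
  -- (`h0`), so the map sought is characterised by h (D₀ s) = D s there.
  obtain ⟨D₀, hD₀, hA₀, hC₀⟩ := X.exists_der 0 hι
  obtain ⟨D, hD, hA, hC⟩ := X.exists_der n hg
  obtain ⟨L, hL⟩ := X.exists_descend D fun j p μ e s x hμ hs hx => by
    rw [X.der_op hD j hμ hs (X.iC_mem hx) (Or.inl (X.γ_iC x)),
      X.der_op hD j hμ (fun l hl => X.iA_mem (X.γ_mem (hs l hl))) (X.iC_mem hx)
        (Or.inl (X.γ_iC x))]
    simp
  have h0 : ∀ s ∈ LinearMap.range X.J, T.eval ι hι (X.κ s) = D₀ s := by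
    intro s hs
    suffices h : LinearMap.range X.J ≤ LinearMap.eqLocus (T.eval ι hι ∘ₗ X.κ) D₀ from h hs
    refine X.range_J_le fun j p e μ x a hμ hx ha => ?_
    rw [LinearMap.mem_eqLocus, LinearMap.comp_apply,
      X.κ_op j μ (fun l _ => X.iA_mem (ha l)) hx,
      X.der_op hD₀ j hμ (fun l _ => X.iA_mem (ha l)) (X.iC_mem hx) (Or.inl (X.γ_iC x)), hC₀,
      zero_mul, ksign_zero, one_smul, T.eval_word ι hι j μ x fun l => X.γ (X.iA (a l))]
  let E := LinearEquiv.ofBijective (T.eval ι hι) hb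
  let h : T.toDGModule →ₗ[K] M.toDGModule := L ∘ₗ E.symm.toLinearMap
  have hh : ∀ s ∈ LinearMap.range X.J, h (D₀ s) = D s := fun s hs => by
    rw [← h0 s hs]
    have : E.symm (T.eval ι hι (X.κ s)) = X.κ s := E.symm_apply_apply _
    simp only [h, LinearMap.comp_apply, LinearEquiv.coe_coe, this]
    exact hL s hs
  -- Homogeneous elements of T are values of D₀ at homogeneous elements of the range of `J`, because
  -- the bijective evaluation reflects degrees.
  have hT : ∀ i, ∀ t ∈ T.gr i, ∃ s ∈ LinearMap.range X.J, s ∈ X.S.gr i ∧ D₀ s = t := by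
    intro i t ht
    obtain ⟨w, rfl⟩ := hb.2 t
    have hw : w ∈ X.freeDG.gr i := by
      refine DGModule.mem_of_bijective (X := X.freeDG) (Y := T.toDGModule) (f := T.eval ι hι)
        ?_ hb.1 ht
      rintro i _ ⟨s, hs, rfl⟩
      exact Set.mem_of_eq_of_mem (h0 s hs.1) (hD₀.1 i s hs.2)
    obtain ⟨s, hs, rfl⟩ := hw
    exact ⟨s, hs.1, hs.2, (h0 s hs.1).symm⟩
  refine ⟨h, mem_homA_of_homogeneous ?_ ?_, ?_⟩
  · intro i t ht
    obtain ⟨s, hs, hi, rfl⟩ := hT i t ht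
    rw [hh s hs]
    exact hD.1 i s hi
  · intro k j p e μ t a hμ ht ha
    obtain ⟨s, hs, hi, rfl⟩ := hT _ t ht
    have h1 := X.der_op hD₀ j hμ (fun l hl => X.iA_mem (ha l hl)) hi (Or.inr fun l _ => hA₀ (a l))
    have h2 := X.der_op hD j hμ (fun l hl => X.iA_mem (ha l hl)) hi (Or.inr fun l _ => hA (a l))
    simp only [X.γ_iA, zero_mul, ksign_zero, one_smul] at h1 h2
    rw [← h1, hh _ (X.op_mem_range j μ ha hs), h2, hh s hs]
  · ext x
    rw [LinearMap.comp_apply, ← hC₀ x, hh _ (X.iC_mem_range x), hC]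

end

end Extension

/-! ### The twisted differential of the free module -/

section

variable {X Y : DGModule K} {H : ℤ → Submodule K (X →ₗ[K] Y)}
  {D : ℤ → (X →ₗ[K] Y) →ₗ[K] (X →ₗ[K] Y)}

theorem IsDGFamily.map_mem_of_eq (h : IsDGFamily H D) {n m : ℤ} (hm : m = n + 1)
    {f : X →ₗ[K] Y} (hf : f ∈ H m) : D m f ∈ H n := by
  subst hm
  exact h.map_mem n f hf

theorem IsDGFamily.sq_zero_of_eq (h : IsDGFamily H D) {m l : ℤ} (hl : l = m + 1)
    {f : X →ₗ[K] Y} (hf : f ∈ H l) : D m (D l f) = 0 := by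
  obtain ⟨n, rfl⟩ : ∃ n, m = n + 1 := ⟨m - 1, by ring⟩
  subst hl
  exact h.sq_zero n f hf

end

section

variable {P : Operad K} {A : PAlgebra P}

/-- The dg module with the differential changed by a map of modules. -/
def AModule.twist (T : AModule A) {h : T.carrier →ₗ[K] T.carrier} (hh : h ∈ homA T T (-1))
    (hsq : ∀ x, (T.d - h) ((T.d - h) x) = 0) : AModule A where
  carrier := T.carrier
  gr := T.gr
  isInternal := T.isInternal
  d := T.d - h
  d_mem {i x} hx := Submodule.sub_mem _ (T.d_mem hx) (by
    have := hh.1 i x hx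
    rwa [← sub_eq_add_neg] at this)
  d_d := hsq
  act := T.act
  act_mem := T.act_mem
  act_d {k} j {p e μ m a} hμ hm ha := by
    rw [LinearMap.sub_apply, T.act_d j hμ hm ha, hh.2 j hμ ha, add_sub_assoc]
    congr 1
    have h1 : ksign K (-1 * (p + before e j)) • T.act j μ (h m) (fun l => a l) =
        ∑ l, ksign K (p + before e l) • if l = j then T.act j μ (h m) (fun l => a l) else 0 := by
      rw [Finset.sum_eq_single_of_mem j (Finset.mem_univ j) fun l _ hl => by rw [if_neg hl, smul_zero],
        if_pos rfl, neg_one_mul, ksign_neg]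
    rw [h1, ← Finset.sum_sub_distrib]
    refine Finset.sum_congr rfl fun l _ => ?_
    rw [← smul_sub]
    split_ifs with hl
    · rw [LinearMap.sub_apply, map_sub, _root_.sub_apply]
    · rw [sub_zero]
  act_one := T.act_one
  act_map := T.act_map
  act_comp := T.act_comp

variable {Q : Cooperad K} {α : OperadicTwisting Q P} {C : QCoalgebra Q}

theorem homA_comp_self {T : AModule A} {h : T.toDGModule →ₗ[K] T.toDGModule}
    (hh : h ∈ homA T T (-1)) : h ∘ₗ h ∈ homA T T (-2) := by
  refine ⟨fun i x hx => ?_, fun {k} j {p e μ t a} hμ ha => ?_⟩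
  · have := hh.1 _ _ (hh.1 _ _ hx)
    rwa [add_assoc] at this
  · rw [LinearMap.comp_apply, hh.2 j hμ ha, map_smul, hh.2 j hμ ha, smul_smul, ← ksign_add,
      LinearMap.comp_apply]
    congr 1
    exact ksign_congr 0 (by ring)

/-- (d - h)² = h² - ∂(h), and both h² and ∂(h) are maps of modules of degree -2, so generators
suffice. Since ι commutes with the untwisted differentials, ∂_φ(ι) = α[φ, ι] = hι, and the required
equation on generators is ∂_φ(∂_φ(ι)) = 0 with values in the untwisted module. -/
theorem twisted_free_sq_zero [CharZero K] (φ : AlgebraicTwisting α C A) {T : AModule A}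
    {ι : C.toDGModule →ₗ[K] T.toDGModule} (hι : ι ∈ homGr C.toDGModule T.toDGModule 0)
    (hb : Function.Bijective (T.eval ι hι)) (hd : ∀ c, T.d (ι c) = ι (C.d c))
    {h : T.carrier →ₗ[K] T.carrier} (hh : h ∈ homA T T (-1))
    (hhι : h ∘ₗ ι = bracket α T 0 φ.toFun ι) (x : T) : (T.d - h) ((T.d - h) x) = 0 := by
  have h1 : homD T.toDGModule T.toDGModule (-1) h = h ∘ₗ h := by
    refine homA_ext hb ((isDGFamily_homA T T).map_mem_of_eq (by norm_num) hh) (homA_comp_self hh) ?_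
    have h2 := (isDGFamily_twistedD φ T).sq_zero_of_eq (m := -1) (by norm_num) hι
    have h3 : twistedD φ T 0 ι = h ∘ₗ ι := by
      rw [hhι]
      ext c
      change homD C.toDGModule T.toDGModule 0 ι c + bracket α T 0 φ.toFun ι c = _
      rw [homD_apply, hd, ksign_zero, one_smul, sub_self, zero_add]
    rw [h3] at h2
    ext c
    have h4 : homD C.toDGModule T.toDGModule (-1) (h ∘ₗ ι) c +
        bracket α T (-1) φ.toFun (h ∘ₗ ι) c = 0 := LinearMap.congr_fun h2 c
    have h5 : h (h (ι c)) = -bracket α T (-1) φ.toFun (h ∘ₗ ι) c := by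
      have h6 := homA_bracket (α := α) (s := 0) hh φ.mem ι c
      rw [← hhι, zero_add, ksign_neg, ksign_one, neg_one_smul] at h6
      exact h6
    rw [LinearMap.comp_apply, LinearMap.comp_apply, LinearMap.comp_apply, h5, homD_apply, hd,
      ← eq_neg_of_add_eq_zero_left h4, homD_apply, LinearMap.comp_apply, LinearMap.comp_apply]
  have h2 := LinearMap.congr_fun h1 x
  rw [homD_apply, ksign_neg, ksign_one, neg_one_smul, LinearMap.comp_apply] at h2
  simp only [LinearMap.sub_apply, map_sub, T.d_d, ← h2]
  abel

/-- The free module with the twisted differential. -/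
theorem exists_twistedFreeModule [CharZero K] (φ : AlgebraicTwisting α C A) :
    ∃ (T : AModule A) (ι : C.toDGModule →ₗ[K] T.toDGModule), IsTwistedFreeModule φ T ι := by
  obtain ⟨T, ι, hι, hb, hd⟩ := exists_freeModule A C.toDGModule
  -- α[φ, ι] equals ∂_φ(ι), so its degree is known from the dg module Hom(C, T).
  have hB : bracket α T 0 φ.toFun ι ∈ homGr C.toDGModule T.toDGModule (-1) := by
    have h1 := (isDGFamily_twistedD φ T).map_mem_of_eq (n := -1) (by norm_num) hι
    have h2 : twistedD φ T 0 ι = bracket α T 0 φ.toFun ι := by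
      ext c
      change homD C.toDGModule T.toDGModule 0 ι c + bracket α T 0 φ.toFun ι c = _
      rw [homD_apply, hd, ksign_zero, one_smul, sub_self, zero_add]
    rwa [h2] at h1
  obtain ⟨h, hh, hhι⟩ := exists_homA hb hB
  refine ⟨T.twist hh (twisted_free_sq_zero φ hι hb hd hh hhι), ι, hι, hb, fun c => ?_⟩
  change T.d (ι c) - h (ι c) = ι (C.d c) - bracket α T 0 φ.toFun ι c
  rw [hd, ← hhι, LinearMap.comp_apply]

variable {φ : AlgebraicTwisting α C A} {T : AModule A} {ι : C.toDGModule →ₗ[K] T.toDGModule}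
  (hT : IsTwistedFreeModule φ T ι) {M : AModule A}

include hT

/-- The differential of maps of modules corresponds to the twisted differential. -/
theorem IsTwistedFreeModule.homD_comp {n : ℤ} {h : T.toDGModule →ₗ[K] M.toDGModule}
    (hh : h ∈ homA T M n) :
    homD T.toDGModule M.toDGModule n h ∘ₗ ι = twistedD φ M n (h ∘ₗ ι) := by
  ext c
  have h1 := homA_bracket (α := α) (s := 0) hh φ.mem ι c
  rw [zero_add] at h1
  rw [LinearMap.comp_apply, homD_apply, hT.d_generator, map_sub, h1, smul_sub, smul_smul,
    ksign_mul_self, one_smul, twistedD, LinearMap.add_apply, LinearMap.add_apply, homD_apply]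
  simp only [LinearMap.comp_apply, bracketOp, LinearMap.coe_mk, AddHom.coe_mk]
  abel

theorem IsTwistedFreeModule.comp_mem (n : ℤ) (h : T.toDGModule →ₗ[K] M.toDGModule)
    (hh : h ∈ homA T M n) : h ∘ₗ ι ∈ homGr C.toDGModule M.toDGModule n := fun _ _ hx =>
  hh.1 _ _ (mem_of_mem_homGr_zero hT.mem hx)

end

end

end DGOperad

/-! ### The isomorphisms -/

theorem mainTheorem5 {K : Type u} [Field K] [CharZero K] {P : Operad K} {Q : Cooperad K}
    (α : OperadicTwisting Q P) (A : PAlgebra P) (C : QCoalgebra Q) (φ : AlgebraicTwisting α C A) :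
    (∃ (R : PAlgebra P) (ι : C.toDGModule →ₗ[K] R.toDGModule)
      (f : R.toDGModule →ₗ[K] A.toDGModule), IsTwistedComposite φ R ι f) ∧
    (∃ (T : AModule A) (ι : C.toDGModule →ₗ[K] T.toDGModule), IsTwistedFreeModule φ T ι) ∧
    ∀ (R : PAlgebra P) (ιR : C.toDGModule →ₗ[K] R.toDGModule)
      (f : R.toDGModule →ₗ[K] A.toDGModule), IsTwistedComposite φ R ιR f →
    ∀ (T : AModule A) (ιT : C.toDGModule →ₗ[K] T.toDGModule), IsTwistedFreeModule φ T ιT →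
    ∀ M : AModule A,
      ∃ (hDer : IsDGFamily (der R f M) (homD R.toDGModule M.toDGModule))
        (hHom : IsDGFamily (homGr C.toDGModule M.toDGModule) (twistedD φ M))
        (hMod : IsDGFamily (homA T M) (homD T.toDGModule M.toDGModule))
        (e₁ : hDer.complex ≅ hHom.complex) (e₂ : hHom.complex ≅ hMod.complex),
        (∀ (n : ℤ) (D : der R f M n),
          ((hHom.equiv n).symm (e₁.hom.f n (hDer.equiv n D))).1 = D.1 ∘ₗ ιR) ∧
        (∀ (n : ℤ) (h : homA T M n),
          ((hHom.equiv n).symm (e₂.inv.f n (hMod.equiv n h))).1 = h.1 ∘ₗ ιT) := by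
  refine ⟨exists_twistedComposite φ, exists_twistedFreeModule φ,
    fun R ιR f hR T ιT hT M => ?_⟩
  have hDer := isDGFamily_der hR.augmentation M
  have hHom := isDGFamily_twistedD φ M
  have hMod := isDGFamily_homA T M
  choose r₁ hr₁ using fun n => exists_restriction_equiv (H := der R f M) hR.comp_mem hR.exists_der
    (fun _ _ hD _ hD' h => der_ext hR.bijective hD hD' h) n
  choose r₂ hr₂ using fun n => exists_restriction_equiv (H := homA T M) hT.comp_mem
    (fun _ _ hg => exists_homA hT.bijective hg)
    (fun _ _ hh _ hh' h => homA_ext hT.bijective hh hh' h) n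
  obtain ⟨E₁, hE₁, -⟩ := hDer.exists_iso hHom r₁ fun n D => by
    rw [hr₁, hr₁, hR.homD_comp D.2]
  -- Restriction runs from maps of modules to Hom(C, M), so the second isomorphism is the inverse of
  -- this one.
  obtain ⟨E₂, hE₂, -⟩ := hMod.exists_iso hHom r₂ fun n h => by
    rw [hr₂, hr₂, hT.homD_comp h.2]
  refine ⟨hDer, hHom, hMod, E₁, E₂.symm, fun n D => ?_, fun n h => ?_⟩
  · rw [hE₁, hr₁]
  · rw [CategoryTheory.Iso.symm_inv, hE₂, hr₂]
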